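/- Let $p(\cdot,\cdot)$ be the transition kernel of an irreducible random walk on $\mathbb{Z}^d$ (so $p(x,y)\ge 0$, $\sum_y p(x,y)=1$ and $p(x+z,y+z)=p(x,y)$), and let $p_t(\cdot,\cdot)=\sum_{n\ge 0}e^{-t}\frac{t^n}{n!}p^{(n)}(\cdot,\cdot)$ be the transition kernel of the associated rate-one continuous-time walk. Let $\rho\in(0,1)$, $\gamma\in(0,\infty)$ and $\kappa\in[0,\infty)$. Let $\xi=(\xi(x,t))_{x\in\mathbb{Z}^d,\,t\ge 0}$ be the voter model with kernel $p$ started from the Bernoulli product measure $\nu_\rho$ of density $\rho$, i.e. the càdlàg Markov process on $\{0,1\}^{\mathbb{Z}^d}$ with initial law $\nu_\rho$ whose generator acts on cylinder functions as $$Lf(\eta)=\sum_{x,y\in\mathbb{Z}^d}p(x,y)\,\bigl(f(\eta^{x,y})-f(\eta)\bigr),\qquad \eta^{x,y}(x)=\eta(y),\quad \eta^{x,y}(z)=\eta(z)\ \text{for } z\ne x$$ (as a solution of the martingale problem for $L$). Let $u\ge 0$ be the solution of the parabolic Anderson model $$\frac{\partial}{\partial t}u(x,t)=\kappa\sum_{y:\,|y-x|_1=1}\bigl(u(y,t)-u(x,t)\bigr)+\gamma\,\xi(x,t)\,u(x,t),\qquad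 u(x,0)=1,\qquad x\in\mathbb{Z}^d,\ t\ge 0,$$ where $u(x,\cdot)$ is continuous and $\partial/\partial t$ is the right derivative. If $p$ is symmetric, $p(x,y)=p(y,x)$, and strongly transient, $\int_0^\infty t\,p_t(0,0)\,dt<\infty$, then for every integer $q\ge 1$ and every $\kappa\in[0,\infty)$ the $q$-th annealed Lyapunov exponent $$\lambda_q(\kappa)=\lim_{t\to\infty}\frac1t\log\Bigl(\mathbb{E}_{\nu_\rho}\bigl[u(0,t)^q\bigr]^{1/q}\Bigr)$$ exists and satisfies $\lambda_q(\kappa)<\gamma$. -/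

import Mathlib

open MeasureTheory ProbabilityTheory Filter Topology
open scoped NNReal

noncomputable section

namespace VoterPAM

/-! ### Random walk kernels on `ℤ^d` -/

/-- The lattice `ℤ^d`. -/
abbrev Lattice (d : ℕ) : Type := Fin d → ℤ

/-- The `n`-step transition kernel `p^n(x, y)` of a kernel `p`. -/
def stepKernel {d : ℕ} (p : Lattice d → Lattice d → ℝ) : ℕ → Lattice d → Lattice d → ℝ
  | 0, x, y => if x = y then 1 else 0
  | n + 1, x, y => ∑' z, p x z * stepKernel p n z y

/-- `p` is the transition kernel of an irreducible random walk on `ℤ^d`: it is a stochastic,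
translation invariant and irreducible kernel. -/
structure IsRandomWalkKernel {d : ℕ} (p : Lattice d → Lattice d → ℝ) : Prop where
  nonneg : ∀ x y, 0 ≤ p x y
  hasSum_one : ∀ x, HasSum (p x) 1
  translation : ∀ x y z, p (x + z) (y + z) = p x y
  irreducible : ∀ x y, ∃ n, 0 < stepKernel p n x y

/-- The kernel `p_t(x, y)` of the continuous time random walk which jumps at rate one according
to `p`. -/
def timeKernel {d : ℕ} (p : Lattice d → Lattice d → ℝ) (t : ℝ) (x y : Lattice d) : ℝ :=
  ∑' n : ℕ, Real.exp (-t) * t ^ n / (n.factorial : ℝ) * stepKernel p n x y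

/-- Strong transience, `∫_0^∞ t p_t(0,0) dt < ∞` (the integrand is nonnegative). -/
def StronglyTransient {d : ℕ} (p : Lattice d → Lattice d → ℝ) : Prop :=
  IntegrableOn (fun t : ℝ => t * timeKernel p t 0 0) (Set.Ioi 0)

/-! ### The voter model -/

/-- Configurations `{0,1}^{ℤ^d}`; `true` stands for `1` (a particle), `false` for `0`. -/
abbrev Config (d : ℕ) : Type := Lattice d → Bool

/-- The configuration `η^{x,y}`: the site `x` adopts the value of the site `y`. -/
def adopt {d : ℕ} (η : Config d) (x y : Lattice d) : Config d :=
  Function.update η x (η y)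

/-- A cylinder function: it depends on finitely many coordinates. -/
def IsCylinder {d : ℕ} (f : Config d → ℝ) : Prop :=
  ∃ A : Finset (Lattice d), DependsOn f (A : Set (Lattice d))

/-- The voter generator, `(L f)(η) = ∑_x ∑_y p(x,y) (f(η^{x,y}) - f(η))`. For a cylinder function
`f` only finitely many `x` contribute, and the sum over `y` converges absolutely. -/
def voterGenerator {d : ℕ} (p : Lattice d → Lattice d → ℝ) (f : Config d → ℝ)
    (η : Config d) : ℝ :=
  ∑' x, ∑' y, p x y * (f (adopt η x y) - f η)

/-- The Bernoulli product measure `ν_ρ` of density `ρ` on `{0,1}^{ℤ^d}`. -/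
def bernoulliProduct (d : ℕ) (ρ : unitInterval) : Measure (Config d) :=
  Measure.infinitePi (fun _ : Lattice d => bernoulliMeasure true false ρ)

/-- `ξ` is a voter model with kernel `p` and initial law `μ`, relative to the filtration `ℱ`:
a càdlàg adapted process on `{0,1}^{ℤ^d}` (product topology) that starts from `μ` and is Markov
with generator `L`, in the sense that it solves the martingale problem
for `L` on cylinder functions. -/
structure IsVoterModel {d : ℕ} {Ω : Type*} [mΩ : MeasurableSpace Ω]
    (p : Lattice d → Lattice d → ℝ) (μ : Measure (Config d)) (P : Measure Ω)
    (ℱ : Filtration ℝ≥0 mΩ) (ξ : ℝ≥0 → Ω → Config d) : Prop where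
  adapted : ∀ t, Measurable[ℱ t] (ξ t)
  right_continuous : ∀ ω t, ContinuousWithinAt (fun s => ξ s ω) (Set.Ici t) t
  left_limits : ∀ ω t, ∃ η : Config d, Tendsto (fun s => ξ s ω) (𝓝[<] t) (𝓝 η)
  initial : P.map (ξ 0) = μ
  martingale : ∀ f : Config d → ℝ, IsCylinder f →
    Martingale (fun (t : ℝ≥0) ω => f (ξ t ω) - f (ξ 0 ω)
      - ∫ r in (0 : ℝ)..t, voterGenerator p f (ξ r.toNNReal ω)) ℱ P

/-! ### The parabolic Anderson model -/

/-- The discrete Laplacian `(Δ v)(x) = ∑_{y ∼ x} (v(y) - v(x))`; the nearest neighbours of `x` are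
`x + e_i` and `x - e_i`. -/
def latticeLaplacian {d : ℕ} (v : Lattice d → ℝ) (x : Lattice d) : ℝ :=
  ∑ i : Fin d, ((v (x + Pi.single i 1) - v x) + (v (x - Pi.single i 1) - v x))

/-- `u` is a (nonnegative) solution of the parabolic Anderson model
`∂u/∂t = κ Δu + γ ζ u`, `u(·, 0) = 1`, in the catalyst path `ζ`. A càdlàg catalyst jumps,
so the time derivative is the right derivative of the continuous
function `u(x, ·)`, at every `t ≥ 0`. -/
structure IsPAMSolution {d : ℕ} (κ γ : ℝ) (ζ : ℝ≥0 → Config d) (u : Lattice d → ℝ → ℝ) :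
    Prop where
  nonneg : ∀ x t, 0 ≤ t → 0 ≤ u x t
  initial : ∀ x, u x 0 = 1
  continuousOn : ∀ x, ContinuousOn (u x) (Set.Ici 0)
  equation : ∀ x t, 0 ≤ t →
    HasDerivWithinAt (u x)
      (κ * latticeLaplacian (fun y => u y t) x
        + γ * (if ζ t.toNNReal x then 1 else 0) * u x t)
      (Set.Ici t) t

/-- `l` is the `q`-th annealed Lyapunov exponent of the random field `u`:
`l = lim_{t → ∞} (1/t) log E[u(0,t)^q]^{1/q}`. -/
def IsAnnealedLyapunovExponent {d : ℕ} {Ω : Type*} [MeasurableSpace Ω] (P : Measure Ω)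
    (u : Lattice d → ℝ → Ω → ℝ) (q : ℕ) (l : ℝ) : Prop :=
  Tendsto (fun t : ℝ => 1 / t * Real.log ((∫ ω, u 0 t ω ^ q ∂P) ^ (1 / (q : ℝ)))) atTop (𝓝 l)

end VoterPAM

end

open scoped ENNReal

noncomputable section

/-! Multiplying `u` by `exp (2 d κ t)` removes the loss term of the Laplacian. The result `w` solves
a growth equation with nonnegative coefficients, whose nonnegative solutions are unique. It is
therefore given by its Picard series, which is built from the occupation variables of the catalyst
by sums, products, nonnegative multiples and time integrals. Statements about moments of `w` thus
reduce to joint occupation probabilities at finitely many space-time points. These are governed by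
duality: the probability that all sites of a finite set are occupied evolves, backwards in time, by
coalescing random walks, and at time zero each surviving walker costs a factor `ρ`.

Existence of the exponent. A comparison principle for coalescing flows (`IsCoalFlow.le_union`) gives
translation invariance in space and positive correlation between the past and a voter model started
afresh. Both pass to the Picard series (`OccDominates`). For the mass that starts at a single site,
the moments `a t z` then satisfy a convolution inequality, so `∑ z, a t z` is supermultiplicative
and Fekete's lemma applies. A box of radius of order `t` carries all but a bounded part of `w`, so
the sum and the moment for the datum `1` differ by a polynomial factor only.

Strict inequality. The core is `IsVoterModel.exists_moment_rate`: at `n` times with gaps at least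
`M`, the joint occupation probability is at most `r ^ n` with `r < 1`, uniformly in the sites. The
dual walkers start at times spaced by `M`. Strong transience says that `∑ (l + 1) P(S_l = 0)` is
finite, which bounds the expected number of later walkers that meet a given one by a constant over
`M`. An expectation does not give exponential decay by itself, so paths are sorted. A path is good
while the expected number of later walkers that meet it, given the path, is at most `ε`. Bad paths
are rare by Markov's inequality and are discarded, which only enlarges the occupation probability. A
walker that meets an earlier good path is discarded too. The expectation of `ρ` to the number of
remaining walkers is bounded by a product of factors linking each walker to earlier ones, and
independence with the deterministic bound `ε` controls that product (`lintegral_prod_link_le`).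

From there to the exponent: Young's inequality shows that the power `w ^ q`, after a further
exponential factor, is a subsolution of the same equation with potential `q γ ξ`. Iterating
Duhamel's formula bounds its expectation by the exponential moment of `q γ` times the occupation
time along the worst deterministic path. Jensen's inequality over the offset in `[0, M]` splits this
time into progressions of step `M`, where the bound `r ^ n` gives a rate `log (1 + (exp (M q γ) - 1)
r) / M`, strictly below `q γ` because `r < 1`. -/

namespace VoterPAM

set_option linter.unusedSectionVars false

/-! ### Lazy random walks on a countable abelian group, Green functions and meeting probabilities.
-/

section Averaging

variable {G : Type*} [AddCommGroup G] [Countable G] [MeasurableSpace G]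
  [MeasurableSingletonClass G] [DecidableEq G]

/-- The average of `φ` after one step of a random walk with step law `μ`. -/
def avg (μ : Measure G) (φ : G → ℝ≥0∞) (x : G) : ℝ≥0∞ := ∫⁻ z, φ (x + z) ∂μ

/-- The probability that a random walk with step law `μ` goes from a site to `0` in `m` steps. -/
def walkProb (μ : Measure G) (m : ℕ) : G → ℝ≥0∞ := (avg μ)^[m] (Pi.single 0 1)

/-- The law that stays put with probability `1 - δ` and otherwise steps according to `ν`. -/
def lazyStep (δ : ℝ≥0∞) (ν : Measure G) : Measure G := (1 - δ) • Measure.dirac 0 + δ • ν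

/-- A measure on a countable group that is invariant under reflection. -/
def IsReflectionInvariant (μ : Measure G) : Prop :=
  ∀ φ : G → ℝ≥0∞, ∫⁻ z, φ (-z) ∂μ = ∫⁻ z, φ z ∂μ

lemma avg_mono (μ : Measure G) {φ ψ : G → ℝ≥0∞} (h : φ ≤ ψ) : avg μ φ ≤ avg μ ψ :=
  fun x => lintegral_mono fun z => h (x + z)

lemma avg_smul (μ : Measure G) (c : ℝ≥0∞) (φ : G → ℝ≥0∞) : avg μ (c • φ) = c • avg μ φ := by
  funext x
  exact lintegral_const_mul _ .of_discrete

lemma avg_sum (μ : Measure G) {ι : Type*} (s : Finset ι) (φ : ι → G → ℝ≥0∞) :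
    avg μ (∑ i ∈ s, φ i) = ∑ i ∈ s, avg μ (φ i) := by
  funext x
  simp only [avg, Finset.sum_apply]
  exact lintegral_finsetSum _ fun _ _ => .of_discrete

lemma avg_tsum (μ : Measure G) (φ : ℕ → G → ℝ≥0∞) (x : G) :
    avg μ (fun y => ∑' i, φ i y) x = ∑' i, avg μ (φ i) x :=
  lintegral_tsum fun _ => Measurable.of_discrete.aemeasurable

lemma avg_lazyStep (δ : ℝ≥0∞) (ν : Measure G) (φ : G → ℝ≥0∞) :
    avg (lazyStep δ ν) φ = (1 - δ) • φ + δ • avg ν φ := by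
  funext x
  simp [avg, lazyStep, lintegral_add_measure]

lemma walkProb_succ (μ : Measure G) (m : ℕ) : walkProb μ (m + 1) = avg μ (walkProb μ m) :=
  Function.iterate_succ_apply' _ _ _

lemma walkProb_add (μ : Measure G) (m k : ℕ) :
    walkProb μ (m + k) = (avg μ)^[m] (walkProb μ k) :=
  Function.iterate_add_apply _ _ _ _

lemma isReflectionInvariant_lazyStep (δ : ℝ≥0∞) {ν : Measure G} (hν : IsReflectionInvariant ν) :
    IsReflectionInvariant (lazyStep δ ν) := by
  intro φ
  simp [lazyStep, lintegral_add_measure, hν φ]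

lemma isProbabilityMeasure_lazyStep {δ : ℝ≥0∞} (hδ : δ ≤ 1) (ν : Measure G)
    [IsProbabilityMeasure ν] : IsProbabilityMeasure (lazyStep δ ν) := by
  constructor
  simp [lazyStep, tsub_add_cancel_of_le hδ]

/-- The Green function of a walk with step law `ν`. -/
def green (ν : Measure G) (x : G) : ℝ≥0∞ := ∑' l, walkProb ν l x

/-- The sum of `(l + 1)` times the `l`-step probabilities of a walk with step law `ν`. -/
def greenMoment (ν : Measure G) (x : G) : ℝ≥0∞ := ∑' l : ℕ, (l + 1) * walkProb ν l x

lemma green_eq (ν : Measure G) : green ν = Pi.single 0 1 + avg ν (green ν) := by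
  funext x
  simp only [Pi.add_apply]
  rw [green, tsum_eq_zero_add' ENNReal.summable]
  congr 1
  simp only [walkProb_succ]
  exact (avg_tsum ν _ x).symm

lemma greenMoment_eq (ν : Measure G) :
    greenMoment ν = green ν + avg ν (greenMoment ν) := by
  funext x
  have h : avg ν (greenMoment ν) x = ∑' l : ℕ, ((l : ℝ≥0∞) + 1) * walkProb ν (l + 1) x := by
    simp only [walkProb_succ]
    refine (avg_tsum ν (fun l y => ((l : ℝ≥0∞) + 1) * walkProb ν l y) x).trans ?_
    exact tsum_congr fun l => congrFun (avg_smul ν ((l : ℝ≥0∞) + 1) (walkProb ν l)) x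
  simp only [Pi.add_apply]
  rw [h, greenMoment]
  simp only [add_mul, one_mul]
  rw [ENNReal.tsum_add, add_comm]
  congr 1
  rw [tsum_eq_zero_add' ENNReal.summable]
  simp [add_mul]

lemma lazy_combination {δ : ℝ≥0∞} (hδ : δ ≤ 1) (φ ψ χ : G → ℝ≥0∞) (h : φ = ψ + χ) :
    δ • ψ + ((1 - δ) • φ + δ • χ) = φ := by
  rw [add_left_comm, ← smul_add, ← h, ← add_smul, tsub_add_cancel_of_le hδ, one_smul]

/-- A lazy walk spends a geometric time of mean `1 / δ` at each site it visits, so its Green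
function is that of `ν` divided by `δ`. Partial sums are compared by induction, since `green ν` is a
fixed point of the lazy recursion; no finiteness is needed. -/
lemma sum_walkProb_lazyStep_le {δ : ℝ≥0∞} (hδ : δ ≤ 1) (ν : Measure G) (N : ℕ) :
    ∑ m ∈ Finset.range N, δ • walkProb (lazyStep δ ν) m ≤ green ν := by
  induction N with
  | zero => intro x; simp
  | succ N ih =>
    rw [Finset.sum_range_succ']
    have : ∑ m ∈ Finset.range N, δ • walkProb (lazyStep δ ν) (m + 1)
        = avg (lazyStep δ ν) (∑ m ∈ Finset.range N, δ • walkProb (lazyStep δ ν) m) := by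
      rw [avg_sum]
      exact Finset.sum_congr rfl fun m _ => by rw [avg_smul, walkProb_succ]
    rw [this, add_comm]
    calc _ ≤ δ • walkProb (lazyStep δ ν) 0 + avg (lazyStep δ ν) (green ν) := by
          gcongr
          exact avg_mono _ ih
      _ = green ν := by
          rw [avg_lazyStep]
          exact lazy_combination hδ _ _ _ (green_eq ν)

/-- Laziness stretches time by `1 / δ`, so the first moment of the Green function scales like `δ⁻²`.
The bound is uniform in `δ`, which permits the continuous-time limit `δ → 0` later. The induction
follows the recursion of `greenMoment_eq`. -/
lemma sum_mul_walkProb_lazyStep_le {δ : ℝ≥0∞} (hδ : δ ≤ 1) (ν : Measure G) (N : ℕ) :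
    ∑ m ∈ Finset.range N, (δ * δ * (m + 1)) • walkProb (lazyStep δ ν) m ≤ greenMoment ν := by
  induction N with
  | zero => intro x; simp
  | succ N ih =>
    have h1 : ∑ m ∈ Finset.range (N + 1), (δ * δ * (m + 1)) • walkProb (lazyStep δ ν) m
        = δ • ∑ m ∈ Finset.range (N + 1), δ • walkProb (lazyStep δ ν) m
          + avg (lazyStep δ ν)
            (∑ m ∈ Finset.range N, (δ * δ * (m + 1)) • walkProb (lazyStep δ ν) m) := by
      rw [avg_sum]
      simp only [avg_smul, ← walkProb_succ]
      simp only [mul_add, add_smul, Finset.sum_add_distrib]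
      rw [Finset.sum_range_succ' (fun m => (δ * δ * (m : ℝ≥0∞)) • walkProb (lazyStep δ ν) m)]
      simp only [Nat.cast_add, Nat.cast_one, Nat.cast_zero, mul_zero, zero_smul, add_zero,
        mul_one, mul_add, add_smul, Finset.sum_add_distrib, Finset.smul_sum, smul_smul]
      abel
    rw [h1]
    calc _ ≤ δ • green ν + avg (lazyStep δ ν) (greenMoment ν) := by
          gcongr
          · exact sum_walkProb_lazyStep_le hδ ν _
          · exact avg_mono _ ih
      _ = greenMoment ν := by
          rw [avg_lazyStep]
          exact lazy_combination hδ _ _ _ (greenMoment_eq ν)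

lemma tsum_mul_walkProb_lazyStep_le {δ : ℝ≥0∞} (hδ : δ ≤ 1) (ν : Measure G) (x : G) :
    ∑' m : ℕ, δ * δ * (m + 1) * walkProb (lazyStep δ ν) m x ≤ greenMoment ν x := by
  rw [ENNReal.tsum_eq_iSup_nat]
  refine iSup_le fun N => ?_
  have := sum_mul_walkProb_lazyStep_le hδ ν N x
  simpa [Finset.sum_apply] using this

lemma lintegral_eq_tsum_singleton (μ : Measure G) (φ : G → ℝ≥0∞) :
    ∫⁻ z, φ z ∂μ = ∑' z, μ {z} * φ z := by
  rw [lintegral_countable']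
  exact tsum_congr fun _ => mul_comm _ _

/-- `walkProb μ m y` is the probability of going from `y` to `0`; reflection invariance identifies
it with the law of the displacement. -/
lemma avg_iterate_eq_tsum {μ : Measure G} (h : IsReflectionInvariant μ) (m : ℕ)
    (φ : G → ℝ≥0∞) (x : G) :
    (avg μ)^[m] φ x = ∑' y, walkProb μ m y * φ (x + y) := by
  induction m generalizing x with
  | zero =>
    rw [tsum_eq_single 0]
    · simp [walkProb]
    · intro y hy; simp [walkProb, hy]
  | succ m ih =>
    rw [Function.iterate_succ_apply', walkProb_succ]
    have h1 : ∀ y, avg μ (walkProb μ m) y = ∑' z, μ {z} * walkProb μ m (y - z) := by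
      intro y
      rw [avg, ← h, lintegral_eq_tsum_singleton]
      simp [sub_eq_add_neg]
    simp only [h1]
    rw [avg, lintegral_eq_tsum_singleton]
    simp only [ih, ← ENNReal.tsum_mul_right, ← ENNReal.tsum_mul_left]
    rw [ENNReal.tsum_comm (f := fun y z => μ {z} * walkProb μ m (y - z) * φ (x + y))]
    refine tsum_congr fun z => ?_
    rw [← (Equiv.addRight z).tsum_eq (fun y => μ {z} * walkProb μ m (y - z) * φ (x + y))]
    refine tsum_congr fun y => ?_
    simp only [Equiv.coe_addRight, add_sub_cancel_right, mul_assoc, add_assoc]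
    rw [add_comm z y]

/-- Split the walk in the middle, `p_{2m}(x) = ∑ p_m(y) p_m(x + y)`, and use `a b ≤ a² + b²`; both
sums of squares equal `p_{2m}(0)`. -/
lemma walkProb_even_le {μ : Measure G} (h : IsReflectionInvariant μ) (m : ℕ) (x : G) :
    walkProb μ (m + m) x ≤ 2 * walkProb μ (m + m) 0 := by
  have key : ∀ a b : ℝ≥0∞, a * b ≤ a * a + b * b := by
    intro a b
    rcases le_total a b with hab | hab
    · exact le_add_left (mul_le_mul_left hab b)
    · exact le_add_right (mul_le_mul_right hab a)
  rw [walkProb_add, avg_iterate_eq_tsum h, avg_iterate_eq_tsum h]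
  simp only [zero_add]
  calc _ ≤ ∑' y, (walkProb μ m y * walkProb μ m y
          + walkProb μ m (x + y) * walkProb μ m (x + y)) :=
        ENNReal.tsum_le_tsum fun y => key _ _
    _ = _ := by
        rw [ENNReal.tsum_add, two_mul]
        congr 1
        exact (Equiv.addLeft x).tsum_eq (fun y => walkProb μ m y * walkProb μ m y)

lemma avg_le_of_le {μ : Measure G} [IsProbabilityMeasure μ] {φ : G → ℝ≥0∞} {c : ℝ≥0∞}
    (h : ∀ x, φ x ≤ c) (x : G) : avg μ φ x ≤ c :=
  (lintegral_mono fun z => h (x + z)).trans (by simp)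

lemma walkProb_le {μ : Measure G} [IsProbabilityMeasure μ] (h : IsReflectionInvariant μ)
    (m : ℕ) (x : G) : walkProb μ m x ≤ 2 * walkProb μ (m / 2 + m / 2) 0 := by
  rcases Nat.even_or_odd' m with ⟨k, rfl | rfl⟩
  · rw [Nat.mul_div_cancel_left _ two_pos, two_mul]
    exact walkProb_even_le h k x
  · have : (2 * k + 1) / 2 = k := by omega
    rw [this, walkProb_succ, two_mul]
    exact avg_le_of_le (walkProb_even_le h k) x

/-- The times `2m` and `2m + 1` both produce the return probability at `2m`, with total weight `(2m
+ 1) + (2m + 2) ≤ 4 (2m + 1)`. -/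
lemma tsum_mul_walkProb_half_le (μ : Measure G) (c : ℝ≥0∞) :
    ∑' m : ℕ, c * (m + 1) * walkProb μ (m / 2 + m / 2) 0
      ≤ 4 * ∑' m : ℕ, c * (m + 1) * walkProb μ m 0 := by
  have h1 : ∑' m : ℕ, c * (m + 1) * walkProb μ (m / 2 + m / 2) 0
      ≤ ∑' m : ℕ, 4 * (c * ((m + m : ℕ) + 1) * walkProb μ (m + m) 0) := by
    rw [← tsum_even_add_odd ENNReal.summable ENNReal.summable, ← ENNReal.tsum_add]
    refine ENNReal.tsum_le_tsum fun m => ?_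
    have e1 : 2 * m / 2 = m := by omega
    have e2 : (2 * m + 1) / 2 = m := by omega
    rw [e1, e2, ← add_mul, ← mul_add, ← mul_assoc, mul_left_comm 4 c]
    gcongr c * ?_ * _
    norm_cast
    omega
  refine h1.trans ?_
  rw [ENNReal.tsum_mul_left]
  refine mul_le_mul_right ?_ 4
  exact ENNReal.tsum_comp_le_tsum_of_injective (f := fun m : ℕ => m + m)
    (fun a b hab => by simp only at hab; omega)
    (fun m : ℕ => c * ((m : ℝ≥0∞) + 1) * walkProb μ m 0)

/-- A superharmonic majorant of the probability that two independent walks, with lazy steps, started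
at distance `x` ever meet. -/
def meetBound (δ : ℝ≥0∞) (ν : Measure G) (x : G) : ℝ≥0∞ :=
  ∑' m : ℕ, 2 * δ * walkProb (lazyStep δ ν) (2 * m) x

lemma avg_iterate_meetBound (δ : ℝ≥0∞) (ν : Measure G) (k : ℕ) (x : G) :
    (avg (lazyStep δ ν))^[k] (meetBound δ ν) x
      = ∑' m : ℕ, 2 * δ * walkProb (lazyStep δ ν) (k + 2 * m) x := by
  induction k generalizing x with
  | zero => simp [meetBound]
  | succ k ih =>
    rw [Function.iterate_succ_apply']
    have : (avg (lazyStep δ ν))^[k] (meetBound δ ν)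
        = fun x => ∑' m : ℕ, 2 * δ * walkProb (lazyStep δ ν) (k + 2 * m) x := funext ih
    rw [this]
    refine (avg_tsum _ (fun m x => 2 * δ * walkProb (lazyStep δ ν) (k + 2 * m) x) x).trans ?_
    refine tsum_congr fun m => ?_
    rw [show k + 1 + 2 * m = (k + 2 * m) + 1 by ring, walkProb_succ]
    exact congrFun (avg_smul _ (2 * δ) (walkProb (lazyStep δ ν) (k + 2 * m))) x

/-- By symmetry, one time step of two independent walkers moves their difference by two steps of a
single walk. Applying `avg` twice to the Green function along even times merely drops the term `m =
0`. -/
lemma avg_avg_meetBound_le (δ : ℝ≥0∞) (ν : Measure G) (x : G) :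
    avg (lazyStep δ ν) (avg (lazyStep δ ν) (meetBound δ ν)) x ≤ meetBound δ ν x := by
  have := avg_iterate_meetBound δ ν 2 x
  simp only [Function.iterate_succ_apply, Function.iterate_zero_apply] at this
  rw [this, meetBound]
  refine (ENNReal.tsum_comp_le_tsum_of_injective (f := fun m : ℕ => m + 1)
    (add_left_injective 1)
    (fun m : ℕ => 2 * δ * walkProb (lazyStep δ ν) (2 * m) x)).trans' (le_of_eq ?_)
  exact tsum_congr fun m => by rw [show 2 + 2 * m = 2 * (m + 1) by ring]

lemma pow_le_walkProb_lazyStep (δ : ℝ≥0∞) (ν : Measure G) (m : ℕ) :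
    (1 - δ) ^ m ≤ walkProb (lazyStep δ ν) m 0 := by
  induction m with
  | zero => simp [walkProb]
  | succ m ih =>
    rw [walkProb_succ, avg_lazyStep, pow_succ']
    refine le_add_right ?_
    simp only [Pi.smul_apply, smul_eq_mul]
    gcongr

/-- This justifies the prefactor `2 δ` of `meetBound`: standing still already contributes `∑ (1 - δ)
^ (2 m) = 1 / (1 - (1 - δ)²) ≥ 1 / (2 δ)`. -/
lemma one_le_meetBound {δ : ℝ≥0∞} (hδ0 : δ ≠ 0) (hδ : δ ≤ 1) (ν : Measure G) :
    1 ≤ meetBound δ ν 0 := by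
  have hδt : δ ≠ ∞ := ne_top_of_le_ne_top ENNReal.one_ne_top hδ
  calc (1 : ℝ≥0∞) = 2 * δ * (2 * δ)⁻¹ :=
        (ENNReal.mul_inv_cancel (by simp [hδ0]) (ENNReal.mul_ne_top (by simp) hδt)).symm
    _ ≤ 2 * δ * (1 - (1 - δ) ^ 2)⁻¹ := by
        gcongr
        rw [tsub_le_iff_left]
        lift δ to ℝ≥0 using hδt
        have hδ' : δ ≤ 1 := by exact_mod_cast hδ
        rw [← ENNReal.coe_one, ← ENNReal.coe_sub]
        norm_cast
        rw [← NNReal.coe_le_coe]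
        push_cast [NNReal.coe_sub hδ']
        nlinarith [sq_nonneg (δ : ℝ)]
    _ = ∑' m : ℕ, 2 * δ * (1 - δ) ^ (2 * m) := by
        rw [ENNReal.tsum_mul_left]
        simp only [pow_mul]
        rw [ENNReal.tsum_geometric]
    _ ≤ _ := ENNReal.tsum_le_tsum fun m => by
        gcongr
        exact pow_le_walkProb_lazyStep δ ν _

/-- The bound on the sum of meeting probabilities of a walk with walks that start at the
times `k H`, `k ≥ 1`, anywhere in space. -/
lemma sum_avg_iterate_meetBound_le {δ : ℝ≥0∞} (hδ : δ ≤ 1) (ν : Measure G)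
    [IsProbabilityMeasure ν] (hν : IsReflectionInvariant ν) {H : ℕ} (hH : 0 < H)
    (s : Finset ℕ) (k : ℕ) (hs : ∀ c ∈ s, k < c) (τ : ℕ → ℕ)
    (hτ : ∀ c ∈ s, (c - k) * H ≤ τ c) (x : ℕ → G) :
    ∑ c ∈ s, (avg (lazyStep δ ν))^[τ c] (meetBound δ ν) (x c)
      ≤ 16 * (δ * H)⁻¹ * greenMoment ν 0 := by
  rcases eq_or_ne δ 0 with rfl | hδ0
  · simp [avg_iterate_meetBound]
  have hδt : δ ≠ ∞ := ne_top_of_le_ne_top ENNReal.one_ne_top hδ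
  have := isProbabilityMeasure_lazyStep hδ ν
  -- `b m` is a return probability that dominates, up to a factor `2`, the probability of being at
  -- any given site at time `m`; this removes the dependence on `x c`.
  set b : ℕ → ℝ≥0∞ := fun m => walkProb (lazyStep δ ν) (m / 2 + m / 2) 0
  have h1 : ∀ c ∈ s, (avg (lazyStep δ ν))^[τ c] (meetBound δ ν) (x c)
      ≤ ∑' m : ℕ, if (c - k) * H ≤ m then 4 * δ * b m else 0 := by
    intro c hc
    rw [avg_iterate_meetBound]
    refine le_trans ?_ (ENNReal.tsum_comp_le_tsum_of_injective (f := fun m : ℕ => τ c + 2 * m)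
      (fun a b hab => by simp only at hab; omega) _)
    refine ENNReal.tsum_le_tsum fun m => ?_
    rw [if_pos ((hτ c hc).trans (Nat.le_add_right _ _))]
    calc _ ≤ 2 * δ * (2 * b (τ c + 2 * m)) := by
          gcongr
          exact walkProb_le (isReflectionInvariant_lazyStep δ hν) _ _
      _ = _ := by ring
  -- After the sums are exchanged, a time `m` is counted by at most `m / H` labels `c`, since `c -
  -- k` ranges over distinct positive integers. This is what produces the first moment of the Green
  -- function.
  have h2 : ∀ m : ℕ, ∑ c ∈ s, (if (c - k) * H ≤ m then 4 * δ * b m else 0)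
      ≤ 4 * (δ * H)⁻¹ * (δ * δ * (m + 1) * b m) := by
    intro m
    rw [← Finset.sum_filter, Finset.sum_const, nsmul_eq_mul]
    have hcard : ((s.filter fun c => (c - k) * H ≤ m).card : ℝ≥0∞) ≤ (m + 1) * (H : ℝ≥0∞)⁻¹ := by
      rw [← div_eq_mul_inv, ENNReal.le_div_iff_mul_le (by simp [hH.ne']) (by simp)]
      have hle : (s.filter fun c => (c - k) * H ≤ m).card ≤ m / H := by
        refine (Finset.card_le_card_of_injOn (fun c => c - k) (t := Finset.Icc 1 (m / H)) ?_ ?_).trans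
          (by simp)
        · intro c hc
          have hc' := Finset.mem_filter.1 hc
          have := hs c hc'.1
          have := (Nat.le_div_iff_mul_le hH).2 hc'.2
          simp only [Finset.coe_Icc, Set.mem_Icc]
          omega
        · intro c hc c' hc' hcc
          have h1 := hs c (Finset.mem_filter.1 hc).1
          have h2 := hs c' (Finset.mem_filter.1 hc').1
          simp only at hcc
          omega
      have := (Nat.mul_le_mul_right H hle).trans (Nat.div_mul_le_self m H)
      exact_mod_cast this.trans (Nat.le_succ m)
    calc _ ≤ (m + 1) * (H : ℝ≥0∞)⁻¹ * (4 * δ * b m) := by gcongr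
      _ = 4 * (H : ℝ≥0∞)⁻¹ * (δ * (m + 1) * b m) := by ring
      _ = _ := by
        rw [ENNReal.mul_inv (Or.inl hδ0) (Or.inl hδt)]
        have : δ⁻¹ * δ = 1 := ENNReal.inv_mul_cancel hδ0 hδt
        calc _ = (δ⁻¹ * δ) * (4 * (H : ℝ≥0∞)⁻¹ * (δ * (m + 1) * b m)) := by rw [this, one_mul]
          _ = _ := by ring
  calc _ ≤ ∑ c ∈ s, ∑' m : ℕ, (if (c - k) * H ≤ m then 4 * δ * b m else 0) :=
        Finset.sum_le_sum h1
    _ = ∑' m : ℕ, ∑ c ∈ s, (if (c - k) * H ≤ m then 4 * δ * b m else 0) :=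
        (Summable.tsum_finsetSum fun _ _ => ENNReal.summable).symm
    _ ≤ ∑' m : ℕ, 4 * (δ * H)⁻¹ * (δ * δ * (m + 1) * b m) := ENNReal.tsum_le_tsum h2
    _ ≤ 4 * (δ * H)⁻¹ * (4 * greenMoment ν 0) := by
        rw [ENNReal.tsum_mul_left]
        gcongr
        refine (tsum_mul_walkProb_half_le _ _).trans ?_
        gcongr
        exact tsum_mul_walkProb_lazyStep_le hδ ν 0
    _ = _ := by ring

end Averaging

/-! ### Products of links between independent random variables. -/

section Forest

variable {E : Type*} [Countable E] [MeasurableSpace E] [MeasurableSingletonClass E]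

lemma one_add_sum_le_prod {ι : Type*} (s : Finset ι) (f : ι → ℝ≥0∞) :
    1 + ∑ i ∈ s, f i ≤ ∏ i ∈ s, (1 + f i) := by
  classical
  induction s using Finset.induction_on with
  | empty => simp
  | insert i s hi ih =>
    rw [Finset.sum_insert hi, Finset.prod_insert hi, add_mul, one_mul, add_left_comm, add_comm (f i)]
    refine add_le_add ih (le_mul_of_one_le_right zero_le ?_)
    exact le_self_add.trans ih

lemma lintegral_pi_fin_succ (μ : Measure E) [SigmaFinite μ] (k : ℕ)
    (F : (Fin (k + 1) → E) → ℝ≥0∞) :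
    ∫⁻ ω, F ω ∂(Measure.pi fun _ : Fin (k + 1) => μ)
      = ∫⁻ ω, ∫⁻ y, F (Fin.snoc (α := fun _ => E) ω y) ∂μ ∂(Measure.pi fun _ : Fin k => μ) := by
  have h := (measurePreserving_piFinSuccAbove (fun _ : Fin (k + 1) => μ) (Fin.last k)).symm
  rw [← h.lintegral_comp .of_discrete, lintegral_prod_symm' _ .of_discrete]
  refine lintegral_congr fun ω => lintegral_congr fun y => ?_
  congr 1
  simp [MeasurableEquiv.piFinSuccAbove, Fin.insertNthEquiv]

/-- A product of factors that link each of `n` independent random variables to the earlier ones is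
small in expectation, provided that the links from any fixed value to the later variables are
rare. -/
theorem lintegral_prod_link_le (μ : Measure E) [IsProbabilityMeasure μ] (n : ℕ)
    (b : ℕ → E → ℝ≥0∞) (M : ℕ → ℕ → E → E → ℝ≥0∞) (a θ K : ℝ≥0∞) (hθ0 : θ ≠ 0) (hθ : θ ≠ ∞)
    (hb : ∀ k < n, ∫⁻ ω, b k ω ∂μ ≤ a)
    (hK : ∀ i < n, ∀ y, ∏ c ∈ Finset.Ioo i n, (1 + θ * ∫⁻ ω, M c i ω y ∂μ) ≤ K) :
    ∫⁻ ω, ∏ k : Fin n, (b k (ω k) + ∑ i : Fin n, if i < k then M k i (ω k) (ω i) else 0)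
      ∂(Measure.pi fun _ : Fin n => μ) ≤ (K * (a + θ⁻¹)) ^ n := by
  set P : ℕ → ℕ → E → ℝ≥0∞ := fun c i y => ∫⁻ ω, M c i ω y ∂μ with hP
  -- The variables are integrated from the last one down. Integrating variable `k` turns its links
  -- into functions of the earlier values; these are kept as weights `1 + θ P k j`. The statement
  -- for `k` carries, for each `j < k`, the weights left by the variables from `k` on.
  suffices h : ∀ k ≤ n, ∫⁻ ω, ∏ j : Fin k,
      ((b j (ω j) + ∑ i : Fin k, if i < j then M j i (ω j) (ω i) else 0)
        * ∏ c ∈ Finset.Ico k n, (1 + θ * P c j (ω j))) ∂(Measure.pi fun _ : Fin k => μ)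
      ≤ (K * (a + θ⁻¹)) ^ k by
    simpa using h n le_rfl
  intro k
  induction k with
  | zero => intro _; simp
  | succ k ih =>
    intro hk
    rw [lintegral_pi_fin_succ]
    have inner : ∀ ω : Fin k → E,
        ∫⁻ y, (b k y + ∑ i : Fin k, M k i y (ω i)) * ∏ c ∈ Finset.Ico (k + 1) n, (1 + θ * P c k y) ∂μ
          ≤ K * (a + θ⁻¹) * ∏ i : Fin k, (1 + θ * P k i (ω i)) := by
      intro ω
      calc _ ≤ ∫⁻ y, (b k y + ∑ i : Fin k, M k i y (ω i)) * K ∂μ := by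
            refine lintegral_mono fun y => mul_le_mul_right ?_ _
            exact hK k hk y
        _ = (∫⁻ y, b k y ∂μ + ∑ i : Fin k, P k i (ω i)) * K := by
            rw [lintegral_mul_const _ .of_discrete, lintegral_add_left .of_discrete,
              lintegral_finsetSum _ fun _ _ => .of_discrete]
        _ ≤ (a + ∑ i : Fin k, P k i (ω i)) * K := by
            gcongr
            exact hb k hk
        _ ≤ ((a + θ⁻¹) * ∏ i : Fin k, (1 + θ * P k i (ω i))) * K := by
            gcongr
            -- A sum of links is traded for a product of weights through `a + S ≤ (a + θ⁻¹) (1 + θ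
            -- S)`, so that the weights factorise over the earlier variables.
            have h1 : 1 + ∑ i : Fin k, θ * P k i (ω i) ≤ ∏ i : Fin k, (1 + θ * P k i (ω i)) :=
              one_add_sum_le_prod _ _
            calc a + ∑ i : Fin k, P k i (ω i)
                ≤ (a + θ⁻¹) * (1 + ∑ i : Fin k, θ * P k i (ω i)) := by
                  rw [← Finset.mul_sum, mul_add, mul_one]
                  refine add_le_add le_self_add ?_
                  calc _ = θ⁻¹ * (θ * ∑ i : Fin k, P k i (ω i)) := by
                        rw [← mul_assoc, ENNReal.inv_mul_cancel hθ0 hθ, one_mul]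
                    _ ≤ _ := by gcongr; exact le_add_self
              _ ≤ _ := by gcongr
        _ = _ := by ring
    calc _ = ∫⁻ ω, (∏ j : Fin k,
          ((b j (ω j) + ∑ i : Fin k, if i < j then M j i (ω j) (ω i) else 0)
            * ∏ c ∈ Finset.Ico (k + 1) n, (1 + θ * P c j (ω j)))) *
          ∫⁻ y, (b k y + ∑ i : Fin k, M k i y (ω i))
            * ∏ c ∈ Finset.Ico (k + 1) n, (1 + θ * P c k y) ∂μ
          ∂(Measure.pi fun _ : Fin k => μ) := by
          refine lintegral_congr fun ω => ?_
          rw [← lintegral_const_mul _ .of_discrete]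
          refine lintegral_congr fun y => ?_
          rw [Fin.prod_univ_castSucc]
          simp only [Fin.sum_univ_castSucc, Fin.snoc_castSucc, Fin.snoc_last, Fin.val_castSucc,
            Fin.val_last, Fin.castSucc_lt_castSucc_iff, Fin.castSucc_lt_last, if_true,
            lt_irrefl, if_false, add_zero, (Fin.castSucc_lt_last _).not_gt]
      _ ≤ ∫⁻ ω, (∏ j : Fin k,
          ((b j (ω j) + ∑ i : Fin k, if i < j then M j i (ω j) (ω i) else 0)
            * ∏ c ∈ Finset.Ico (k + 1) n, (1 + θ * P c j (ω j)))) *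
          (K * (a + θ⁻¹) * ∏ i : Fin k, (1 + θ * P k i (ω i)))
          ∂(Measure.pi fun _ : Fin k => μ) :=
          lintegral_mono fun ω => mul_le_mul_right (inner ω) _
      _ = (∫⁻ ω, ∏ j : Fin k,
          ((b j (ω j) + ∑ i : Fin k, if i < j then M j i (ω j) (ω i) else 0)
            * ∏ c ∈ Finset.Ico k n, (1 + θ * P c j (ω j))) ∂(Measure.pi fun _ : Fin k => μ))
          * (K * (a + θ⁻¹)) := by
          rw [← lintegral_mul_const _ .of_discrete]
          refine lintegral_congr fun ω => ?_
          simp only [Finset.prod_eq_prod_Ico_succ_bot hk, Finset.prod_mul_distrib]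
          ring
      _ ≤ _ := by
          rw [pow_succ]
          gcongr
          exact ih (Nat.le_of_succ_le hk)

lemma prod_one_add_le_exp {ι : Type*} (s : Finset ι) (f : ι → ℝ≥0∞) {c : ℝ}
    (hc : 0 ≤ c) (h : ∑ i ∈ s, f i ≤ ENNReal.ofReal c) :
    ∏ i ∈ s, (1 + f i) ≤ ENNReal.ofReal (Real.exp c) := by
  have hf : ∀ i ∈ s, f i ≠ ∞ := fun i hi =>
    ne_top_of_le_ne_top ENNReal.ofReal_ne_top ((Finset.single_le_sum (fun _ _ => zero_le) hi).trans h)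
  calc _ ≤ ∏ i ∈ s, ENNReal.ofReal (Real.exp (f i).toReal) := by
        refine Finset.prod_le_prod' fun i hi => ?_
        rw [← ENNReal.ofReal_toReal (hf i hi), ← ENNReal.ofReal_one,
          ← ENNReal.ofReal_add zero_le_one ENNReal.toReal_nonneg,
          ENNReal.toReal_ofReal ENNReal.toReal_nonneg]
        exact ENNReal.ofReal_le_ofReal (by linarith [Real.add_one_le_exp (f i).toReal])
    _ = ENNReal.ofReal (Real.exp (∑ i ∈ s, (f i).toReal)) := by
        rw [Real.exp_sum, ENNReal.ofReal_prod_of_nonneg fun _ _ => (Real.exp_pos _).le]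
    _ ≤ _ := by
        gcongr
        rw [← ENNReal.toReal_sum hf]
        exact ENNReal.toReal_le_of_le_ofReal hc h

end Forest

/-! ### Independent walkers with staggered starts, their meetings, and the domination of
coalescence. -/

section Walkers

variable {G : Type*} [AddCommGroup G] [Countable G] [MeasurableSpace G]
  [MeasurableSingletonClass G] [DecidableEq G] {T : ℕ}

/-- The law of `T` independent steps. -/
abbrev stepLaw (π : Measure G) (T : ℕ) : Measure (Fin T → G) := Measure.pi fun _ => π

lemma measurePreserving_update (π : Measure G) [IsProbabilityMeasure π] (j : Fin T) :
    MeasurePreserving (fun q : (Fin T → G) × G => Function.update q.1 j q.2)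
      ((stepLaw π T).prod π) (stepLaw π T) := by
  refine ⟨.of_discrete, (Measure.pi_eq fun s _ => ?_).symm⟩
  rw [Measure.map_apply .of_discrete .of_discrete]
  have : (fun q : (Fin T → G) × G => Function.update q.1 j q.2) ⁻¹' Set.univ.pi s
      = (Set.univ.pi (Function.update s j Set.univ)) ×ˢ s j := by
    ext q
    simp only [Set.mem_preimage, Set.mem_pi, Set.mem_univ, true_imp_iff, Set.mem_prod]
    constructor
    · intro h
      refine ⟨fun i => ?_, by simpa using h j⟩
      rcases eq_or_ne i j with rfl | hij
      · simp
      · simpa [hij] using h i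
    · rintro ⟨h, hj⟩ i
      rcases eq_or_ne i j with rfl | hij
      · simpa using hj
      · simpa [hij] using h i
  rw [this, Measure.prod_prod, Measure.pi_pi, ← Finset.mul_prod_erase _ _ (Finset.mem_univ j),
    ← Finset.mul_prod_erase _ (fun i => π (s i)) (Finset.mem_univ j)]
  simp only [Function.update_self, measure_univ, one_mul]
  rw [mul_comm]
  congr 1
  refine Finset.prod_congr rfl fun i hi => ?_
  rw [Function.update_of_ne (Finset.ne_of_mem_erase hi)]

/-- Resampling the step `j` plays the role of the Markov property: what depends on times up to `j`
only is not affected by the resampling. -/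
lemma lintegral_update (π : Measure G) [IsProbabilityMeasure π] (j : Fin T)
    (F : (Fin T → G) → ℝ≥0∞) :
    ∫⁻ ω, F ω ∂(stepLaw π T) = ∫⁻ ω, ∫⁻ z, F (Function.update ω j z) ∂π ∂(stepLaw π T) := by
  rw [← (measurePreserving_update π j).lintegral_comp .of_discrete, lintegral_prod _
    Measurable.of_discrete.aemeasurable]

lemma lintegral_update_all (π : Measure G) [IsProbabilityMeasure π] (n : ℕ) (j : Fin T)
    (F : (Fin n → Fin T → G) → ℝ≥0∞) :
    ∫⁻ ω, F ω ∂(Measure.pi fun _ : Fin n => stepLaw π T)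
      = ∫⁻ ω, ∫⁻ z, F (fun k => Function.update (ω k) j (z k)) ∂(stepLaw π n)
        ∂(Measure.pi fun _ : Fin n => stepLaw π T) := by
  have h1 := measurePreserving_pi (fun _ : Fin n => (stepLaw π T).prod π)
    (fun _ : Fin n => stepLaw π T) (fun _ => measurePreserving_update π j)
  have h2 := (measurePreserving_arrowProdEquivProdArrow (Fin T → G) G (Fin n)
    (fun _ => stepLaw π T) (fun _ => π)).symm
  have h3 := h1.comp h2
  rw [← h3.lintegral_comp .of_discrete, lintegral_prod _ Measurable.of_discrete.aemeasurable]
  rfl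

variable (x : ℕ → G) (τ : ℕ → ℕ)

/-- The position at time `j` of the walker `k`, which starts at the site `x k` at time `τ k`
and uses the steps `ω`. -/
def pos (k : ℕ) (ω : Fin T → G) (j : ℕ) : G :=
  x k + ∑ l : Fin T, if τ k ≤ l ∧ (l : ℕ) < j then ω l else 0

lemma pos_start (k : ℕ) (ω : Fin T → G) : pos x τ k ω (τ k) = x k := by
  simp only [pos]
  rw [Finset.sum_eq_zero, add_zero]
  intro l _
  rw [if_neg]
  omega

lemma pos_update_of_le (k : ℕ) (ω : Fin T → G) (j : Fin T) (z : G) {s : ℕ} (hs : s ≤ j) :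
    pos x τ k (Function.update ω j z) s = pos x τ k ω s := by
  simp only [pos]
  congr 1
  refine Finset.sum_congr rfl fun l _ => ?_
  split_ifs with h
  · rw [Function.update_of_ne]
    rintro rfl
    omega
  · rfl

lemma pos_update_succ (k : ℕ) (ω : Fin T → G) (j : Fin T) (z : G) (hk : τ k ≤ j) :
    pos x τ k (Function.update ω j z) (j + 1) = pos x τ k ω j + z := by
  simp only [pos, add_assoc]
  congr 1
  rw [← Finset.add_sum_erase _ _ (Finset.mem_univ j),
    ← Finset.add_sum_erase _ (fun l : Fin T => if τ k ≤ l ∧ (l : ℕ) < j then ω l else 0)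
      (Finset.mem_univ j)]
  simp only [Function.update_self, lt_irrefl, and_false, if_false, zero_add]
  rw [if_pos ⟨hk, Nat.lt_succ_self _⟩, add_comm z]
  congr 1
  refine Finset.sum_congr rfl fun l hl => ?_
  have hlj := Finset.ne_of_mem_erase hl
  have hlj' : (l : ℕ) ≠ j := fun h => hlj (Fin.ext h)
  rw [Function.update_of_ne hlj]
  refine if_congr ?_ rfl rfl
  omega

lemma lintegral_pos (π : Measure G) [IsProbabilityMeasure π] (k m : ℕ) (hm : τ k + m ≤ T)
    (φ : G → ℝ≥0∞) :
    ∫⁻ ω : Fin T → G, φ (pos x τ k ω (τ k + m)) ∂(stepLaw π T) = (avg π)^[m] φ (x k) := by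
  induction m generalizing φ with
  | zero => simp [pos_start]
  | succ m ih =>
    rw [lintegral_update π ⟨τ k + m, by omega⟩]
    have : ∀ (ω : Fin T → G) (z : G),
        pos x τ k (Function.update ω ⟨τ k + m, by omega⟩ z) (τ k + (m + 1))
          = pos x τ k ω (τ k + m) + z :=
      fun ω z => pos_update_succ x τ k ω ⟨τ k + m, by omega⟩ z (Nat.le_add_right _ _)
    simp only [this]
    rw [Function.iterate_succ_apply, ← ih (by omega)]
    rfl

/-- The event that the walker `c` visits the path `y` before or at time `j`. -/
def hits (T : ℕ) (c : ℕ) (y : ℕ → G) (j : ℕ) : Set (Fin T → G) :=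
  {ω | ∃ s, τ c ≤ s ∧ s ≤ j ∧ pos x τ c ω s = y s}

lemma hits_mono (c : ℕ) (y : ℕ → G) {i j : ℕ} (h : i ≤ j) : hits x τ T c y i ⊆ hits x τ T c y j :=
  fun _ ⟨s, h1, h2, h3⟩ => ⟨s, h1, h2.trans h, h3⟩

lemma hits_congr (c : ℕ) {y y' : ℕ → G} {j : ℕ} (h : ∀ s ≤ j, y s = y' s) :
    hits x τ T c y j = hits x τ T c y' j := by
  ext ω
  refine exists_congr fun s => and_congr_right fun _ => and_congr_right fun hs => ?_
  rw [h s hs]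

lemma mem_hits_update_iff (c : ℕ) (y : ℕ → G) (ω : Fin T → G) (j : Fin T) (z : G) :
    Function.update ω j z ∈ hits x τ T c y j ↔ ω ∈ hits x τ T c y j := by
  refine exists_congr fun s => and_congr_right fun _ => and_congr_right fun hs => ?_
  rw [pos_update_of_le x τ c ω j z hs]

lemma mem_hits_succ_iff (c : ℕ) (y : ℕ → G) (ω : Fin T → G) (j : ℕ) (hj : τ c ≤ j + 1) :
    ω ∈ hits x τ T c y (j + 1) ↔ ω ∈ hits x τ T c y j ∨ pos x τ c ω (j + 1) = y (j + 1) := by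
  constructor
  · rintro ⟨s, h1, h2, h3⟩
    rcases Nat.lt_or_ge j s with h | h
    · obtain rfl : s = j + 1 := by omega
      exact Or.inr h3
    · exact Or.inl ⟨s, h1, h, h3⟩
  · rintro (h | h)
    · exact hits_mono x τ c y (Nat.le_succ j) h
    · exact ⟨j + 1, hj, le_rfl, h⟩

open scoped Classical in
/-- Two independent walkers meet with probability at most the value at the initial difference of a
function that is superharmonic for the difference of the walkers. -/
lemma lintegral_hits_le (π : Measure G) [IsProbabilityMeasure π] (hπ : IsReflectionInvariant π)
    (g : G → ℝ≥0∞) (hg : ∀ y, avg π (avg π g) y ≤ g y) (hg0 : 1 ≤ g 0) (c k : ℕ)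
    (hck : τ k ≤ τ c) (hc : τ c ≤ T) :
    ∫⁻ ω, stepLaw π T (hits x τ T c (pos x τ k ω) T) ∂(stepLaw π T)
      ≤ (avg π)^[τ c - τ k] g (x k - x c) := by
  -- `N j` equals `1` once the walkers have met and `g` of their difference before. Its expectation
  -- does not increase with `j` after the start of `c`, and at time `T` it dominates the indicator
  -- of a meeting.
  set N : ℕ → (Fin T → G) → (Fin T → G) → ℝ≥0∞ := fun j ω ω' =>
    if ω' ∈ hits x τ T c (pos x τ k ω) j then 1 else g (pos x τ k ω j - pos x τ c ω' j) with hN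
  have start : ∫⁻ ω, ∫⁻ ω', N (τ c) ω ω' ∂(stepLaw π T) ∂(stepLaw π T)
      ≤ (avg π)^[τ c - τ k] g (x k - x c) := by
    have hshift : ∀ m, ∀ y, (avg π)^[m] (fun w => g (w - x c)) y = (avg π)^[m] g (y - x c) := by
      intro m
      induction m with
      | zero => intro y; rfl
      | succ m ih =>
        intro y
        rw [Function.iterate_succ_apply', Function.iterate_succ_apply']
        refine lintegral_congr fun z => ?_
        rw [ih, add_sub_right_comm]
    rw [← hshift, ← lintegral_pos (T := T) x τ π k _ (by omega)]
    refine lintegral_mono fun ω => ?_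
    calc _ ≤ ∫⁻ _, g (pos x τ k ω (τ k + (τ c - τ k)) - x c) ∂(stepLaw π T) := by
          refine lintegral_mono fun ω' => ?_
          rw [Nat.add_sub_cancel' hck]
          simp only [hN]
          split_ifs with h
          · obtain ⟨s, h1, h2, h3⟩ := h
            obtain rfl : s = τ c := le_antisymm h2 h1
            rw [pos_start] at h3
            rw [← h3, sub_self]
            exact hg0
          · rw [pos_start]
      _ = _ := by simp
  have step : ∀ j, τ c ≤ j → j < T →
      ∫⁻ ω, ∫⁻ ω', N (j + 1) ω ω' ∂(stepLaw π T) ∂(stepLaw π T)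
        ≤ ∫⁻ ω, ∫⁻ ω', N j ω ω' ∂(stepLaw π T) ∂(stepLaw π T) := by
    intro j hj hjT
    set J : Fin T := ⟨j, hjT⟩
    have hJ : (J : ℕ) = j := rfl
    calc _ = ∫⁻ ω, ∫⁻ z, ∫⁻ ω', ∫⁻ z', N (j + 1) (Function.update ω J z) (Function.update ω' J z')
          ∂π ∂(stepLaw π T) ∂π ∂(stepLaw π T) := by
          rw [lintegral_update π J]
          refine lintegral_congr fun ω => lintegral_congr fun z => ?_
          rw [lintegral_update π J]
      _ = ∫⁻ ω, ∫⁻ ω', ∫⁻ z, ∫⁻ z', N (j + 1) (Function.update ω J z) (Function.update ω' J z')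
          ∂π ∂π ∂(stepLaw π T) ∂(stepLaw π T) := by
          refine lintegral_congr fun ω => ?_
          exact lintegral_lintegral_swap Measurable.of_discrete.aemeasurable
      _ ≤ _ := by
          refine lintegral_mono fun ω => lintegral_mono fun ω' => ?_
          have hh : ∀ z z', Function.update ω' J z' ∈ hits x τ T c (pos x τ k (Function.update ω J z)) j
              ↔ ω' ∈ hits x τ T c (pos x τ k ω) j := by
            intro z z'
            rw [mem_hits_update_iff x τ c _ ω' J z',
              hits_congr x τ c fun s hs => pos_update_of_le x τ k ω J z hs]
          by_cases hit : ω' ∈ hits x τ T c (pos x τ k ω) j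
          · calc _ ≤ ∫⁻ _, ∫⁻ _, 1 ∂π ∂π := by
                  refine lintegral_mono fun z => lintegral_mono fun z' => ?_
                  simp only [hN]
                  rw [if_pos (hits_mono x τ c _ (Nat.le_succ j) ((hh z z').2 hit))]
              _ = N j ω ω' := by simp [hN, hit]
          · calc _ ≤ ∫⁻ z, ∫⁻ z', g (pos x τ k ω j - pos x τ c ω' j + z + -z') ∂π ∂π := by
                  refine lintegral_mono fun z => lintegral_mono fun z' => ?_
                  have e1 := pos_update_succ x τ k ω J z (hck.trans hj)
                  have e2 := pos_update_succ x τ c ω' J z' hj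
                  simp only [hJ] at e1 e2
                  have e3 : pos x τ k ω j - pos x τ c ω' j + z + -z'
                      = pos x τ k (Function.update ω J z) (j + 1)
                        - pos x τ c (Function.update ω' J z') (j + 1) := by
                    rw [e1, e2]; abel
                  rw [e3]
                  simp only [hN]
                  split_ifs with h
                  · rw [mem_hits_succ_iff x τ c _ _ _ (by omega), hh] at h
                    rcases h with h | h
                    · exact absurd h hit
                    · rw [h, sub_self]; exact hg0
                  · exact le_rfl
              -- The walker `c` contributes `-z'` to the difference; reflection invariance replaces
              -- it by `z'`.
              _ = avg π (avg π g) (pos x τ k ω j - pos x τ c ω' j) := by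
                  refine lintegral_congr fun z => ?_
                  rw [hπ fun z' => g (pos x τ k ω j - pos x τ c ω' j + z + z')]
                  rfl
              _ ≤ N j ω ω' := by
                  simp only [hN, if_neg hit]
                  exact hg _
  have all : ∀ j, τ c ≤ j → j ≤ T → ∫⁻ ω, ∫⁻ ω', N j ω ω' ∂(stepLaw π T) ∂(stepLaw π T)
      ≤ (avg π)^[τ c - τ k] g (x k - x c) := by
    intro j hj
    induction j, hj using Nat.le_induction with
    | base => intro _; exact start
    | succ j hj ih => intro h; exact (step j hj h).trans (ih (Nat.le_of_succ_le h))
  refine le_trans ?_ (all T hc le_rfl)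
  refine lintegral_mono fun ω => ?_
  rw [← lintegral_indicator_one .of_discrete]
  refine lintegral_mono fun ω' => ?_
  simp only [hN, Set.indicator]
  split_ifs
  · exact le_rfl
  · exact zero_le

variable (π : Measure G) (T) (n : ℕ) (ε : ℝ≥0∞)

/-- The path `y` of the walker `k` is good up to time `j` if few of the later walkers are expected
to meet it by then. -/
def IsGood (k : ℕ) (y : ℕ → G) (j : ℕ) : Prop :=
  ∑ c ∈ Finset.Ioo k n, stepLaw π T (hits x τ T c y j) ≤ ε

lemma IsGood.of_le {k : ℕ} {y : ℕ → G} {i j : ℕ} (h : IsGood T x τ π n ε k y j) (hij : i ≤ j) :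
    IsGood T x τ π n ε k y i :=
  (Finset.sum_le_sum fun c _ => measure_mono (hits_mono x τ c y hij)).trans h

lemma isGood_congr {k : ℕ} {y y' : ℕ → G} {j : ℕ} (h : ∀ s ≤ j, y s = y' s) :
    IsGood T x τ π n ε k y j ↔ IsGood T x τ π n ε k y' j := by
  simp only [IsGood, hits_congr x τ _ h]

/-- The walker `k` is active at time `j` if it has started, its path is still good, and it
has not met an earlier walker with a path that was good at the time. -/
def IsActive (y : Fin n → ℕ → G) (j : ℕ) (k : Fin n) : Prop :=
  τ k ≤ j ∧ IsGood T x τ π n ε k (y k) j ∧ ∀ s ≤ j, τ k ≤ s → ∀ i < k,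
    IsGood T x τ π n ε i (y i) s → y i s ≠ y k s

lemma IsActive.of_le {y : Fin n → ℕ → G} {i j : ℕ} {k : Fin n}
    (h : IsActive T x τ π n ε y j k) (hij : i ≤ j) (hk : τ k ≤ i) : IsActive T x τ π n ε y i k :=
  ⟨hk, h.2.1.of_le T x τ π n ε hij, fun s hs => h.2.2 s (hs.trans hij)⟩

lemma isActive_congr {y y' : Fin n → ℕ → G} {j : ℕ} (h : ∀ k, ∀ s ≤ j, y k s = y' k s)
    (k : Fin n) : IsActive T x τ π n ε y j k ↔ IsActive T x τ π n ε y' j k := by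
  refine and_congr_right fun _ => and_congr (isGood_congr T x τ π n ε (h k)) ?_
  refine forall_congr' fun s => forall_congr' fun hs => forall_congr' fun _ =>
    forall_congr' fun i => forall_congr' fun _ => ?_
  rw [isGood_congr T x τ π n ε fun r hr => h i r (hr.trans hs), h i s hs, h k s hs]

/-- If two active walkers were at the same site, the later one would be meeting an earlier path that
is still good, which activity forbids. Active walkers therefore move like coalescing walks that have
not merged. -/
lemma IsActive.injOn {y : Fin n → ℕ → G} {j : ℕ} :
    Set.InjOn (fun k => y k j) {k | IsActive T x τ π n ε y j k} := by
  intro k hk i hi hki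
  by_contra hne
  rcases lt_or_gt_of_ne hne with h | h
  · exact hi.2.2 j le_rfl hi.1 k h hk.2.1 hki
  · exact hk.2.2 j le_rfl hk.1 i h hi.2.1 hki.symm

open scoped Classical in
/-- The labels of the active walkers. -/
def activeLabels (y : Fin n → ℕ → G) (j : ℕ) : Finset (Fin n) :=
  Finset.univ.filter (IsActive T x τ π n ε y j)

lemma mem_activeLabels {y : Fin n → ℕ → G} {j : ℕ} {k : Fin n} :
    k ∈ activeLabels T x τ π n ε y j ↔ IsActive T x τ π n ε y j k := by
  simp [activeLabels]

/-- The sites at which walkers start at time `j`. -/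
def newSites (j : ℕ) : Finset G := ((Finset.univ : Finset (Fin n)).filter fun k : Fin n => τ k = j).image
  fun k : Fin n => x k

/-- A function of finite sets that evolves at most like coalescing random walks is controlled by
the active ones among independent walkers. -/
theorem le_lintegral_activeLabels (ε : ℝ≥0∞) [IsProbabilityMeasure π] (v : ℕ → Finset G → ℝ≥0∞)
    (e : ℝ≥0∞) (hanti : ∀ j A B, A ⊆ B → v j B ≤ v j A)
    (hstep : ∀ j < T, ∀ (I : Finset (Fin n)) (y : Fin n → G), Set.InjOn y I →
      v j (I.image y) ≤ ∫⁻ z, v (j + 1) (I.image (y + z) ∪ newSites x τ n (j + 1))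
        ∂(stepLaw π n) + e) :
    v 0 (newSites x τ n 0) ≤
      ∫⁻ ω, v T ((activeLabels T x τ π n ε (fun k => pos x τ k (ω k)) T).image
        fun k : Fin n => pos x τ k (ω k) T) ∂(Measure.pi fun _ : Fin n => stepLaw π T) + T * e := by
  set V : ℕ → (Fin n → Fin T → G) → ℝ≥0∞ := fun j ω =>
    v j ((activeLabels T x τ π n ε (fun k => pos x τ k (ω k)) j).image
        fun k : Fin n => pos x τ k (ω k) j) with hV
  have main : ∀ j ≤ T, v 0 (newSites x τ n 0) ≤
      ∫⁻ ω, V j ω ∂(Measure.pi fun _ : Fin n => stepLaw π T) + j * e := by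
    intro j
    induction j with
    | zero =>
      intro _
      refine le_add_right ?_
      calc _ = ∫⁻ _, v 0 (newSites x τ n 0) ∂(Measure.pi fun _ : Fin n => stepLaw π T) := by simp
        _ ≤ _ := by
          refine lintegral_mono fun ω => hanti _ _ _ fun w hw => ?_
          obtain ⟨k, hk, rfl⟩ := Finset.mem_image.1 hw
          have hk' : τ k = 0 := Nat.le_zero.1 ((mem_activeLabels T x τ π n ε).1 hk).1
          refine Finset.mem_image.2 ⟨k, Finset.mem_filter.2 ⟨Finset.mem_univ _, hk'⟩, ?_⟩
          have := pos_start x τ k (ω k)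
          rw [hk'] at this
          exact this.symm
    | succ j ih =>
      intro hj
      refine (ih (Nat.le_of_succ_le hj)).trans ?_
      set J : Fin T := ⟨j, hj⟩
      have hJ : (J : ℕ) = j := rfl
      -- The sites active at time `j + 1` lie among the displaced active sites and the new starting
      -- sites. Walkers that drop out in between only increase `v`, by monotonicity, so no account
      -- of actual coalescence is needed.
      have key : ∀ ω : Fin n → Fin T → G, V j ω ≤
          ∫⁻ z, V (j + 1) (fun k => Function.update (ω k) J (z k)) ∂(stepLaw π n) + e := by
        intro ω
        refine (hstep j hj _ _ ?_).trans ?_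
        · intro k hk i hi
          exact IsActive.injOn T x τ π n ε (y := fun k : Fin n => pos x τ k (ω k))
            ((mem_activeLabels T x τ π n ε).1 hk) ((mem_activeLabels T x τ π n ε).1 hi)
        · gcongr with z
          refine hanti _ _ _ fun w hw => ?_
          obtain ⟨k, hk, rfl⟩ := Finset.mem_image.1 hw
          have hk' := (mem_activeLabels T x τ π n ε).1 hk
          rcases Nat.lt_or_ge j (τ k) with h | h
          · have hτ : τ k = j + 1 := le_antisymm hk'.1 h
            refine Finset.mem_union_right _ (Finset.mem_image.2
              ⟨k, Finset.mem_filter.2 ⟨Finset.mem_univ _, hτ⟩, ?_⟩)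
            rw [← hτ]
            exact (pos_start x τ k _).symm
          · refine Finset.mem_union_left _ (Finset.mem_image.2 ⟨k, ?_, ?_⟩)
            · refine (mem_activeLabels T x τ π n ε).2 ?_
              refine (isActive_congr T x τ π n ε (fun i s hs => ?_) k).1
                (hk'.of_le T x τ π n ε (Nat.le_succ j) h)
              exact pos_update_of_le x τ i (ω i) J (z i) hs
            · exact (pos_update_succ x τ k (ω k) J (z k) h).symm
      calc _ ≤ ∫⁻ ω, (∫⁻ z, V (j + 1) (fun k => Function.update (ω k) J (z k)) ∂(stepLaw π n) + e)
            ∂(Measure.pi fun _ : Fin n => stepLaw π T) + j * e := by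
            gcongr with ω
            exact key ω
        _ = _ := by
            rw [lintegral_update_all π n J (V (j + 1)), lintegral_add_right _ measurable_const,
              lintegral_const, measure_univ, mul_one, add_assoc]
            push_cast
            rw [add_mul, one_mul, add_comm e]
  exact main T le_rfl

-- An inactive walker has a bad path or has met an earlier path while that was good. In either case
-- its factor on the right is at least `1`; for an active walker the factor is at least `R`.
open scoped Classical in
lemma pow_card_activeLabels_le (R : ℝ≥0∞) (hτ : ∀ k < n, τ k ≤ T)
    (ω : Fin n → Fin T → G) :
    R ^ ((activeLabels T x τ π n ε (fun k => pos x τ k (ω k)) T).image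
        fun k : Fin n => pos x τ k (ω k) T).card
      ≤ ∏ k : Fin n, ((if IsGood T x τ π n ε k (pos x τ k (ω k)) T then R else 1)
        + ∑ i : Fin n, if i < k then
          (if ∃ s ≤ T, τ k ≤ s ∧ IsGood T x τ π n ε i (pos x τ i (ω i)) s
            ∧ pos x τ k (ω k) s = pos x τ i (ω i) s then 1 else 0) else 0) := by
  rw [Finset.card_image_of_injOn]
  · rw [← Finset.prod_const, Finset.prod_subset_one_on_sdiff
      (Finset.subset_univ (activeLabels T x τ π n ε (fun k => pos x τ k (ω k)) T))
      (g := fun k => if IsActive T x τ π n ε (fun k => pos x τ k (ω k)) T k then R else 1)]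
    · refine Finset.prod_le_prod' fun k _ => ?_
      split_ifs with h1 h2 h2
      · exact le_self_add
      · exact absurd h1.2.1 h2
      · have : ∃ s ≤ T, τ k ≤ s ∧ ∃ i < k, IsGood T x τ π n ε i (pos x τ i (ω i)) s ∧
            pos x τ i (ω i) s = pos x τ k (ω k) s := by
          by_contra hcon
          push Not at hcon
          exact h1 ⟨hτ k k.2, h2, hcon⟩
        obtain ⟨s, hs, hks, i, hik, hg, he⟩ := this
        refine le_add_left ((Finset.single_le_sum (fun _ _ => zero_le)
          (Finset.mem_univ i)).trans' ?_)
        rw [if_pos hik, if_pos ⟨s, hs, hks, hg, he.symm⟩]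
      · exact le_self_add
    · intro k hk
      rw [if_neg]
      simpa [mem_activeLabels] using hk
    · intro k hk
      rw [if_pos ((mem_activeLabels T x τ π n ε).1 hk)]
  · intro k hk i hi
    exact IsActive.injOn T x τ π n ε (y := fun k : Fin n => pos x τ k (ω k))
      ((mem_activeLabels T x τ π n ε).1 hk) ((mem_activeLabels T x τ π n ε).1 hi)

-- Meetings while the path `y` is good all happen before the last time at which it is good, and the
-- definition of goodness at that time is the bound `ε`. It holds for every path, which the link
-- product needs.
open scoped Classical in
lemma sum_meet_good_le (i : ℕ) (y : ℕ → G) :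
    ∑ c ∈ Finset.Ioo i n, ∫⁻ ω : Fin T → G, (if ∃ s ≤ T, τ c ≤ s ∧ IsGood T x τ π n ε i y s
      ∧ pos x τ c ω s = y s then 1 else 0) ∂(stepLaw π T) ≤ ε := by
  by_cases hex : ∃ s ≤ T, IsGood T x τ π n ε i y s
  · set s₀ := Nat.findGreatest (fun s => IsGood T x τ π n ε i y s) T with hs₀
    obtain ⟨s, hs, hgs⟩ := hex
    have hg : IsGood T x τ π n ε i y s₀ :=
      Nat.findGreatest_spec (P := fun s => IsGood T x τ π n ε i y s) hs hgs
    refine le_trans (Finset.sum_le_sum fun c _ => ?_) hg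
    rw [← lintegral_indicator_one .of_discrete]
    refine lintegral_mono fun ω => ?_
    simp only [Set.indicator]
    split_ifs with h1 h2 h2
    · exact le_rfl
    · obtain ⟨r, hr, hcr, hgr, he⟩ := h1
      exact absurd ⟨r, hcr, Nat.le_findGreatest hr hgr, he⟩ h2
    · exact zero_le
    · exact le_rfl
  · refine le_trans (le_of_eq (Finset.sum_eq_zero fun c _ => ?_)) zero_le
    rw [lintegral_eq_zero_iff .of_discrete]
    refine Filter.Eventually.of_forall fun ω => ?_
    simp only [Pi.zero_apply, ite_eq_right_iff, one_ne_zero, imp_false]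
    rintro ⟨s, hs, -, hg, -⟩
    exact hex ⟨s, hs, hg⟩

-- Markov's inequality for the expected number of later walkers that meet the path.
open scoped Classical in
lemma lintegral_isGood_le [IsProbabilityMeasure π] (R : ℝ≥0∞) (k : ℕ) (hε0 : ε ≠ 0)
    (hε : ε ≠ ∞) :
    ∫⁻ ω : Fin T → G, (if IsGood T x τ π n ε k (pos x τ k ω) T then R else 1) ∂(stepLaw π T)
      ≤ R + ε⁻¹ * ∑ c ∈ Finset.Ioo k n,
        ∫⁻ ω, stepLaw π T (hits x τ T c (pos x τ k ω) T) ∂(stepLaw π T) := by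
  rw [← lintegral_finsetSum _ fun _ _ => .of_discrete, ← lintegral_const_mul _ .of_discrete]
  calc _ ≤ ∫⁻ ω : Fin T → G, (R + ε⁻¹ * ∑ c ∈ Finset.Ioo k n,
          stepLaw π T (hits x τ T c (pos x τ k ω) T)) ∂(stepLaw π T) := by
        refine lintegral_mono fun ω => ?_
        split_ifs with h
        · exact le_self_add
        · refine le_add_left ?_
          rw [← ENNReal.inv_mul_cancel hε0 hε]
          gcongr
          exact (not_le.1 h).le
    _ = _ := by
        rw [lintegral_add_left measurable_const]
        simp

/-- If the Green function of a symmetric walk has a finite first moment, then any function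
of finite sets that evolves at most like lazy coalescing walks, and equals `ρ` to the cardinality
at the end, is exponentially small in the number of walks, as long as these start at distant
times. -/
theorem exists_rate_of_coalescing (ν : Measure G) [IsProbabilityMeasure ν]
    (hν : IsReflectionInvariant ν) (hS : greenMoment ν 0 ≠ ∞) (ρ : ℝ) (hρ0 : 0 ≤ ρ) (hρ1 : ρ < 1) :
    ∃ M : ℕ, 0 < M ∧ ∃ r : ℝ, 0 < r ∧ r < 1 ∧ ∀ m : ℕ, 0 < m → ∀ (n T : ℕ) (x : ℕ → G) (τ : ℕ → ℕ),
      (∀ k < n, τ k ≤ T) → (∀ i k, i < k → k < n → τ i + (k - i) * (M * m) ≤ τ k) →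
      ∀ (v : ℕ → Finset G → ℝ≥0∞) (e : ℝ≥0∞), (∀ j A B, A ⊆ B → v j B ≤ v j A) →
      (∀ j < T, ∀ (I : Finset (Fin n)) (y : Fin n → G), Set.InjOn y I →
        v j (I.image y) ≤ ∫⁻ z, v (j + 1) (I.image (y + z) ∪ newSites x τ n (j + 1))
          ∂(stepLaw (lazyStep (m : ℝ≥0∞)⁻¹ ν) n) + e) →
      (∀ A, v T A ≤ ENNReal.ofReal ρ ^ A.card) →
      v 0 (newSites x τ n 0) ≤ ENNReal.ofReal r ^ n + T * e := by
  classical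
  -- The link product is applied with `θ = 1 / a` and `K = κ`, and gives the rate `κ (ρ + a + a) = κ
  -- (1 + ρ) / 2 = (3 + ρ) / 4`. Here one `a` is room for bad paths, the other is `θ⁻¹`, and `ε` is
  -- chosen such that `exp (ε / a) = κ`.
  set a : ℝ := (1 - ρ) / 4 with ha
  have ha0 : 0 < a := by rw [ha]; linarith
  set κ : ℝ := (3 + ρ) / (2 * (1 + ρ)) with hκ
  have hκ1 : 1 < κ := by rw [hκ, lt_div_iff₀ (by linarith)]; linarith
  obtain ⟨ε, hε⟩ : ∃ ε, ε = a * Real.log κ := ⟨_, rfl⟩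
  have hε0 : 0 < ε := hε ▸ mul_pos ha0 (Real.log_pos hκ1)
  -- The spacing in lazy steps is `M * m` with `δ = 1 / m`, so `δ * H = M`. The expected number of
  -- later meetings is at most `16 / M` times the Green moment, and for this `M` the probability of
  -- a bad path is at most `a`.
  obtain ⟨M, hM⟩ := exists_nat_gt (16 * (greenMoment ν 0).toReal / (ε * a))
  have hM0 : 0 < M := by
    have : (0 : ℝ) ≤ 16 * (greenMoment ν 0).toReal / (ε * a) := by positivity
    exact_mod_cast this.trans_lt hM
  refine ⟨M, hM0, (3 + ρ) / 4, by linarith, by linarith, ?_⟩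
  intro m hm n T x τ hτT hτ v e hanti hstep hend
  set δ : ℝ≥0∞ := (m : ℝ≥0∞)⁻¹ with hδ
  have hδ1 : δ ≤ 1 := ENNReal.inv_le_one.2 (by exact_mod_cast hm)
  have hδ0 : δ ≠ 0 := by simp [hδ]
  have hm0 : (m : ℝ≥0∞) ≠ 0 := by exact_mod_cast hm.ne'
  set π := lazyStep δ ν with hπ
  have : IsProbabilityMeasure π := isProbabilityMeasure_lazyStep hδ1 ν
  have hπr : IsReflectionInvariant π := isReflectionInvariant_lazyStep δ hν
  have hε0' : ENNReal.ofReal ε ≠ 0 := by simpa using hε0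
  refine (le_lintegral_activeLabels T x τ π n (ENNReal.ofReal ε) v e hanti hstep).trans ?_
  gcongr
  calc _ ≤ ∫⁻ ω, ENNReal.ofReal ρ ^
          ((activeLabels T x τ π n (ENNReal.ofReal ε) (fun k => pos x τ k (ω k)) T).image
          fun k : Fin n => pos x τ k (ω k) T).card ∂(Measure.pi fun _ : Fin n => stepLaw π T) :=
        lintegral_mono fun ω => hend _
    _ ≤ _ := lintegral_mono fun ω => pow_card_activeLabels_le T x τ π n (ENNReal.ofReal ε)
        (ENNReal.ofReal ρ) hτT ω
    _ ≤ (ENNReal.ofReal κ * (ENNReal.ofReal (ρ + a) + (ENNReal.ofReal a⁻¹)⁻¹)) ^ n := by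
        refine lintegral_prod_link_le (stepLaw π T) n
          (fun k ω => if IsGood T x τ π n (ENNReal.ofReal ε) k (pos x τ k ω) T
            then ENNReal.ofReal ρ else 1)
          (fun c i ω ω' => if ∃ s ≤ T, τ c ≤ s ∧ IsGood T x τ π n (ENNReal.ofReal ε) i (pos x τ i ω') s
            ∧ pos x τ c ω s = pos x τ i ω' s then 1 else 0) _ (ENNReal.ofReal a⁻¹) _ ?_ ?_ ?_ ?_
        · simpa using ha0
        · exact ENNReal.ofReal_ne_top
        · intro k hk
          refine (lintegral_isGood_le T x τ π n _ _ k hε0' ENNReal.ofReal_ne_top).trans ?_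
          rw [ENNReal.ofReal_add hρ0 ha0.le]
          gcongr
          calc _ ≤ (ENNReal.ofReal ε)⁻¹ * ∑ c ∈ Finset.Ioo k n,
                (avg π)^[τ c - τ k] (meetBound δ ν) (x k - x c) := by
                refine mul_le_mul_right (Finset.sum_le_sum fun c hc => ?_) _
                have hc' := Finset.mem_Ioo.1 hc
                exact lintegral_hits_le x τ π hπr _ (avg_avg_meetBound_le δ ν)
                  (one_le_meetBound hδ0 hδ1 ν) c k
                  ((Nat.le_add_right _ _).trans (hτ k c hc'.1 hc'.2)) (hτT c hc'.2)
            _ ≤ (ENNReal.ofReal ε)⁻¹ * (16 * (δ * (M * m : ℕ))⁻¹ * greenMoment ν 0) := by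
                refine mul_le_mul_right ?_ _
                refine sum_avg_iterate_meetBound_le hδ1 ν hν (Nat.mul_pos hM0 hm) _ k
                  (fun c hc => (Finset.mem_Ioo.1 hc).1) (fun c => τ c - τ k) (fun c hc => ?_)
                  (fun c => x k - x c)
                have hc' := Finset.mem_Ioo.1 hc
                have := hτ k c hc'.1 hc'.2
                omega
            _ = ENNReal.ofReal (ε⁻¹ * (16 * (M : ℝ)⁻¹ * (greenMoment ν 0).toReal)) := by
                have h1 : δ * (M * m : ℕ) = M := by
                  push_cast
                  rw [mul_left_comm, hδ, ENNReal.inv_mul_cancel hm0 (by simp), mul_one]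
                rw [h1, ENNReal.ofReal_mul (by positivity), ENNReal.ofReal_mul (by positivity),
                  ENNReal.ofReal_mul (by positivity), ENNReal.ofReal_toReal hS,
                  ENNReal.ofReal_inv_of_pos hε0, ENNReal.ofReal_inv_of_pos (by exact_mod_cast hM0)]
                simp
            _ ≤ _ := by
                refine ENNReal.ofReal_le_ofReal ?_
                rw [div_lt_iff₀ (mul_pos hε0 ha0)] at hM
                have hMr : (0 : ℝ) < M := by exact_mod_cast hM0
                rw [← mul_assoc, ← mul_assoc, mul_right_comm, ← div_eq_mul_inv, div_le_iff₀ hMr,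
                  mul_assoc, inv_mul_le_iff₀ hε0]
                linarith
        · intro i _ ω'
          have h1 := sum_meet_good_le T x τ π n (ENNReal.ofReal ε) i (pos x τ i ω')
          refine (prod_one_add_le_exp _ _ (c := a⁻¹ * ε) (by positivity) ?_).trans ?_
          · rw [← Finset.mul_sum, ENNReal.ofReal_mul (by positivity)]
            exact mul_le_mul_right h1 _
          · rw [hε, ← mul_assoc, inv_mul_cancel₀ ha0.ne', one_mul, Real.exp_log (by linarith)]
    _ = _ := by
        congr 1
        rw [ENNReal.ofReal_inv_of_pos ha0, inv_inv, ← ENNReal.ofReal_add (by linarith) ha0.le,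
          ← ENNReal.ofReal_mul (by linarith)]
        congr 1
        rw [hκ, ha]
        field_simp
        ring

end Walkers

/-! ### The jump law of the kernel, and strong transience as a finite Green moment. -/

section Kernel

variable {d : ℕ} {p : Lattice d → Lattice d → ℝ}

/-- The law of a single jump of the walk with kernel `p`. -/
def jump (p : Lattice d → Lattice d → ℝ) : Measure (Lattice d) :=
  Measure.sum fun z => ENNReal.ofReal (p 0 z) • Measure.dirac z

lemma lintegral_jump (φ : Lattice d → ℝ≥0∞) :
    ∫⁻ z, φ z ∂(jump p) = ∑' z, ENNReal.ofReal (p 0 z) * φ z := by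
  simp [jump, lintegral_sum_measure]

lemma IsRandomWalkKernel.isProbabilityMeasure_jump (hp : IsRandomWalkKernel p) :
    IsProbabilityMeasure (jump p) := by
  constructor
  rw [← lintegral_one, lintegral_jump]
  simp only [mul_one]
  rw [← ENNReal.ofReal_tsum_of_nonneg (hp.nonneg 0) (hp.hasSum_one 0).summable,
    (hp.hasSum_one 0).tsum_eq, ENNReal.ofReal_one]

lemma IsRandomWalkKernel.apply_eq (hp : IsRandomWalkKernel p) (x y : Lattice d) :
    p x y = p 0 (y - x) := by
  have := hp.translation 0 (y - x) x
  rwa [zero_add, sub_add_cancel] at this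

lemma IsRandomWalkKernel.apply_add (hp : IsRandomWalkKernel p) (x z : Lattice d) :
    p x (x + z) = p 0 z := by
  rw [hp.apply_eq, add_sub_cancel_left]

lemma isReflectionInvariant_jump (hp : IsRandomWalkKernel p) (hsymm : ∀ x y, p x y = p y x) :
    IsReflectionInvariant (jump p) := by
  intro φ
  rw [lintegral_jump, lintegral_jump, ← (Equiv.neg _).tsum_eq]
  refine tsum_congr fun z => ?_
  simp only [Equiv.neg_apply, neg_neg]
  rw [hsymm 0 (-z), hp.apply_eq (-z) 0, zero_sub, neg_neg]

lemma stepKernel_nonneg (hp : IsRandomWalkKernel p) (n : ℕ) (x y : Lattice d) :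
    0 ≤ stepKernel p n x y := by
  induction n generalizing x with
  | zero => simp only [stepKernel]; split_ifs <;> norm_num
  | succ n ih => exact tsum_nonneg fun z => mul_nonneg (hp.nonneg x z) (ih z)

lemma stepKernel_le_one (hp : IsRandomWalkKernel p) (n : ℕ) (x y : Lattice d) :
    stepKernel p n x y ≤ 1 := by
  induction n generalizing x with
  | zero => simp only [stepKernel]; split_ifs <;> norm_num
  | succ n ih =>
    rw [stepKernel, ← (hp.hasSum_one x).tsum_eq]
    have h : ∀ z, p x z * stepKernel p n z y ≤ p x z :=
      fun z => mul_le_of_le_one_right (hp.nonneg x z) (ih z)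
    exact (Summable.of_nonneg_of_le (fun z => mul_nonneg (hp.nonneg x z)
      (stepKernel_nonneg hp n z y)) h (hp.hasSum_one x).summable).tsum_le_tsum h
      (hp.hasSum_one x).summable

lemma walkProb_jump (hp : IsRandomWalkKernel p) (n : ℕ) (x : Lattice d) :
    walkProb (jump p) n x = ENNReal.ofReal (stepKernel p n x 0) := by
  induction n generalizing x with
  | zero => simp [walkProb, stepKernel, Pi.single_apply]; split_ifs <;> simp
  | succ n ih =>
    have h : ∀ z, p x z * stepKernel p n z 0 ≤ p x z :=
      fun z => mul_le_of_le_one_right (hp.nonneg x z) (stepKernel_le_one hp n z 0)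
    have h0 : ∀ z, 0 ≤ p x z * stepKernel p n z 0 :=
      fun z => mul_nonneg (hp.nonneg x z) (stepKernel_nonneg hp n z 0)
    rw [walkProb_succ, avg, lintegral_jump, stepKernel, ENNReal.ofReal_tsum_of_nonneg h0
      (Summable.of_nonneg_of_le h0 h (hp.hasSum_one x).summable),
      ← (Equiv.addLeft x).tsum_eq (fun z => ENNReal.ofReal (p x z * stepKernel p n z 0))]
    refine tsum_congr fun z => ?_
    rw [Equiv.coe_addLeft, ENNReal.ofReal_mul (hp.nonneg _ _), ih, hp.apply_add]

lemma lintegral_gamma_nat (n : ℕ) :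
    ∫⁻ t in Set.Ioi (0 : ℝ), ENNReal.ofReal (t * (Real.exp (-t) * t ^ n / n.factorial))
      = n + 1 := by
  have h1 := Real.Gamma_eq_integral (s := n + 2) (by positivity)
  have h2 : Real.Gamma (n + 2) = (n + 1).factorial := by
    rw [← Real.Gamma_nat_eq_factorial (n + 1)]; push_cast; ring_nf
  have hint := Real.GammaIntegral_convergent (s := n + 2) (by positivity)
  have he : ∀ t ∈ Set.Ioi (0 : ℝ), t * (Real.exp (-t) * t ^ n / n.factorial)
      = (n.factorial : ℝ)⁻¹ * (Real.exp (-t) * t ^ ((n : ℝ) + 2 - 1)) := by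
    intro t ht
    rw [show (n : ℝ) + 2 - 1 = ((n + 1 : ℕ) : ℝ) by push_cast; ring, Real.rpow_natCast]
    ring
  rw [setLIntegral_congr_fun measurableSet_Ioi (fun t ht => by rw [he t ht]),
    ← ofReal_integral_eq_lintegral_ofReal (hint.const_mul _), integral_const_mul, ← h1, h2,
    Nat.factorial_succ]
  · rw [show (n.factorial : ℝ)⁻¹ * ((n + 1) * n.factorial : ℕ) = ((n + 1 : ℕ) : ℝ) by
      push_cast; field_simp]
    rw [ENNReal.ofReal_natCast]; push_cast; rfl
  · refine (ae_restrict_iff' measurableSet_Ioi).2 (Eventually.of_forall fun t ht => ?_)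
    have : (0 : ℝ) < t := ht
    simp only [Pi.zero_apply]
    positivity

/-- Since `∫ t e^{-t} t^n / n! dt = n + 1`, integrating the Poisson series of `t p_t(0,0)` term by
term gives exactly the Green moment of the jump chain. -/
lemma greenMoment_jump_ne_top (hp : IsRandomWalkKernel p) (h : StronglyTransient p) :
    greenMoment (jump p) 0 ≠ ∞ := by
  have h1 : greenMoment (jump p) 0
      = ∫⁻ t in Set.Ioi (0 : ℝ), ENNReal.ofReal (t * timeKernel p t 0 0) := by
    calc _ = ∑' n : ℕ, ∫⁻ t in Set.Ioi (0 : ℝ),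
          ENNReal.ofReal (t * (Real.exp (-t) * t ^ n / n.factorial)) * walkProb (jump p) n 0 := by
          refine tsum_congr fun n => ?_
          rw [lintegral_mul_const _ (by fun_prop), lintegral_gamma_nat]
      _ = ∫⁻ t in Set.Ioi (0 : ℝ), ∑' n : ℕ,
          ENNReal.ofReal (t * (Real.exp (-t) * t ^ n / n.factorial)) * walkProb (jump p) n 0 :=
          (lintegral_tsum fun n => by fun_prop).symm
      _ = _ := by
          refine setLIntegral_congr_fun measurableSet_Ioi fun t ht => ?_
          have ht' : (0 : ℝ) < t := ht
          have hs : Summable fun n : ℕ =>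
              Real.exp (-t) * t ^ n / n.factorial * stepKernel p n 0 0 := by
            refine Summable.of_nonneg_of_le
              (fun n => mul_nonneg (by positivity) (stepKernel_nonneg hp n 0 0))
              (fun n => mul_le_of_le_one_right (by positivity) (stepKernel_le_one hp n 0 0)) ?_
            simpa only [mul_div_assoc] using (Real.summable_pow_div_factorial t).mul_left (Real.exp (-t))
          simp only [timeKernel]
          rw [ENNReal.ofReal_mul ht'.le, ENNReal.ofReal_tsum_of_nonneg
            (fun n => mul_nonneg (by positivity) (stepKernel_nonneg hp n 0 0)) hs,
            ← ENNReal.tsum_mul_left]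
          refine tsum_congr fun n => ?_
          rw [walkProb_jump hp, ENNReal.ofReal_mul ht'.le,
            ENNReal.ofReal_mul (p := Real.exp (-t) * t ^ n / n.factorial) (by positivity), mul_assoc]
  rw [h1]
  exact h.lintegral_lt_top.ne

end Kernel

/-! ### Duality between the voter generator and coalescing random walks. -/

section Occupation

variable {d : ℕ} {p : Lattice d → Lattice d → ℝ}

open scoped Classical in
/-- The indicator of the event that all sites of `A` are occupied. -/
def occ (A : Finset (Lattice d)) (η : Config d) : ℝ := if ∀ x ∈ A, η x = true then 1 else 0

/-- The map that moves the site `x` to `y` and fixes all other sites. -/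
def moveTo (x y z : Lattice d) : Lattice d := if z = x then y else z

lemma occ_nonneg (A : Finset (Lattice d)) (η : Config d) : 0 ≤ occ A η := by
  unfold occ; split_ifs <;> norm_num

lemma occ_le_one (A : Finset (Lattice d)) (η : Config d) : occ A η ≤ 1 := by
  unfold occ; split_ifs <;> norm_num

@[simp] lemma occ_empty (η : Config d) : occ ∅ η = 1 := by simp [occ]

lemma occ_singleton (x : Lattice d) (η : Config d) :
    occ {x} η = if η x = true then 1 else 0 := by simp [occ]

lemma occ_union (A B : Finset (Lattice d)) (η : Config d) :
    occ (A ∪ B) η = occ A η * occ B η := by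
  simp only [occ, Finset.mem_union, or_imp, forall_and]
  split_ifs <;> simp_all

lemma occ_insert (x : Lattice d) (A : Finset (Lattice d)) (η : Config d) :
    occ (insert x A) η = (if η x = true then 1 else 0) * occ A η := by
  rw [Finset.insert_eq, occ_union, occ_singleton]

lemma occ_anti {A B : Finset (Lattice d)} (h : A ⊆ B) (η : Config d) : occ B η ≤ occ A η := by
  simp only [occ]
  split_ifs with h1 h2 h2
  · exact le_rfl
  · exact absurd (fun x hx => h1 x (h hx)) h2
  · exact zero_le_one
  · exact le_rfl

/-- This is the pathwise form of duality: if `x` adopts the value of `y`, then `A` is occupied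
afterwards exactly if its image under moving `x` to `y` was occupied before. Sites that are moved
onto each other coalesce. -/
lemma occ_adopt (A : Finset (Lattice d)) (η : Config d) (x y : Lattice d) :
    occ A (adopt η x y) = occ (A.image (moveTo x y)) η := by
  have : adopt η x y = fun z => η (moveTo x y z) := by
    funext z
    simp only [adopt, moveTo, Function.update_apply]
    split_ifs <;> rfl
  simp [occ, this]

lemma image_moveTo_of_notMem {A : Finset (Lattice d)} {x : Lattice d} (hx : x ∉ A)
    (y : Lattice d) : A.image (moveTo x y) = A := by
  rw [Finset.image_congr (g := id), Finset.image_id]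
  intro z hz
  simp only [moveTo, id]
  rw [if_neg]
  rintro rfl
  exact hx hz

lemma isCylinder_occ (A : Finset (Lattice d)) : IsCylinder (occ A) := by
  refine ⟨A, fun η η' h => ?_⟩
  have : (∀ x ∈ A, η x = true) ↔ ∀ x ∈ A, η' x = true :=
    forall₂_congr fun x hx => by rw [h x hx]
  simp only [occ, this]

lemma continuous_occ (A : Finset (Lattice d)) : Continuous (occ A) := by
  induction A using Finset.induction_on with
  | empty => exact (continuous_const (y := (1 : ℝ))).congr fun η => (occ_empty η).symm
  | insert x A _ ih =>
    have h : Continuous fun b : Bool => if b = true then (1 : ℝ) else 0 :=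
      continuous_of_discreteTopology
    exact ((h.comp (continuous_apply x)).mul ih).congr fun η => (occ_insert x A η).symm

lemma measurable_occ (A : Finset (Lattice d)) : Measurable (occ A) :=
  (continuous_occ A).measurable

/-- The generator of coalescing random walks, which is dual to the voter generator. -/
def coalOp (p : Lattice d → Lattice d → ℝ) (φ : Finset (Lattice d) → ℝ)
    (A : Finset (Lattice d)) : ℝ :=
  ∑ x ∈ A, ∑' y, p x y * (φ (A.image (moveTo x y)) - φ A)

lemma voterGenerator_occ (p : Lattice d → Lattice d → ℝ) (A : Finset (Lattice d)) (η : Config d) :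
    voterGenerator p (occ A) η = coalOp p (fun B => occ B η) A := by
  rw [voterGenerator, tsum_eq_sum (s := A)]
  · simp only [occ_adopt, coalOp]
  · intro x hx
    simp [occ_adopt, image_moveTo_of_notMem hx]

lemma summable_mul_of_bounded (hp : IsRandomWalkKernel p) (x : Lattice d) {f : Lattice d → ℝ}
    {C : ℝ} (hf : ∀ y, |f y| ≤ C) : Summable fun y => p x y * f y := by
  refine Summable.of_norm_bounded ((hp.hasSum_one x).summable.mul_right C) fun y => ?_
  rw [Real.norm_eq_abs, abs_mul, abs_of_nonneg (hp.nonneg x y)]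
  exact mul_le_mul_of_nonneg_left (hf y) (hp.nonneg x y)

lemma abs_tsum_mul_le (hp : IsRandomWalkKernel p) (x : Lattice d) {f : Lattice d → ℝ}
    {C : ℝ} (hf : ∀ y, |f y| ≤ C) : |∑' y, p x y * f y| ≤ C := by
  rw [← Real.norm_eq_abs]
  refine (tsum_of_norm_bounded ((hp.hasSum_one x).mul_right C) fun y => ?_).trans (by simp)
  rw [Real.norm_eq_abs, abs_mul, abs_of_nonneg (hp.nonneg x y)]
  exact mul_le_mul_of_nonneg_left (hf y) (hp.nonneg x y)

lemma abs_coalOp_le (hp : IsRandomWalkKernel p) {φ : Finset (Lattice d) → ℝ} {C : ℝ}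
    {A : Finset (Lattice d)} (hφ : ∀ x y, |φ (A.image (moveTo x y)) - φ A| ≤ C) :
    |coalOp p φ A| ≤ A.card * C := by
  refine (Finset.abs_sum_le_sum_abs _ _).trans ?_
  rw [← nsmul_eq_mul]
  exact Finset.sum_le_card_nsmul _ _ _ fun x _ => abs_tsum_mul_le hp x fun y => hφ x y

lemma abs_occ_sub_le (A B : Finset (Lattice d)) (η : Config d) : |occ A η - occ B η| ≤ 1 := by
  rw [abs_sub_le_iff]
  constructor <;> linarith [occ_nonneg A η, occ_le_one A η, occ_nonneg B η, occ_le_one B η]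

lemma continuous_voterGenerator_occ (hp : IsRandomWalkKernel p) (A : Finset (Lattice d)) :
    Continuous (voterGenerator p (occ A)) := by
  have : voterGenerator p (occ A) = fun η => coalOp p (fun B => occ B η) A :=
    funext fun η => voterGenerator_occ p A η
  rw [this]
  refine continuous_finsetSum _ fun x _ => ?_
  refine continuous_tsum (fun y => ?_) (hp.hasSum_one x).summable fun y η => ?_
  · exact continuous_const.mul ((continuous_occ _).sub (continuous_occ _))
  · rw [Real.norm_eq_abs, abs_mul, abs_of_nonneg (hp.nonneg x y)]
    exact mul_le_of_le_one_right (hp.nonneg x y) (abs_occ_sub_le _ _ η)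

end Occupation

/-- Time is rounded to a grid point on its right. Each approximation takes countably many time
values, and right-continuity gives convergence. -/
lemma measurable_uncurry_of_rightContinuous {Ω : Type*} [MeasurableSpace Ω] {f : ℝ → Ω → ℝ}
    (hm : ∀ t, Measurable (f t)) (hc : ∀ ω t, ContinuousWithinAt (fun s => f s ω) (Set.Ici t) t) :
    Measurable (Function.uncurry f) := by
  have hlim : ∀ t : ℝ, Tendsto (fun n : ℕ => ((⌊t * (n + 1)⌋ : ℝ) + 1) / (n + 1)) atTop
      (𝓝[≥] t) := by
    intro t
    refine tendsto_nhdsWithin_iff.2 ⟨?_, Eventually.of_forall fun n => ?_⟩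
    · refine tendsto_of_tendsto_of_tendsto_of_le_of_le (g := fun _ => t)
        (h := fun n : ℕ => t + 1 / ((n : ℝ) + 1)) tendsto_const_nhds ?_ ?_ ?_
      · simpa using (tendsto_const_nhds (x := t)).add tendsto_one_div_add_atTop_nhds_zero_nat
      · intro n
        have hn : (0 : ℝ) < n + 1 := by positivity
        rw [le_div_iff₀ hn]
        exact (Int.lt_floor_add_one _).le
      · intro n
        have hn : (0 : ℝ) < n + 1 := by positivity
        simp only
        rw [div_le_iff₀ hn, add_mul, one_div, inv_mul_cancel₀ hn.ne']
        linarith [Int.floor_le (t * (n + 1))]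
    · have hn : (0 : ℝ) < n + 1 := by positivity
      rw [Set.mem_Ici, le_div_iff₀ hn]
      exact (Int.lt_floor_add_one _).le
  refine measurable_of_tendsto_metrizable
    (f := fun (n : ℕ) (q : ℝ × Ω) => f (((⌊q.1 * (n + 1)⌋ : ℝ) + 1) / (n + 1)) q.2) ?_ ?_
  · intro n
    have h1 : Measurable fun q : ℤ × Ω => f (((q.1 : ℝ) + 1) / (n + 1)) q.2 :=
      measurable_from_prod_countable_right fun k => hm (((k : ℝ) + 1) / (n + 1))
    exact h1.comp ((Int.measurable_floor.comp (measurable_fst.mul_const _)).prodMk measurable_snd)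
  · rw [tendsto_pi_nhds]
    intro q
    exact (hc q.2 q.1).tendsto.comp (hlim q.1)

/-! ### Moments of the voter model: forward equation, Euler error, and lazy coalescing steps. -/

section VoterMoments

variable {d : ℕ} {Ω : Type*} [mΩ : MeasurableSpace Ω] {p : Lattice d → Lattice d → ℝ}
  {μ : Measure (Config d)} {P : Measure Ω} [IsProbabilityMeasure P] {ℱ : Filtration ℝ≥0 mΩ}
  {ξ : ℝ≥0 → Ω → Config d}

lemma IsVoterModel.measurable (hξ : IsVoterModel p μ P ℱ ξ) (t : ℝ≥0) : Measurable (ξ t) :=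
  (hξ.adapted t).mono (ℱ.le t) le_rfl

lemma IsVoterModel.rightContinuous_toNNReal (hξ : IsVoterModel p μ P ℱ ξ) (ω : Ω) (t : ℝ) :
    ContinuousWithinAt (fun s : ℝ => ξ s.toNNReal ω) (Set.Ici t) t :=
  (hξ.right_continuous ω t.toNNReal).comp continuous_real_toNNReal.continuousWithinAt
    fun _ hs => Real.toNNReal_mono hs

lemma IsVoterModel.measurable_uncurry (hξ : IsVoterModel p μ P ℱ ξ) {f : Config d → ℝ}
    (hf : Continuous f) : Measurable (Function.uncurry fun (r : ℝ) ω => f (ξ r.toNNReal ω)) :=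
  measurable_uncurry_of_rightContinuous
    (fun t => hf.measurable.comp (hξ.measurable t.toNNReal))
    fun ω t => hf.continuousAt.comp_continuousWithinAt (hξ.rightContinuous_toNNReal ω t)

lemma abs_voterGenerator_occ_le (hp : IsRandomWalkKernel p) (A : Finset (Lattice d))
    (η : Config d) : |voterGenerator p (occ A) η| ≤ A.card := by
  rw [voterGenerator_occ]
  refine (abs_coalOp_le hp (C := 1) fun x y => abs_occ_sub_le _ _ η).trans (by simp)

lemma integrable_of_abs_le {f : Ω → ℝ} (hf : AEStronglyMeasurable f P) {C : ℝ}
    (h : ∀ ω, |f ω| ≤ C) : Integrable f P :=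
  Integrable.of_bound hf C (Eventually.of_forall h)

/-- The expected increment of the occupation indicator of a finite set, weighted with
a function of the past. -/
lemma IsVoterModel.integral_occ_sub (hξ : IsVoterModel p μ P ℱ ξ) (hp : IsRandomWalkKernel p)
    (A : Finset (Lattice d)) {s t : ℝ≥0} (hst : s ≤ t) {Z : Ω → ℝ} (hZ : Measurable[ℱ s] Z)
    {C : ℝ} (hC : ∀ ω, |Z ω| ≤ C) :
    ∫ ω, (occ A (ξ t ω) - occ A (ξ s ω)) * Z ω ∂P
      = ∫ r in (s : ℝ)..t, ∫ ω, voterGenerator p (occ A) (ξ r.toNNReal ω) * Z ω ∂P := by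
  have hZm : Measurable Z := hZ.mono (ℱ.le s) le_rfl
  set g : ℝ → Ω → ℝ := fun r ω => voterGenerator p (occ A) (ξ r.toNNReal ω) with hg
  have hgm : Measurable (Function.uncurry g) :=
    hξ.measurable_uncurry (continuous_voterGenerator_occ hp A)
  have hgb : ∀ r ω, |g r ω| ≤ A.card := fun r ω => abs_voterGenerator_occ_le hp A _
  have hgi : ∀ ω (a b : ℝ), IntervalIntegrable (fun r => g r ω) volume a b := by
    intro ω a b
    refine (intervalIntegrable_const (c := (A.card : ℝ))).mono_fun
      (hgm.comp measurable_prodMk_right).aestronglyMeasurable (Eventually.of_forall fun r => ?_)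
    simpa using hgb r ω
  set M : ℝ≥0 → Ω → ℝ := fun t ω => occ A (ξ t ω) - occ A (ξ 0 ω) - ∫ r in (0 : ℝ)..t, g r ω
    with hM
  have hmart : Martingale M ℱ P := hξ.martingale (occ A) (isCylinder_occ A)
  have hMZ : ∀ r, Integrable (M r * Z) P := fun r =>
    (hmart.integrable r).mul_bdd (c := C) hZm.aestronglyMeasurable (Eventually.of_forall hC)
  -- The weight `Z` is bounded and known at time `s`, so it passes through the conditional
  -- expectation of the martingale.
  have h0 : ∫ ω, (M t * Z) ω ∂P = ∫ ω, (M s * Z) ω ∂P := by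
    rw [← integral_condExp (ℱ.le s)]
    refine integral_congr_ae ?_
    refine (condExp_mul_of_stronglyMeasurable_right hZ.stronglyMeasurable (hMZ t)
      (hmart.integrable t)).trans ?_
    exact (hmart.condExp_ae_eq hst).mul EventuallyEq.rfl
  have hi : Integrable (fun ω => (occ A (ξ t ω) - occ A (ξ s ω)) * Z ω) P := by
    refine integrable_of_abs_le (C := 1 * C) ?_ fun ω => ?_
    · exact ((((measurable_occ A).comp (hξ.measurable t)).sub
        ((measurable_occ A).comp (hξ.measurable s))).mul hZm).aestronglyMeasurable
    · rw [abs_mul, one_mul]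
      exact (mul_le_of_le_one_left (abs_nonneg _)
        (abs_sub_le_iff.2 ⟨by linarith [occ_le_one A (ξ t ω), occ_nonneg A (ξ s ω)],
          by linarith [occ_le_one A (ξ s ω), occ_nonneg A (ξ t ω)]⟩)).trans (hC ω)
  have h1 : ∫ ω, (occ A (ξ t ω) - occ A (ξ s ω)) * Z ω ∂P
      = ∫ ω, (∫ r in (s : ℝ)..t, g r ω * Z ω) ∂P := by
    have h2 : ∀ ω, ∫ r in (s : ℝ)..t, g r ω * Z ω
        = (occ A (ξ t ω) - occ A (ξ s ω)) * Z ω - ((M t * Z) ω - (M s * Z) ω) := by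
      intro ω
      rw [intervalIntegral.integral_mul_const, ← intervalIntegral.integral_interval_sub_left
        (hgi ω 0 t) (hgi ω 0 s)]
      simp only [hM, Pi.mul_apply]
      ring
    simp only [h2]
    have hs : Integrable (fun ω => (M t * Z) ω - (M s * Z) ω) P := (hMZ t).sub (hMZ s)
    rw [integral_sub hi hs, integral_sub (hMZ t) (hMZ s), h0]
    simp
  rw [h1]
  symm
  refine intervalIntegral_integral_swap ?_
  rw [Set.uIoc_of_le (by exact_mod_cast hst)]
  refine Integrable.of_bound (C := A.card * C) ?_ (Eventually.of_forall fun q => ?_)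
  · exact (hgm.mul (hZm.comp measurable_snd)).aestronglyMeasurable
  · rw [Function.uncurry_apply_pair _ q.1 q.2, norm_mul]
    exact mul_le_mul (hgb _ _) (hC _) (abs_nonneg _) (by positivity)

/-- The generator of coalescing random walks commutes with expectations. -/
lemma integral_voterGenerator_mul (hp : IsRandomWalkKernel p) (A : Finset (Lattice d))
    {X : Ω → Config d} (hX : Measurable X) {Z : Ω → ℝ} (hZ : AEStronglyMeasurable Z P) {C : ℝ}
    (hC : ∀ ω, |Z ω| ≤ C) :
    ∫ ω, voterGenerator p (occ A) (X ω) * Z ω ∂P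
      = coalOp p (fun B => ∫ ω, occ B (X ω) * Z ω ∂P) A := by
  have hi : ∀ B, Integrable (fun ω => occ B (X ω) * Z ω) P := fun B => by
    refine integrable_of_abs_le (C := C) ?_ fun ω => ?_
    · exact ((measurable_occ B).comp hX).aestronglyMeasurable.mul hZ
    · rw [abs_mul, abs_of_nonneg (occ_nonneg _ _)]
      exact (mul_le_of_le_one_left (abs_nonneg _) (occ_le_one _ _)).trans (hC ω)
  have hi2 : ∀ x y, Integrable (fun ω =>
      p x y * (occ (A.image (moveTo x y)) (X ω) - occ A (X ω)) * Z ω) P := fun x y => by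
    have := ((hi (A.image (moveTo x y))).sub (hi A)).const_mul (p x y)
    refine this.congr (Eventually.of_forall fun ω => ?_)
    simp only [Pi.sub_apply]
    ring
  have hb : ∀ x y ω, ‖p x y * (occ (A.image (moveTo x y)) (X ω) - occ A (X ω)) * Z ω‖
      ≤ p x y * C := by
    intro x y ω
    rw [mul_assoc, norm_mul, Real.norm_of_nonneg (hp.nonneg x y)]
    refine mul_le_mul_of_nonneg_left ?_ (hp.nonneg x y)
    rw [norm_mul]
    exact (mul_le_of_le_one_left (norm_nonneg _) (abs_occ_sub_le _ _ _)).trans (hC ω)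
  have hsum : ∀ x, HasSum (fun y => ∫ ω, p x y * (occ (A.image (moveTo x y)) (X ω)
      - occ A (X ω)) * Z ω ∂P) (∫ ω, ∑' y, p x y * (occ (A.image (moveTo x y)) (X ω)
      - occ A (X ω)) * Z ω ∂P) := by
    intro x
    refine hasSum_integral_of_summable_integral_norm (hi2 x) ?_
    refine Summable.of_nonneg_of_le (fun y => by positivity) (fun y => ?_)
      ((hp.hasSum_one x).summable.mul_right C)
    calc _ ≤ ∫ _, p x y * C ∂P := integral_mono (hi2 x y).norm (integrable_const _) fun ω => hb x y ω
      _ = _ := by simp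
  have hsi : ∀ x, Integrable (fun ω => ∑' y, p x y * (occ (A.image (moveTo x y)) (X ω)
      - occ A (X ω)) * Z ω) P := by
    intro x
    simp only [tsum_mul_right]
    refine integrable_of_abs_le (C := 1 * C) ?_ fun ω => ?_
    · have hc : Continuous fun η : Config d => ∑' y, p x y * (occ (A.image (moveTo x y)) η - occ A η) :=
        continuous_tsum (fun y => continuous_const.mul ((continuous_occ _).sub (continuous_occ _)))
          (hp.hasSum_one x).summable fun y η => by
            rw [norm_mul, Real.norm_of_nonneg (hp.nonneg x y)]
            exact mul_le_of_le_one_right (hp.nonneg x y) (abs_occ_sub_le _ _ η)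
      exact (hc.measurable.comp hX).aestronglyMeasurable.mul hZ
    · rw [abs_mul]
      exact mul_le_mul (abs_tsum_mul_le hp x fun y => abs_occ_sub_le _ _ _) (hC ω) (abs_nonneg _)
        zero_le_one
  simp only [voterGenerator_occ, coalOp, Finset.sum_mul, ← tsum_mul_right]
  rw [integral_finsetSum _ fun x _ => hsi x]
  refine Finset.sum_congr rfl fun x _ => ?_
  rw [← (hsum x).tsum_eq]
  refine tsum_congr fun y => ?_
  rw [← integral_sub (hi _) (hi _), ← integral_const_mul]
  refine integral_congr_ae (Eventually.of_forall fun ω => ?_)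
  simp only
  ring

/-- The weighted moment of the occupation indicator. -/
def moment (P : Measure Ω) (ξ : ℝ≥0 → Ω → Config d) (Z : Ω → ℝ) (t : ℝ≥0)
    (A : Finset (Lattice d)) : ℝ := ∫ ω, occ A (ξ t ω) * Z ω ∂P

lemma IsVoterModel.integrable_occ_mul (hξ : IsVoterModel p μ P ℱ ξ) (A : Finset (Lattice d))
    (t : ℝ≥0) {Z : Ω → ℝ} (hZ : AEStronglyMeasurable Z P) {C : ℝ} (hC : ∀ ω, |Z ω| ≤ C) :
    Integrable (fun ω => occ A (ξ t ω) * Z ω) P := by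
  refine integrable_of_abs_le (C := C) ?_ fun ω => ?_
  · exact ((measurable_occ A).comp (hξ.measurable t)).aestronglyMeasurable.mul hZ
  · rw [abs_mul, abs_of_nonneg (occ_nonneg _ _)]
    exact (mul_le_of_le_one_left (abs_nonneg _) (occ_le_one _ _)).trans (hC ω)

/-- The martingale problem for `occ A` closes up among weighted moments, because the voter generator
becomes `coalOp` in the set variable. The weight later carries all occupation variables of earlier
times. -/
lemma IsVoterModel.moment_sub (hξ : IsVoterModel p μ P ℱ ξ) (hp : IsRandomWalkKernel p)
    (A : Finset (Lattice d)) {s t : ℝ≥0} (hst : s ≤ t) {Z : Ω → ℝ} (hZ : Measurable[ℱ s] Z)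
    {C : ℝ} (hC : ∀ ω, |Z ω| ≤ C) :
    moment P ξ Z t A - moment P ξ Z s A
      = ∫ r in (s : ℝ)..t, coalOp p (moment P ξ Z r.toNNReal) A := by
  have hZm : AEStronglyMeasurable Z P := (hZ.mono (ℱ.le s) le_rfl).aestronglyMeasurable
  have h := hξ.integral_occ_sub hp A hst hZ hC
  rw [moment, moment, ← integral_sub (hξ.integrable_occ_mul A t hZm hC)
    (hξ.integrable_occ_mul A s hZm hC)]
  simp only [sub_mul] at h
  rw [h]
  refine intervalIntegral.integral_congr fun r _ => ?_
  exact integral_voterGenerator_mul hp A (hξ.measurable _) hZm hC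

lemma IsVoterModel.moment_mem_Icc (hξ : IsVoterModel p μ P ℱ ξ) (A : Finset (Lattice d))
    (t : ℝ≥0) {Z : Ω → ℝ} (hZ : AEStronglyMeasurable Z P) (h0 : ∀ ω, 0 ≤ Z ω) (h1 : ∀ ω, Z ω ≤ 1) :
    moment P ξ Z t A ∈ Set.Icc (0 : ℝ) 1 := by
  have hC : ∀ ω, |Z ω| ≤ 1 := fun ω => by rw [abs_of_nonneg (h0 ω)]; exact h1 ω
  constructor
  · exact integral_nonneg fun ω => mul_nonneg (occ_nonneg _ _) (h0 ω)
  · calc _ ≤ ∫ _, (1 : ℝ) ∂P := integral_mono (hξ.integrable_occ_mul A t hZ hC)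
          (integrable_const _) fun ω => mul_le_one₀ (occ_le_one _ _) (h0 ω) (h1 ω)
      _ = 1 := by simp

lemma abs_sub_le_one_of_mem_Icc {a b : ℝ} (ha : a ∈ Set.Icc (0 : ℝ) 1)
    (hb : b ∈ Set.Icc (0 : ℝ) 1) : |a - b| ≤ 1 :=
  abs_sub_le_iff.2 ⟨by linarith [ha.2, hb.1], by linarith [ha.1, hb.2]⟩

/-- The moments follow the coalescing random walks up to an error of second order. -/
lemma IsVoterModel.abs_moment_sub_le (hξ : IsVoterModel p μ P ℱ ξ) (hp : IsRandomWalkKernel p)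
    (A : Finset (Lattice d)) {s t : ℝ≥0} (hst : s ≤ t) {Z : Ω → ℝ} (hZ : Measurable[ℱ s] Z)
    (h0 : ∀ ω, 0 ≤ Z ω) (h1 : ∀ ω, Z ω ≤ 1) :
    |moment P ξ Z t A - moment P ξ Z s A - (t - s) * coalOp p (moment P ξ Z s) A|
      ≤ 2 * A.card ^ 2 * (t - s : ℝ) ^ 2 := by
  have hC : ∀ ω, |Z ω| ≤ 1 := fun ω => by rw [abs_of_nonneg (h0 ω)]; exact h1 ω
  have hZm : AEStronglyMeasurable Z P := (hZ.mono (ℱ.le s) le_rfl).aestronglyMeasurable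
  have hmem := fun B r => hξ.moment_mem_Icc B r hZm h0 h1
  have hst' : (s : ℝ) ≤ t := by exact_mod_cast hst
  -- Moments of `B` move at speed at most `B.card`. Using this for `A` and for its images inside
  -- `coalOp`, which has at most `A.card` terms, yields the quadratic error.
  have hlip : ∀ B (r : ℝ≥0), s ≤ r → |moment P ξ Z r B - moment P ξ Z s B| ≤ B.card * (r - s) := by
    intro B r hr
    rw [hξ.moment_sub hp B hr hZ hC]
    have hr' : (s : ℝ) ≤ r := by exact_mod_cast hr
    have := intervalIntegral.norm_integral_le_of_norm_le_const (a := (s : ℝ)) (b := r)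
      (f := fun r => coalOp p (moment P ξ Z r.toNNReal) B) (C := B.card) fun r _ => by
        simpa using abs_coalOp_le hp (φ := moment P ξ Z r.toNNReal) (A := B) (C := 1)
          fun x y => abs_sub_le_one_of_mem_Icc (hmem _ _) (hmem _ _)
    rwa [abs_of_nonneg (sub_nonneg.2 hr'), Real.norm_eq_abs] at this
  have hcoal : ∀ r : ℝ, r ∈ Set.Ioc (s : ℝ) t →
      ‖coalOp p (moment P ξ Z r.toNNReal) A - coalOp p (moment P ξ Z s) A‖
        ≤ 2 * A.card ^ 2 * (t - s) := by
    intro r hr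
    have hr0 : s ≤ r.toNNReal := NNReal.le_toNNReal_of_coe_le hr.1.le
    have hr1 : ((r.toNNReal : ℝ≥0) : ℝ) = r := Real.coe_toNNReal r (s.2.trans hr.1.le)
    have hsm : ∀ u x, Summable fun y =>
        p x y * (moment P ξ Z u (A.image (moveTo x y)) - moment P ξ Z u A) := fun u x =>
      summable_mul_of_bounded hp x fun y => abs_sub_le_one_of_mem_Icc (hmem _ _) (hmem _ _)
    have he : coalOp p (moment P ξ Z r.toNNReal) A - coalOp p (moment P ξ Z s) A
        = coalOp p (fun B => moment P ξ Z r.toNNReal B - moment P ξ Z s B) A := by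
      simp only [coalOp, ← Finset.sum_sub_distrib]
      refine Finset.sum_congr rfl fun x _ => ?_
      rw [← (hsm _ x).tsum_sub (hsm _ x)]
      exact tsum_congr fun y => by ring
    rw [he, Real.norm_eq_abs]
    refine (abs_coalOp_le hp (C := 2 * (A.card * (t - s))) fun x y => ?_).trans (le_of_eq (by ring))
    have e1 := hlip (A.image (moveTo x y)) _ hr0
    have e2 := hlip A _ hr0
    rw [hr1] at e1 e2
    have e3 : ((A.image (moveTo x y)).card : ℝ) * (r - s) ≤ A.card * (t - s) := by
      have : ((A.image (moveTo x y)).card : ℝ) ≤ A.card := by exact_mod_cast Finset.card_image_le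
      exact mul_le_mul this (by linarith [hr.2]) (by linarith [hr.1]) (by positivity)
    have e4 : (A.card : ℝ) * (r - s) ≤ A.card * (t - s) :=
      mul_le_mul_of_nonneg_left (by linarith [hr.2]) (by positivity)
    refine (abs_sub _ _).trans ?_
    linarith
  have hb := intervalIntegral.norm_integral_le_of_norm_le_const (a := (s : ℝ)) (b := t)
    (f := fun r => coalOp p (moment P ξ Z r.toNNReal) A - coalOp p (moment P ξ Z s) A)
    (C := 2 * A.card ^ 2 * (t - s)) (by rw [Set.uIoc_of_le hst']; exact hcoal)
  have hint : IntervalIntegrable (fun r : ℝ => coalOp p (moment P ξ Z r.toNNReal) A) volume s t := by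
    have he : (fun r : ℝ => coalOp p (moment P ξ Z r.toNNReal) A)
        = fun r : ℝ => ∫ ω, voterGenerator p (occ A) (ξ r.toNNReal ω) * Z ω ∂P :=
      funext fun r => (integral_voterGenerator_mul hp A (hξ.measurable _) hZm hC).symm
    refine (intervalIntegrable_const (c := (A.card : ℝ))).mono_fun ?_
      (Eventually.of_forall fun r => ?_)
    · rw [he]
      have hm := (hξ.measurable_uncurry (continuous_voterGenerator_occ hp A)).mul
        ((hZ.mono (ℱ.le s) le_rfl).comp measurable_snd)
      exact hm.stronglyMeasurable.integral_prod_right.aestronglyMeasurable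
    · simpa using abs_coalOp_le hp (φ := moment P ξ Z r.toNNReal) (A := A) (C := 1)
          fun x y => abs_sub_le_one_of_mem_Icc (hmem _ _) (hmem _ _)
  rw [intervalIntegral.integral_sub hint intervalIntegrable_const,
    ← hξ.moment_sub hp A hst hZ hC, intervalIntegral.integral_const, smul_eq_mul,
    abs_of_nonneg (sub_nonneg.2 hst'), Real.norm_eq_abs] at hb
  exact hb.trans (le_of_eq (by ring))

lemma IsVoterModel.moment_le (hξ : IsVoterModel p μ P ℱ ξ) (hp : IsRandomWalkKernel p)
    (A : Finset (Lattice d)) {s t : ℝ≥0} (hst : s ≤ t) {Z : Ω → ℝ} (hZ : Measurable[ℱ s] Z)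
    (h0 : ∀ ω, 0 ≤ Z ω) (h1 : ∀ ω, Z ω ≤ 1) :
    moment P ξ Z t A ≤ moment P ξ Z s A + (t - s) * coalOp p (moment P ξ Z s) A
      + 2 * A.card ^ 2 * (t - s : ℝ) ^ 2 := by
  have := le_of_abs_le (hξ.abs_moment_sub_le hp A hst hZ h0 h1)
  linarith

section LazySteps

variable {G : Type*} [AddCommGroup G] [Countable G] [MeasurableSpace G]
  [MeasurableSingletonClass G] [DecidableEq G]

/-- At most one of several independent lazy walkers moves, up to a small probability. -/
lemma le_lintegral_stepLaw_lazyStep (δ : ℝ≥0∞) (hδ : δ ≤ 1) (ν : Measure G)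
    [IsProbabilityMeasure ν] (n : ℕ) (F : (Fin n → G) → ℝ≥0∞) :
    (1 - δ) ^ n * (F 0 + δ * ∑ i, ∫⁻ z, F (Pi.single i z) ∂ν)
      ≤ ∫⁻ z, F z ∂(stepLaw (lazyStep δ ν) n) := by
  have := isProbabilityMeasure_lazyStep hδ ν
  induction n with
  | zero =>
    simp only [Finset.univ_eq_empty, Finset.sum_empty, mul_zero, add_zero, pow_zero, one_mul]
    rw [lintegral_unique, Measure.pi_univ]
    simp [Subsingleton.elim (default : Fin 0 → G) 0]
  | succ n ih =>
    rw [lintegral_pi_fin_succ]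
    have h0 : (0 : Fin (n + 1) → G) = Fin.snoc (α := fun _ => G) 0 0 := by
      funext i
      refine Fin.lastCases ?_ (fun i => ?_) i <;> simp
    have h1 : ∀ (i : Fin n) (z : G), (Pi.single i.castSucc z : Fin (n + 1) → G)
        = Fin.snoc (α := fun _ => G) (Pi.single i z) 0 := by
      intro i z
      funext j
      refine Fin.lastCases ?_ (fun j => ?_) j
      · simp [(Fin.castSucc_lt_last i).ne']
      · simp [Pi.single_apply]
    have h2 : ∀ z : G, (Pi.single (Fin.last n) z : Fin (n + 1) → G)
        = Fin.snoc (α := fun _ => G) 0 z := by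
      intro z
      funext j
      refine Fin.lastCases ?_ (fun j => ?_) j
      · simp
      · simp [(Fin.castSucc_lt_last j).ne]
    rw [lintegral_lintegral_swap Measurable.of_discrete.aemeasurable]
    have e1 : ∀ y, (1 - δ) ^ n * (F (Fin.snoc (α := fun _ => G) 0 y)
        + δ * ∑ i, ∫⁻ z, F (Fin.snoc (α := fun _ => G) (Pi.single i z) y) ∂ν)
        ≤ ∫⁻ ω, F (Fin.snoc (α := fun _ => G) ω y) ∂(stepLaw (lazyStep δ ν) n) :=
      fun y => ih fun ω => F (Fin.snoc (α := fun _ => G) ω y)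
    refine le_trans ?_ (lintegral_mono e1)
    rw [lazyStep, lintegral_add_measure, lintegral_smul_measure, lintegral_smul_measure,
      lintegral_dirac, Fin.sum_univ_castSucc]
    simp only [h1, h2, smul_eq_mul]
    rw [h0]
    set a := F (Fin.snoc (α := fun _ => G) 0 0)
    set S := ∑ i : Fin n, ∫⁻ z, F (Fin.snoc (α := fun _ => G) (Pi.single i z) 0) ∂ν
    -- When the last walker moves, only the case in which all others stay is kept.
    have e2 : (1 - δ) ^ n * ∫⁻ z, F (Fin.snoc (α := fun _ => G) 0 z) ∂ν
        ≤ ∫⁻ y, (1 - δ) ^ n * (F (Fin.snoc (α := fun _ => G) 0 y)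
        + δ * ∑ i, ∫⁻ z, F (Fin.snoc (α := fun _ => G) (Pi.single i z) y) ∂ν) ∂ν := by
      rw [← lintegral_const_mul _ .of_discrete]
      exact lintegral_mono fun y => mul_le_mul_right le_self_add _
    set b := ∫⁻ z, F (Fin.snoc (α := fun _ => G) 0 z) ∂ν
    calc (1 - δ) ^ (n + 1) * (a + δ * (S + b))
        = (1 - δ) * ((1 - δ) ^ n * (a + δ * S)) + (1 - δ) * (δ * ((1 - δ) ^ n * b)) := by ring
      _ ≤ (1 - δ) * ((1 - δ) ^ n * (a + δ * S)) + 1 * (δ * ((1 - δ) ^ n * b)) := by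
          gcongr
          exact tsub_le_self
      _ ≤ _ := by
          rw [one_mul]
          gcongr

end LazySteps

/-- Injectivity of `y` on `I` is essential: with two labels at one site, moving a single label would
not move the site. -/
lemma image_add_single {n : ℕ} (I : Finset (Fin n)) (y : Fin n → Lattice d)
    (hy : Set.InjOn y I) (i : Fin n) (hi : i ∈ I) (z : Lattice d) :
    I.image (y + Pi.single i z) = (I.image y).image (moveTo (y i) (y i + z)) := by
  rw [Finset.image_image]
  refine Finset.image_congr fun k hk => ?_
  simp only [Pi.add_apply, Function.comp_apply, moveTo]
  split_ifs with h
  · obtain rfl := hy hk hi h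
    simp
  · have : k ≠ i := fun h' => h (by rw [h'])
    rw [Pi.single_eq_of_ne this, add_zero]

lemma coalOp_image (hp : IsRandomWalkKernel p) {n : ℕ} (I : Finset (Fin n))
    (y : Fin n → Lattice d) (hy : Set.InjOn y I) (φ : Finset (Lattice d) → ℝ) :
    coalOp p φ (I.image y)
      = ∑ i ∈ I, ∑' z, p 0 z * (φ (I.image (y + Pi.single i z)) - φ (I.image y)) := by
  rw [coalOp, Finset.sum_image hy]
  refine Finset.sum_congr rfl fun i hi => ?_
  rw [← (Equiv.addLeft (y i)).tsum_eq]
  refine tsum_congr fun z => ?_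
  rw [Equiv.coe_addLeft, hp.apply_add, image_add_single I y hy i hi]

/-- Up to a quadratic error, moments of the voter model evolve at most like lazy coalescing
walks. -/
lemma IsVoterModel.ofReal_moment_le (hξ : IsVoterModel p μ P ℱ ξ) (hp : IsRandomWalkKernel p)
    {s t : ℝ≥0} (δ : ℝ) (hδ0 : 0 ≤ δ) (hδ : δ ≤ 1) (hst : (t : ℝ) = s + δ) {Z : Ω → ℝ}
    (hZ : Measurable[ℱ s] Z) (h0 : ∀ ω, 0 ≤ Z ω) (h1 : ∀ ω, Z ω ≤ 1) {n : ℕ}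
    (I : Finset (Fin n)) (y : Fin n → Lattice d) (hy : Set.InjOn y I) :
    ENNReal.ofReal (moment P ξ Z t (I.image y))
      ≤ ∫⁻ z, ENNReal.ofReal (moment P ξ Z s (I.image (y + z)))
        ∂(stepLaw (lazyStep (ENNReal.ofReal δ) (jump p)) n)
        + ENNReal.ofReal (3 * n ^ 2 * δ ^ 2) := by
  have := hp.isProbabilityMeasure_jump
  have hZm : AEStronglyMeasurable Z P := (hZ.mono (ℱ.le s) le_rfl).aestronglyMeasurable
  set φ := moment P ξ Z s with hφ
  have hmem : ∀ B, φ B ∈ Set.Icc (0 : ℝ) 1 := fun B => hξ.moment_mem_Icc B s hZm h0 h1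
  have hst' : s ≤ t := by rw [← NNReal.coe_le_coe, hst]; linarith
  have hts : (t : ℝ) - s = δ := by linarith
  have hcard : ((I.image y).card : ℝ) ≤ n := by
    exact_mod_cast (Finset.card_image_le.trans (Finset.card_le_univ I)).trans_eq (Fintype.card_fin n)
  set a := φ (I.image y) with ha
  set S : Fin n → ℝ := fun i => ∑' z, p 0 z * φ (I.image (y + Pi.single i z)) with hS
  have hsm : ∀ i, Summable fun z => p 0 z * φ (I.image (y + Pi.single i z)) := fun i =>
    summable_mul_of_bounded hp 0 (C := 1) fun z => by
      rw [abs_of_nonneg (hmem _).1]; exact (hmem _).2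
  have hS0 : ∀ i, 0 ≤ S i := fun i => tsum_nonneg fun z => mul_nonneg (hp.nonneg _ _) (hmem _).1
  have hS1 : ∀ i, S i ≤ 1 := fun i => (le_abs_self _).trans (abs_tsum_mul_le hp 0 fun z => by
    rw [abs_of_nonneg (hmem _).1]; exact (hmem _).2)
  have hcoal : coalOp p φ (I.image y) = ∑ i, (S i - a) := by
    rw [coalOp_image hp I y hy]
    have hsub : ∀ i, ∑' z, p 0 z * (φ (I.image (y + Pi.single i z)) - φ (I.image y)) = S i - a := by
      intro i
      rw [tsum_congr fun z => mul_sub _ _ _, (hsm i).tsum_sub ((hp.hasSum_one 0).summable.mul_right _), tsum_mul_right,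
        (hp.hasSum_one 0).tsum_eq, one_mul]
    simp only [hsub]
    refine Finset.sum_subset (Finset.subset_univ _) fun i _ hi => ?_
    have : ∀ z, I.image (y + Pi.single i z) = I.image y := fun z =>
      Finset.image_congr fun k hk => by
        have : k ≠ i := fun h => hi (h ▸ hk)
        simp [this]
    simp only [hS, this, tsum_mul_right, (hp.hasSum_one 0).tsum_eq, one_mul, ← ha, sub_self]
  -- Of the `3 n² δ²`, a part `2 n² δ²` is the Euler error. The rest pays for replacing `1 - n δ` by
  -- the probability factor `(1 - δ) ^ n` (Bernoulli's inequality) in front of the jump terms as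
  -- well.
  have hreal : moment P ξ Z t (I.image y)
      ≤ (1 - δ) ^ n * (a + δ * ∑ i, S i) + 3 * n ^ 2 * δ ^ 2 := by
    have e1 := hξ.moment_le hp (I.image y) hst' hZ h0 h1
    rw [hts, ← hφ, hcoal, ← ha, Finset.sum_sub_distrib, Finset.sum_const, Finset.card_univ,
      Fintype.card_fin, nsmul_eq_mul] at e1
    have e2 : 1 - n * δ ≤ (1 - δ) ^ n := by
      have := one_add_mul_le_pow (a := -δ) (by linarith) n
      simpa [sub_eq_add_neg] using this
    have e3 : ((I.image y).card : ℝ) ^ 2 ≤ (n : ℝ) ^ 2 :=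
      pow_le_pow_left₀ (Nat.cast_nonneg _) hcard 2
    have e4 : ∑ i, S i ≤ n := by
      simpa using Finset.sum_le_sum fun i (_ : i ∈ Finset.univ) => hS1 i
    have e5 : 0 ≤ ∑ i, S i := Finset.sum_nonneg fun i _ => hS0 i
    have e6 : (1 - n * δ) * (a + δ * ∑ i, S i) ≤ (1 - δ) ^ n * (a + δ * ∑ i, S i) :=
      mul_le_mul_of_nonneg_right e2 (add_nonneg (hmem _).1 (mul_nonneg hδ0 e5))
    have e7 : (n : ℝ) * δ ^ 2 * ∑ i, S i ≤ n * δ ^ 2 * n :=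
      mul_le_mul_of_nonneg_left e4 (by positivity)
    have e8 : 2 * ((I.image y).card : ℝ) ^ 2 * δ ^ 2 ≤ 2 * n ^ 2 * δ ^ 2 :=
      mul_le_mul_of_nonneg_right (mul_le_mul_of_nonneg_left e3 zero_le_two) (sq_nonneg δ)
    nlinarith
  have hE : ∀ i, ∫⁻ z, ENNReal.ofReal (φ (I.image (y + Pi.single i z))) ∂(jump p)
      = ENNReal.ofReal (S i) := by
    intro i
    rw [lintegral_jump, hS, ENNReal.ofReal_tsum_of_nonneg
      (fun z => mul_nonneg (hp.nonneg _ _) (hmem _).1) (hsm i)]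
    exact tsum_congr fun z => (ENNReal.ofReal_mul (hp.nonneg _ _)).symm
  have hlow := le_lintegral_stepLaw_lazyStep (ENNReal.ofReal δ) (ENNReal.ofReal_le_one.2 hδ)
    (jump p) n fun z => ENNReal.ofReal (φ (I.image (y + z)))
  refine (ENNReal.ofReal_le_ofReal hreal).trans ?_
  have h1δ : 0 ≤ 1 - δ := by linarith
  have hsum0 : 0 ≤ ∑ i, S i := Finset.sum_nonneg fun i _ => hS0 i
  rw [ENNReal.ofReal_add (mul_nonneg (pow_nonneg h1δ n)
    (add_nonneg (hmem _).1 (mul_nonneg hδ0 hsum0))) (by positivity)]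
  gcongr
  refine le_trans (le_of_eq ?_) hlow
  simp only [hE, add_zero, ← ha]
  rw [← ENNReal.ofReal_sum_of_nonneg fun i _ => hS0 i, ← ENNReal.ofReal_mul hδ0,
    ← ENNReal.ofReal_add (hmem _).1 (mul_nonneg hδ0 hsum0), ← ENNReal.ofReal_one,
    ← ENNReal.ofReal_sub _ hδ0, ← ENNReal.ofReal_pow h1δ,
    ← ENNReal.ofReal_mul (pow_nonneg h1δ n)]

end VoterMoments

/-! ### Exponential decay of joint occupation probabilities. -/

section MomentDecay

variable {d : ℕ} {Ω : Type*} [mΩ : MeasurableSpace Ω] {p : Lattice d → Lattice d → ℝ}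
  {ρ : unitInterval} {P : Measure Ω} [IsProbabilityMeasure P] {ℱ : Filtration ℝ≥0 mΩ}
  {ξ : ℝ≥0 → Ω → Config d}

lemma integral_occ_bernoulliProduct (ρ : unitInterval) (A : Finset (Lattice d)) :
    ∫ η, occ A η ∂(bernoulliProduct d ρ) = (ρ : ℝ) ^ A.card := by
  have hset : {η : Config d | ∀ x ∈ A, η x = true} = Set.pi A fun _ => {true} := by
    ext η; simp
  have hm : MeasurableSet {η : Config d | ∀ x ∈ A, η x = true} := by
    rw [hset]
    exact MeasurableSet.pi A.countable_toSet fun _ _ => .of_discrete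
  have : occ A = Set.indicator {η : Config d | ∀ x ∈ A, η x = true} 1 := by
    classical
    funext η
    simp only [occ, Set.indicator, Set.mem_ofPred_eq, Pi.one_apply]
  rw [this, integral_indicator_one hm, hset, bernoulliProduct, measureReal_def,
    Measure.infinitePi_pi _ fun _ _ => .of_discrete]
  simp [bernoulliMeasure]

lemma IsVoterModel.integral_occ_zero (hξ : IsVoterModel p (bernoulliProduct d ρ) P ℱ ξ)
    (A : Finset (Lattice d)) : ∫ ω, occ A (ξ 0 ω) ∂P = (ρ : ℝ) ^ A.card := by
  rw [← integral_occ_bernoulliProduct, ← hξ.initial, integral_map (hξ.measurable 0).aemeasurable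
    (measurable_occ A).aestronglyMeasurable]

lemma occ_image {n : ℕ} (I : Finset (Fin n)) (x : Fin n → Lattice d) (η : Config d) :
    occ (I.image x) η = ∏ k ∈ I, occ {x k} η := by
  induction I using Finset.induction_on with
  | empty => simp
  | insert k I hk ih =>
    rw [Finset.image_insert, occ_insert, Finset.prod_insert hk, ih, occ_singleton]

/-- Joint occupation probabilities at distant times that lie on a grid. -/
lemma IsVoterModel.moment_grid_le (hξ : IsVoterModel p (bernoulliProduct d ρ) P ℱ ξ)
    (hp : IsRandomWalkKernel p) {M : ℕ} {r : ℝ} (hr0 : 0 ≤ r)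
    (hM : ∀ m : ℕ, 0 < m → ∀ (n T : ℕ) (x : ℕ → Lattice d) (τ : ℕ → ℕ),
      (∀ k < n, τ k ≤ T) → (∀ i k, i < k → k < n → τ i + (k - i) * (M * m) ≤ τ k) →
      ∀ (v : ℕ → Finset (Lattice d) → ℝ≥0∞) (e : ℝ≥0∞), (∀ j A B, A ⊆ B → v j B ≤ v j A) →
      (∀ j < T, ∀ (I : Finset (Fin n)) (y : Fin n → Lattice d), Set.InjOn y I →
        v j (I.image y) ≤ ∫⁻ z, v (j + 1) (I.image (y + z) ∪ newSites x τ n (j + 1))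
          ∂(stepLaw (lazyStep (m : ℝ≥0∞)⁻¹ (jump p)) n) + e) →
      (∀ A, v T A ≤ ENNReal.ofReal ρ ^ A.card) →
      v 0 (newSites x τ n 0) ≤ ENNReal.ofReal r ^ n + T * e)
    (m : ℕ) (hm : 0 < m) (n N : ℕ) (x : ℕ → Lattice d) (s : ℕ → ℕ) (hs : ∀ k < n, s k ≤ N)
    (hgap : ∀ i k, i < k → k < n → s k + (k - i) * (M * m) ≤ s i) :
    ∫ ω, ∏ k : Fin n, occ {x k} (ξ (s k / m) ω) ∂P ≤ r ^ n + N * (3 * n ^ 2 * (1 / m : ℝ) ^ 2) := by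
  have hm' : (0 : ℝ) < m := by exact_mod_cast hm
  -- Duality runs backwards from the grid time `N`: walker `k` starts at dual time `N - s k`. `Z j`
  -- collects the factors of the walkers that have not started by dual time `j`.
  set τ : ℕ → ℕ := fun k => N - s k with hτ
  set Z : ℕ → Ω → ℝ := fun j ω =>
    ∏ k ∈ Finset.univ.filter (fun k : Fin n => j < τ k), occ {x k} (ξ (s k / m) ω) with hZ
  have hZ0 : ∀ j ω, 0 ≤ Z j ω := fun j ω => Finset.prod_nonneg fun k _ => occ_nonneg _ _
  have hZ1 : ∀ j ω, Z j ω ≤ 1 := fun j ω =>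
    Finset.prod_le_one (fun k _ => occ_nonneg _ _) fun k _ => occ_le_one _ _
  -- Pending factors sit at grid times at most `N - (j + 1)`, the left end of the next Euler step,
  -- so they are admissible weights for that step.
  have hZmeas : ∀ j, Measurable[ℱ ((N - (j + 1) : ℕ) / m)] (Z j) := by
    intro j
    refine Finset.measurable_fun_prod _ fun k hk => ?_
    have hk' : j < N - s k := (Finset.mem_filter.1 hk).2
    refine (measurable_occ _).comp ((hξ.adapted _).mono (ℱ.mono ?_) le_rfl)
    have : s k ≤ N - (j + 1) := by omega
    gcongr
  have hZmeas' : ∀ j, AEStronglyMeasurable (Z j) P := fun j =>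
    ((hZmeas j).mono (ℱ.le _) le_rfl).aestronglyMeasurable
  have hC : ∀ j ω, |Z j ω| ≤ 1 := fun j ω => by rw [abs_of_nonneg (hZ0 j ω)]; exact hZ1 j ω
  -- `v j A` is the joint occupation probability with the walkers started so far collected at `A`.
  -- At dual time `N` the real time is zero and no factor is pending, so the Bernoulli law gives `ρ
  -- ^ A.card`.
  set v : ℕ → Finset (Lattice d) → ℝ≥0∞ := fun j A =>
    ENNReal.ofReal (moment P ξ (Z j) ((N - j : ℕ) / m) A) with hv
  have hnew : ∀ j, j ≤ N → ∀ η : ℝ≥0 → Config d,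
      occ (newSites x τ n j) (η ((N - j : ℕ) / m))
        = ∏ k ∈ Finset.univ.filter (fun k : Fin n => τ k = j), occ {x k} (η (s k / m)) := by
    intro j hj η
    rw [newSites, occ_image]
    refine Finset.prod_congr rfl fun k hk => ?_
    have hk' : N - s k = j := (Finset.mem_filter.1 hk).2
    have hk2 := hs k k.2
    have : N - j = s k := by omega
    rw [this]
  have key := hM m hm n N x τ (fun k _ => Nat.sub_le _ _) ?_ v
    (ENNReal.ofReal (3 * n ^ 2 * (1 / m : ℝ) ^ 2)) ?_ ?_ ?_
  · have hv0 : v 0 (newSites x τ n 0)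
        = ENNReal.ofReal (∫ ω, ∏ k : Fin n, occ {x k} (ξ (s k / m) ω) ∂P) := by
      simp only [hv, moment]
      congr 2
      funext ω
      rw [hnew 0 (Nat.zero_le _) fun t => ξ t ω, hZ]
      simp only [Nat.pos_iff_ne_zero]
      exact Finset.prod_filter_mul_prod_filter_not _ _ _
    rw [hv0, ← ENNReal.ofReal_pow hr0, ← ENNReal.ofReal_natCast,
      ← ENNReal.ofReal_mul (by positivity), ← ENNReal.ofReal_add (by positivity) (by positivity)] at key
    exact (ENNReal.ofReal_le_ofReal_iff (by positivity)).1 key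
  · intro i k hik hk
    have h1 := hgap i k hik hk
    have h2 := hs i (hik.trans hk)
    simp only [hτ]
    omega
  · intro j A B hAB
    refine ENNReal.ofReal_le_ofReal (integral_mono (hξ.integrable_occ_mul B _ (hZmeas' j) (hC j))
      (hξ.integrable_occ_mul A _ (hZmeas' j) (hC j)) fun ω => ?_)
    exact mul_le_mul_of_nonneg_right (occ_anti hAB _) (hZ0 j ω)
  · intro j hj I y hy
    have hst : (((N - j : ℕ) / m : ℝ≥0) : ℝ) = (((N - (j + 1) : ℕ) / m : ℝ≥0) : ℝ) + 1 / m := by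
      have : N - j = N - (j + 1) + 1 := by omega
      rw [this]
      push_cast
      ring
    have h1 := hξ.ofReal_moment_le hp (1 / m) (by positivity)
      ((div_le_one hm').2 (by exact_mod_cast hm)) hst (hZmeas j) (hZ0 j) (hZ1 j) I y hy
    have hδ : ENNReal.ofReal (1 / m) = (m : ℝ≥0∞)⁻¹ := by
      rw [one_div, ENNReal.ofReal_inv_of_pos hm', ENNReal.ofReal_natCast]
    rw [hδ] at h1
    refine h1.trans (le_of_eq ?_)
    congr 1
    refine lintegral_congr fun z => ?_
    simp only [hv, moment]
    congr 2
    funext ω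
    rw [occ_union, mul_assoc, hnew (j + 1) hj fun t => ξ t ω]
    congr 1
    simp only [hZ]
    rw [← Finset.prod_union]
    · refine Finset.prod_congr ?_ fun _ _ => rfl
      ext k
      simp only [Finset.mem_filter, Finset.mem_univ, true_and, Finset.mem_union]
      omega
    · rw [Finset.disjoint_filter]
      intro k _ h1 h2
      omega
  · intro A
    have h1 : ∀ ω, Z N ω = 1 := by
      intro ω
      simp only [hZ]
      rw [Finset.filter_false_of_mem, Finset.prod_empty]
      intro k _
      simp only [hτ]
      omega
    simp only [hv, moment, h1, mul_one, Nat.sub_self, Nat.cast_zero, zero_div]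
    rw [hξ.integral_occ_zero, ENNReal.ofReal_pow ρ.2.1]

lemma tendsto_ceil_div (t : ℝ≥0) :
    Tendsto (fun m : ℕ => ((⌈((m + 1 : ℕ) : ℝ) * t⌉₊ : ℝ≥0) / ((m + 1 : ℕ) : ℝ≥0))) atTop (𝓝[≥] t) := by
  refine tendsto_nhdsWithin_iff.2 ⟨?_, Eventually.of_forall fun m => ?_⟩
  · rw [← NNReal.tendsto_coe]
    refine tendsto_of_tendsto_of_tendsto_of_le_of_le (g := fun _ => (t : ℝ))
        (h := fun n : ℕ => (t : ℝ) + 1 / ((n : ℝ) + 1)) tendsto_const_nhds ?_ ?_ ?_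
    · simpa using (tendsto_const_nhds (x := (t : ℝ))).add tendsto_one_div_add_atTop_nhds_zero_nat
    · intro m
      have hn : (0 : ℝ) < (m + 1 : ℕ) := by positivity
      push_cast
      rw [le_div_iff₀ (by positivity), mul_comm]
      exact_mod_cast Nat.le_ceil (((m + 1 : ℕ) : ℝ) * t)
    · intro m
      have hn : (0 : ℝ) < (m : ℝ) + 1 := by positivity
      push_cast
      rw [div_le_iff₀ hn, add_mul (t : ℝ), one_div, inv_mul_cancel₀ hn.ne']
      have := (Nat.ceil_lt_add_one (a := ((m : ℝ) + 1) * t) (by positivity)).le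
      linarith
  · have hn : (0 : ℝ) < (m + 1 : ℕ) := by positivity
    rw [Set.mem_Ici, ← NNReal.coe_le_coe]
    push_cast
    rw [le_div_iff₀ (by positivity), mul_comm]
    exact_mod_cast Nat.le_ceil (((m + 1 : ℕ) : ℝ) * t)

/-- In the strongly transient case, the probability that the voter model occupies `n` given sites at
`n` distant times is exponentially small in `n`, uniformly in the sites and times. -/
theorem IsVoterModel.exists_moment_rate (hξ : IsVoterModel p (bernoulliProduct d ρ) P ℱ ξ)
    (hp : IsRandomWalkKernel p) (hsymm : ∀ x y, p x y = p y x) (htrans : StronglyTransient p)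
    (hρ : ρ < 1) :
    ∃ M : ℕ, 0 < M ∧ ∃ r : ℝ, 0 < r ∧ r < 1 ∧ ∀ (n : ℕ) (t : ℕ → ℝ≥0) (x : ℕ → Lattice d),
      (∀ i k, i < k → k < n → (t k : ℝ) + (k - i) * M ≤ t i) →
      ∫ ω, ∏ k : Fin n, occ {x k} (ξ (t k) ω) ∂P ≤ r ^ n := by
  have := hp.isProbabilityMeasure_jump
  obtain ⟨M, hM0, r, hr0, hr1, hM⟩ := exists_rate_of_coalescing (jump p)
    (isReflectionInvariant_jump hp hsymm) (greenMoment_jump_ne_top hp htrans) ρ ρ.2.1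
    (by exact_mod_cast hρ)
  refine ⟨M, hM0, r, hr0, hr1, fun n t x hgap => ?_⟩
  set s : ℕ → ℕ → ℕ := fun m k => ⌈((m + 1 : ℕ) : ℝ) * t k⌉₊ with hs
  have hlim : Tendsto (fun m : ℕ => ∫ ω, ∏ k : Fin n,
      occ {x k} (ξ ((s m k : ℝ≥0) / ((m + 1 : ℕ) : ℝ≥0)) ω) ∂P) atTop
      (𝓝 (∫ ω, ∏ k : Fin n, occ {x k} (ξ (t k) ω) ∂P)) := by
    refine tendsto_integral_of_dominated_convergence (fun _ => 1) (fun m => ?_)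
      (integrable_const _) (fun m => Eventually.of_forall fun ω => ?_)
      (Eventually.of_forall fun ω => ?_)
    · exact (Finset.measurable_fun_prod _ fun k _ =>
        (measurable_occ _).comp (hξ.measurable _)).aestronglyMeasurable
    · rw [Real.norm_of_nonneg (Finset.prod_nonneg fun k _ => occ_nonneg _ _)]
      exact Finset.prod_le_one (fun k _ => occ_nonneg _ _) fun k _ => occ_le_one _ _
    · refine tendsto_finsetProd _ fun k _ => ?_
      exact ((continuous_occ _).continuousAt.comp_continuousWithinAt
        (hξ.right_continuous ω (t k))).tendsto.comp (tendsto_ceil_div (t k))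
  -- The number of grid steps is of order `m` while the error per step is of order `m⁻²`, so the
  -- total error vanishes. The times are rounded up because the paths are only right-continuous.
  have hlim2 : Tendsto (fun m : ℕ => r ^ n
      + (((m + 1 : ℕ) : ℝ) * t 0 + 1) * (3 * n ^ 2 * (1 / ((m + 1 : ℕ) : ℝ)) ^ 2)) atTop
      (𝓝 (r ^ n)) := by
    have h1 : Tendsto (fun m : ℕ => 1 / ((m : ℝ) + 1)) atTop (𝓝 0) :=
      tendsto_one_div_add_atTop_nhds_zero_nat
    have h2 := ((h1.const_mul (3 * n ^ 2 * (t 0 : ℝ))).add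
      ((h1.pow 2).const_mul (3 * (n : ℝ) ^ 2))).const_add (r ^ n)
    simp only [mul_zero, ne_eq, OfNat.ofNat_ne_zero, not_false_eq_true, zero_pow, add_zero] at h2
    refine h2.congr fun m => ?_
    have : (m : ℝ) + 1 ≠ 0 := by positivity
    push_cast
    field_simp
  refine le_of_tendsto_of_tendsto' hlim hlim2 fun m => ?_
  rcases Nat.eq_zero_or_pos n with rfl | hn
  · simp
  refine (hξ.moment_grid_le hp hr0.le hM (m + 1) (Nat.succ_pos m) n (s m 0) x (s m) ?_ ?_).trans ?_
  · intro k hk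
    rcases Nat.eq_zero_or_pos k with rfl | hk0
    · exact le_rfl
    · have h := hgap 0 k hk0 hk
      refine Nat.ceil_mono (mul_le_mul_of_nonneg_left ?_ (Nat.cast_nonneg _))
      have : (0 : ℝ) ≤ ((k : ℝ) - (0 : ℕ)) * M := by
        have : (0 : ℝ) ≤ k := Nat.cast_nonneg k
        simp only [Nat.cast_zero, sub_zero]
        positivity
      linarith
  · intro i k hik hk
    have h := hgap i k hik hk
    simp only [hs]
    rw [← Nat.ceil_add_natCast (by positivity)]
    refine Nat.ceil_mono ?_
    push_cast [Nat.cast_sub hik.le]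
    calc ((m : ℝ) + 1) * t k + (k - i) * (M * (m + 1)) = (m + 1) * (t k + (k - i) * M) := by ring
      _ ≤ _ := mul_le_mul_of_nonneg_left h (by positivity)
  · gcongr
    exact (Nat.ceil_lt_add_one (by positivity)).le

end MomentDecay

/-! ### The growth equation: Picard series, minimality, and uniqueness of nonnegative solutions. -/

section Growth

variable {d : ℕ}

/-- The neighbour of `x` in the direction `k`. -/
def nb (k : Fin d × Bool) (x : Lattice d) : Lattice d :=
  if k.2 then x + Pi.single k.1 1 else x - Pi.single k.1 1

/-- The sum over the nearest neighbours. -/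
def nbSum (v : Lattice d → ℝ) (x : Lattice d) : ℝ := ∑ k : Fin d × Bool, v (nb k x)

lemma latticeLaplacian_eq (v : Lattice d → ℝ) (x : Lattice d) :
    latticeLaplacian v x = nbSum v x - 2 * d * v x := by
  simp only [latticeLaplacian, nbSum, nb, Fintype.sum_prod_type, Fintype.sum_bool]
  simp only [if_true, Bool.false_eq_true, if_false, Finset.sum_add_distrib, Finset.sum_sub_distrib,
    Finset.sum_const, Finset.card_univ, Fintype.card_fin, nsmul_eq_mul]
  ring

lemma nbSum_mono {v w : Lattice d → ℝ} (h : ∀ x, v x ≤ w x) (x : Lattice d) :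
    nbSum v x ≤ nbSum w x := Finset.sum_le_sum fun _ _ => h _

lemma nbSum_nonneg {v : Lattice d → ℝ} (h : ∀ x, 0 ≤ v x) (x : Lattice d) : 0 ≤ nbSum v x :=
  Finset.sum_nonneg fun _ _ => h _

lemma nbSum_le {v : Lattice d → ℝ} {C : ℝ} (h : ∀ x, v x ≤ C) (x : Lattice d) :
    nbSum v x ≤ 2 * d * C := by
  refine (Finset.sum_le_sum fun k _ => h (nb k x)).trans (le_of_eq ?_)
  rw [Finset.sum_const, Finset.card_univ, Fintype.card_prod, Fintype.card_fin, Fintype.card_bool,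
    nsmul_eq_mul]
  push_cast
  ring

lemma nbSum_sub (v w : Lattice d → ℝ) (x : Lattice d) :
    nbSum (fun y => v y - w y) x = nbSum v x - nbSum w x := Finset.sum_sub_distrib _ _

lemma nbSum_const_mul (c : ℝ) (v : Lattice d → ℝ) (x : Lattice d) :
    nbSum (fun y => c * v y) x = c * nbSum v x := (Finset.mul_sum _ _ _).symm

/-- The right hand side of the parabolic Anderson model without the loss term. -/
def growthRate (κ : ℝ) (V : Lattice d → ℝ → ℝ) (w : Lattice d → ℝ → ℝ) (x : Lattice d) (t : ℝ) : ℝ :=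
  κ * nbSum (fun y => w y t) x + V x t * w x t

/-- A potential with values in `[0, γ]` that is right-continuous in time. -/
structure IsPotential (γ : ℝ) (V : Lattice d → ℝ → ℝ) : Prop where
  nonneg : ∀ x t, 0 ≤ V x t
  le : ∀ x t, V x t ≤ γ
  measurable : ∀ x, Measurable (V x)
  right_continuous : ∀ x t, ContinuousWithinAt (V x) (Set.Ici t) t

/-- `w` is a solution on `[0, ∞)` of the parabolic Anderson model without the loss term. -/
structure IsGrowthSolution (κ : ℝ) (V : Lattice d → ℝ → ℝ) (w : Lattice d → ℝ → ℝ) : Prop where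
  continuousOn : ∀ x, ContinuousOn (w x) (Set.Ici 0)
  equation : ∀ x t, 0 ≤ t → HasDerivWithinAt (w x) (growthRate κ V w x t) (Set.Ici t) t

variable {κ γ : ℝ} {V : Lattice d → ℝ → ℝ} {w : Lattice d → ℝ → ℝ}

lemma IsPotential.intervalIntegrable_mul (hV : IsPotential γ V) (x : Lattice d) {f : ℝ → ℝ} {a b : ℝ}
    (hf : ContinuousOn f (Set.uIcc a b)) : IntervalIntegrable (fun s => V x s * f s) volume a b := by
  refine IntervalIntegrable.mul_continuousOn ?_ hf
  refine (intervalIntegrable_const (c := γ)).mono_fun (hV.measurable x).aestronglyMeasurable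
    (Eventually.of_forall fun s => ?_)
  show ‖V x s‖ ≤ ‖γ‖
  rw [Real.norm_of_nonneg (hV.nonneg x s), Real.norm_of_nonneg ((hV.nonneg x s).trans (hV.le x s))]
  exact hV.le x s

lemma continuousOn_nbSum {s : Set ℝ} (hw : ∀ x, ContinuousOn (w x) s) (x : Lattice d) :
    ContinuousOn (fun t => nbSum (fun y => w y t) x) s :=
  continuousOn_finsetSum _ fun _ _ => hw _

lemma IsPotential.intervalIntegrable_growthRate (hV : IsPotential γ V) {a b : ℝ}
    (hw : ∀ x, ContinuousOn (w x) (Set.uIcc a b)) (x : Lattice d) :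
    IntervalIntegrable (growthRate κ V w x) volume a b :=
  ((continuousOn_nbSum hw x).intervalIntegrable.const_mul κ).add
    (hV.intervalIntegrable_mul x (hw x))

lemma uIcc_subset_Ici {s t : ℝ} (hs : 0 ≤ s) (ht : 0 ≤ t) : Set.uIcc s t ⊆ Set.Ici 0 :=
  fun _ hr => (le_min hs ht).trans hr.1

lemma IsGrowthSolution.sub_eq_integral (hw : IsGrowthSolution κ V w) (hV : IsPotential γ V)
    (x : Lattice d) {s t : ℝ} (hs : 0 ≤ s) (hst : s ≤ t) :
    w x t - w x s = ∫ r in s..t, growthRate κ V w x r := by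
  have hc := fun x => (hw.continuousOn x).mono (uIcc_subset_Ici hs (hs.trans hst))
  symm
  refine intervalIntegral.integral_eq_sub_of_hasDeriv_right (hc x) (fun r hr => ?_)
    (hV.intervalIntegrable_growthRate hc x)
  rw [min_eq_left hst] at hr
  exact (hw.equation x r (hs.trans hr.1.le)).mono Set.Ioi_subset_Ici_self

/-- Conversely, a continuous solution of the integral equation is a solution. -/
lemma isGrowthSolution_of_integral (hV : IsPotential γ V) (hc : ∀ x, ContinuousOn (w x) (Set.Ici 0))
    {g : Lattice d → ℝ} (h : ∀ x t, 0 ≤ t → w x t = g x + ∫ r in (0 : ℝ)..t, growthRate κ V w x r) :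
    IsGrowthSolution κ V w := by
  refine ⟨hc, fun x t ht => ?_⟩
  have hc' : ∀ y, ContinuousOn (w y) (Set.uIcc 0 t) := fun y =>
    (hc y).mono (uIcc_subset_Ici le_rfl ht)
  have hrc : ContinuousWithinAt (growthRate κ V w x) (Set.Ici t) t := by
    have h1 : ∀ y, ContinuousWithinAt (w y) (Set.Ici t) t := fun y =>
      ((hc y) t ht).mono (Set.Ici_subset_Ici.2 ht)
    have h2 : ContinuousWithinAt (fun t => nbSum (fun y => w y t) x) (Set.Ici t) t :=
      (continuousOn_nbSum (s := Set.Ici 0) hc x t ht).mono (Set.Ici_subset_Ici.2 ht)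
    exact (h2.const_mul κ).add ((hV.right_continuous x t).mul (h1 x))
  have hm : StronglyMeasurableAtFilter (growthRate κ V w x) (𝓝[Set.Ioi t] t) volume := by
    refine ⟨Set.Ioc t (t + 1), Ioc_mem_nhdsGT (by linarith), ?_⟩
    have := hV.intervalIntegrable_growthRate (κ := κ) (a := t) (b := t + 1) (w := w)
      (fun y => (hc y).mono (uIcc_subset_Ici ht (by linarith))) x
    exact this.1.aestronglyMeasurable
  have hd := intervalIntegral.integral_hasDerivWithinAt_right (s := Set.Ici t) (t := Set.Ioi t)
    (hV.intervalIntegrable_growthRate (κ := κ) hc' x) hm (hrc.mono Set.Ioi_subset_Ici_self)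
  refine (hd.const_add (g x)).congr (fun s hs => h x s (ht.trans hs)) (h x t ht)

/-- The Picard iterates of the growth equation. -/
def picard (κ : ℝ) (V : Lattice d → ℝ → ℝ) (g : Lattice d → ℝ) : ℕ → Lattice d → ℝ → ℝ
  | 0, x, _ => g x
  | n + 1, x, t => ∫ r in (0 : ℝ)..t, growthRate κ V (picard κ V g n) x r

/-- The minimal solution of the growth equation. -/
def growth (κ : ℝ) (V : Lattice d → ℝ → ℝ) (g : Lattice d → ℝ) (x : Lattice d) (t : ℝ) : ℝ :=
  ∑' n, picard κ V g n x t

variable {g : Lattice d → ℝ} {C : ℝ}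

lemma IsPotential.continuous_picard (hV : IsPotential γ V) (g : Lattice d → ℝ) (n : ℕ)
    (x : Lattice d) : Continuous (picard κ V g n x) := by
  induction n generalizing x with
  | zero => exact continuous_const
  | succ n ih =>
    exact intervalIntegral.continuous_primitive (fun a b =>
      hV.intervalIntegrable_growthRate (fun y => (ih y).continuousOn) x) 0

lemma growthRate_nonneg (hκ : 0 ≤ κ) (hV : IsPotential γ V) {t : ℝ} (hw : ∀ x, 0 ≤ w x t)
    (x : Lattice d) : 0 ≤ growthRate κ V w x t :=
  add_nonneg (mul_nonneg hκ (nbSum_nonneg hw x)) (mul_nonneg (hV.nonneg x t) (hw x))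

lemma IsPotential.picard_nonneg (hV : IsPotential γ V) (hκ : 0 ≤ κ) (hg : ∀ x, 0 ≤ g x) (n : ℕ)
    (x : Lattice d) {t : ℝ} (ht : 0 ≤ t) : 0 ≤ picard κ V g n x t := by
  induction n generalizing x t with
  | zero => exact hg x
  | succ n ih =>
    exact intervalIntegral.integral_nonneg ht fun r hr =>
      growthRate_nonneg hκ hV (fun y => ih y hr.1) x

lemma integral_mul_pow_div_factorial (c t : ℝ) (n : ℕ) :
    ∫ r in (0 : ℝ)..t, c * ((c * r) ^ n / n.factorial) = (c * t) ^ (n + 1) / (n + 1).factorial := by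
  have : ∀ r : ℝ, c * ((c * r) ^ n / n.factorial) = c ^ (n + 1) / n.factorial * r ^ n := by
    intro r; rw [mul_pow]; ring
  simp only [this]
  rw [intervalIntegral.integral_const_mul, integral_pow, mul_pow, Nat.factorial_succ]
  push_cast
  field_simp
  simp

lemma IsPotential.picard_le (hV : IsPotential γ V) (hκ : 0 ≤ κ) (hC : ∀ x, g x ≤ C)
    (hg : ∀ x, 0 ≤ g x) (n : ℕ) (x : Lattice d) {t : ℝ} (ht : 0 ≤ t) :
    picard κ V g n x t ≤ C * (((2 * d * κ + γ) * t) ^ n / n.factorial) := by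
  induction n generalizing x t with
  | zero => simpa [picard] using hC x
  | succ n ih =>
    rw [← integral_mul_pow_div_factorial, ← intervalIntegral.integral_const_mul]
    refine intervalIntegral.integral_mono_on ht
      (hV.intervalIntegrable_growthRate (fun y => (hV.continuous_picard g n y).continuousOn) x)
      (Continuous.intervalIntegrable (by fun_prop) _ _) fun r hr => ?_
    have h1 := nbSum_le (fun y => ih y hr.1) x
    have h2 : V x r * picard κ V g n x r ≤ γ * (C * (((2 * d * κ + γ) * r) ^ n / n.factorial)) :=
      mul_le_mul (hV.le x r) (ih x hr.1) (hV.picard_nonneg hκ hg n x hr.1)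
        ((hV.nonneg x r).trans (hV.le x r))
    have h3 := mul_le_mul_of_nonneg_left h1 hκ
    simp only [growthRate]
    linarith

/-- The common bounds on bounded nonnegative initial data. -/
structure IsDatum (g : Lattice d → ℝ) : Prop where
  nonneg : ∀ x, 0 ≤ g x
  le_one : ∀ x, g x ≤ 1

lemma IsPotential.rate_nonneg (hV : IsPotential γ V) (hκ : 0 ≤ κ) : 0 ≤ 2 * d * κ + γ := by
  have : 0 ≤ γ := (hV.nonneg 0 0).trans (hV.le 0 0)
  positivity

lemma IsPotential.abs_picard_le (hV : IsPotential γ V) (hκ : 0 ≤ κ) (hg : IsDatum g) (n : ℕ)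
    (x : Lattice d) {t T : ℝ} (ht : 0 ≤ t) (htT : t ≤ T) :
    |picard κ V g n x t| ≤ ((2 * d * κ + γ) * T) ^ n / n.factorial := by
  rw [abs_of_nonneg (hV.picard_nonneg hκ hg.nonneg n x ht)]
  refine (hV.picard_le hκ hg.le_one hg.nonneg n x ht).trans ?_
  rw [one_mul]
  have := hV.rate_nonneg hκ (d := d)
  gcongr

lemma IsPotential.summable_picard (hV : IsPotential γ V) (hκ : 0 ≤ κ) (hg : IsDatum g)
    (x : Lattice d) {t : ℝ} (ht : 0 ≤ t) : Summable fun n => picard κ V g n x t :=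
  Summable.of_norm_bounded (Real.summable_pow_div_factorial _)
    fun n => hV.abs_picard_le hκ hg n x ht le_rfl

lemma IsPotential.growth_nonneg (hV : IsPotential γ V) (hκ : 0 ≤ κ) (hg : IsDatum g)
    (x : Lattice d) {t : ℝ} (ht : 0 ≤ t) : 0 ≤ growth κ V g x t :=
  tsum_nonneg fun n => hV.picard_nonneg hκ hg.nonneg n x ht

lemma tsum_pow_div_factorial (a : ℝ) : ∑' n : ℕ, a ^ n / n.factorial = Real.exp a := by
  rw [Real.exp_eq_exp_ℝ, NormedSpace.exp_eq_tsum_div]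

lemma IsPotential.growth_le (hV : IsPotential γ V) (hκ : 0 ≤ κ) (hg : IsDatum g)
    (x : Lattice d) {t : ℝ} (ht : 0 ≤ t) :
    growth κ V g x t ≤ Real.exp ((2 * d * κ + γ) * t) := by
  rw [← tsum_pow_div_factorial]
  exact (hV.summable_picard hκ hg x ht).tsum_le_tsum
    (fun n => (le_abs_self _).trans (hV.abs_picard_le hκ hg n x ht le_rfl))
    (Real.summable_pow_div_factorial _)

lemma IsPotential.continuousOn_growth (hV : IsPotential γ V) (hκ : 0 ≤ κ) (hg : IsDatum g)
    (x : Lattice d) : ContinuousOn (growth κ V g x) (Set.Ici 0) := by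
  have h : ∀ T, ContinuousOn (growth κ V g x) (Set.Icc 0 T) := fun T =>
    continuousOn_tsum (fun n => (hV.continuous_picard g n x).continuousOn)
      (Real.summable_pow_div_factorial ((2 * d * κ + γ) * T))
      fun n t ht => hV.abs_picard_le hκ hg n x ht.1 ht.2
  intro t ht
  refine ((h (t + 1)) t ⟨ht, by linarith⟩).mono_of_mem_nhdsWithin ?_
  have : Set.Ici 0 ∩ Set.Iio (t + 1) ⊆ Set.Icc 0 (t + 1) := fun s hs => ⟨hs.1, le_of_lt hs.2⟩
  exact mem_of_superset (inter_mem_nhdsWithin _ (Iio_mem_nhds (by linarith))) this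

lemma hasSum_growthRate_picard (hV : IsPotential γ V) (hκ : 0 ≤ κ) (hg : IsDatum g) (x : Lattice d)
    {r : ℝ} (hr : 0 ≤ r) : HasSum (fun n => growthRate κ V (picard κ V g n) x r)
      (growthRate κ V (growth κ V g) x r) :=
  ((hasSum_sum fun k _ => (hV.summable_picard hκ hg (nb k x) hr).hasSum).mul_left κ).add
    ((hV.summable_picard hκ hg x hr).hasSum.mul_left (V x r))

lemma IsPotential.growth_eq (hV : IsPotential γ V) (hκ : 0 ≤ κ) (hg : IsDatum g) (x : Lattice d)
    {t : ℝ} (ht : 0 ≤ t) :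
    growth κ V g x t = g x + ∫ r in (0 : ℝ)..t, growthRate κ V (growth κ V g) x r := by
  have h1 : HasSum (fun n => picard κ V g (n + 1) x t)
      (∫ r in (0 : ℝ)..t, growthRate κ V (growth κ V g) x r) := by
    refine intervalIntegral.hasSum_integral_of_dominated_convergence
      (fun n _ => (2 * d * κ + γ) * (((2 * d * κ + γ) * t) ^ n / n.factorial)) (fun n => ?_)
      (fun n => Eventually.of_forall fun r hr => ?_) (Eventually.of_forall fun r _ =>
        (Real.summable_pow_div_factorial _).mul_left _) ?_ (Eventually.of_forall fun r hr => ?_)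
    · rw [Set.uIoc_of_le ht]
      exact (hV.intervalIntegrable_growthRate (a := 0) (b := t)
        (fun y => (hV.continuous_picard g n y).continuousOn) x).1.aestronglyMeasurable
    · rw [Set.uIoc_of_le ht] at hr
      rw [Real.norm_of_nonneg (growthRate_nonneg hκ hV
        (fun y => hV.picard_nonneg hκ hg.nonneg n y hr.1.le) x)]
      have hb : ∀ y, picard κ V g n y r ≤ ((2 * d * κ + γ) * t) ^ n / n.factorial := fun y =>
        (le_abs_self _).trans (hV.abs_picard_le hκ hg n y hr.1.le hr.2)
      have h1 := mul_le_mul_of_nonneg_left (nbSum_le hb x) hκ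
      have h2 := mul_le_mul (hV.le x r) (hb x) (hV.picard_nonneg hκ hg.nonneg n x hr.1.le)
        ((hV.nonneg x r).trans (hV.le x r))
      simp only [growthRate]
      linarith
    · exact intervalIntegrable_const
    · rw [Set.uIoc_of_le ht] at hr
      exact hasSum_growthRate_picard hV hκ hg x hr.1.le
  rw [growth, (hV.summable_picard hκ hg x ht).tsum_eq_zero_add, h1.tsum_eq]
  rfl

lemma IsPotential.isGrowthSolution_growth (hV : IsPotential γ V) (hκ : 0 ≤ κ) (hg : IsDatum g) :
    IsGrowthSolution κ V (growth κ V g) :=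
  isGrowthSolution_of_integral hV (hV.continuousOn_growth hκ hg) fun x _ ht => hV.growth_eq hκ hg x ht

lemma growth_zero (κ : ℝ) (V : Lattice d → ℝ → ℝ) (g : Lattice d → ℝ) (x : Lattice d) :
    growth κ V g x 0 = g x := by
  rw [growth, tsum_eq_single 0]
  · rfl
  · intro n hn
    obtain ⟨m, rfl⟩ := Nat.exists_eq_succ_of_ne_zero hn
    simp [picard]

/-- The growth solution is minimal among the nonnegative solutions. -/
lemma IsGrowthSolution.growth_le (hw : IsGrowthSolution κ V w) (hV : IsPotential γ V) (hκ : 0 ≤ κ)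
    (hg : ∀ x, 0 ≤ g x) (hw0 : ∀ x t, 0 ≤ t → 0 ≤ w x t) (hwg : ∀ x, g x ≤ w x 0) (x : Lattice d)
    {t : ℝ} (ht : 0 ≤ t) : growth κ V g x t ≤ w x t := by
  refine Real.tsum_le_of_sum_range_le (fun n => hV.picard_nonneg hκ hg n x ht) fun N => ?_
  induction N generalizing x t with
  | zero => simpa using hw0 x t ht
  | succ N ih =>
    have hpc : ∀ n y, ContinuousOn (picard κ V g n y) (Set.uIcc 0 t) := fun n y =>
      (hV.continuous_picard g n y).continuousOn
    have h1 := hw.sub_eq_integral hV x le_rfl ht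
    have h0 := hwg x
    rw [Finset.sum_range_succ']
    have h2 : ∑ n ∈ Finset.range N, picard κ V g (n + 1) x t
        = ∫ r in (0 : ℝ)..t, ∑ n ∈ Finset.range N, growthRate κ V (picard κ V g n) x r :=
      (intervalIntegral.integral_finsetSum fun n _ =>
        hV.intervalIntegrable_growthRate (hpc n) x).symm
    have h3 : ∫ r in (0 : ℝ)..t, ∑ n ∈ Finset.range N, growthRate κ V (picard κ V g n) x r
        ≤ ∫ r in (0 : ℝ)..t, growthRate κ V w x r := by
      refine intervalIntegral.integral_mono_on ht ?_ ?_ fun r hr => ?_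
      · have := IntervalIntegrable.sum (Finset.range N) fun n _ =>
          hV.intervalIntegrable_growthRate (κ := κ) (hpc n) x
        simpa only [Finset.sum_fn] using this
      · exact hV.intervalIntegrable_growthRate
          (fun y => (hw.continuousOn y).mono (uIcc_subset_Ici le_rfl ht)) x
      · have e : ∑ n ∈ Finset.range N, growthRate κ V (picard κ V g n) x r
            = growthRate κ V (fun y s => ∑ n ∈ Finset.range N, picard κ V g n y s) x r := by
          simp only [growthRate, nbSum, Finset.sum_add_distrib, ← Finset.mul_sum]
          rw [Finset.sum_comm]
        rw [e]
        exact add_le_add (mul_le_mul_of_nonneg_left (nbSum_mono (fun y => ih y hr.1) x) hκ)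
          (mul_le_mul_of_nonneg_left (ih x hr.1) (hV.nonneg x r))
    have h4 : picard κ V g 0 x t = g x := rfl
    linarith

lemma IsGrowthSolution.sub {w' : Lattice d → ℝ → ℝ} (hw : IsGrowthSolution κ V w)
    (hw' : IsGrowthSolution κ V w') : IsGrowthSolution κ V fun x t => w x t - w' x t := by
  refine ⟨fun x => (hw.continuousOn x).sub (hw'.continuousOn x), fun x t ht => ?_⟩
  refine ((hw.equation x t ht).sub (hw'.equation x t ht)).congr_deriv ?_
  simp only [growthRate, nbSum_sub]
  ring

/-- The sum of `e` over all walks of `n` nearest neighbour steps. -/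
def walkSum (e : Lattice d → ℝ → ℝ) : ℕ → Lattice d → ℝ → ℝ
  | 0, x, t => e x t
  | n + 1, x, t => nbSum (fun y => walkSum e n y t) x

/-- A nonnegative solution of the growth equation that vanishes at time `0` is zero. -/
theorem IsGrowthSolution.eq_zero (hw : IsGrowthSolution κ V w) (hV : IsPotential γ V)
    (hκ : 0 ≤ κ) (hw0 : ∀ x t, 0 ≤ t → 0 ≤ w x t) (hi : ∀ x, w x 0 = 0) (x : Lattice d) {t : ℝ}
    (ht : 0 ≤ t) : w x t = 0 := by
  have hint : ∀ x {s t : ℝ}, 0 ≤ s → s ≤ t → IntervalIntegrable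
      (fun r => κ * nbSum (fun y => w y r) x) volume s t := fun x s t hs hst =>
    ((continuousOn_nbSum (fun y => (hw.continuousOn y).mono
      (uIcc_subset_Ici hs (hs.trans hst))) x).intervalIntegrable).const_mul κ
  have hlow : ∀ x {s t : ℝ}, 0 ≤ s → s ≤ t →
      w x s + ∫ r in s..t, κ * nbSum (fun y => w y r) x ≤ w x t := by
    intro x s t hs hst
    have h1 := hw.sub_eq_integral hV x hs hst
    have h2 : ∫ r in s..t, κ * nbSum (fun y => w y r) x ≤ ∫ r in s..t, growthRate κ V w x r := by
      refine intervalIntegral.integral_mono_on hst (hint x hs hst)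
        (hV.intervalIntegrable_growthRate (fun y => (hw.continuousOn y).mono
          (uIcc_subset_Ici hs (hs.trans hst))) x) fun r hr => ?_
      exact le_add_of_nonneg_right (mul_nonneg (hV.nonneg x r) (hw0 x r (hs.trans hr.1)))
    linarith
  have hmono : ∀ n x {s t : ℝ}, 0 ≤ s → s ≤ t → walkSum w n x s ≤ walkSum w n x t := by
    intro n
    induction n with
    | zero =>
      intro x s t hs hst
      have := intervalIntegral.integral_nonneg (μ := volume) hst fun r hr =>
        mul_nonneg hκ (nbSum_nonneg (fun y => hw0 y r (hs.trans hr.1)) x)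
      have := hlow x hs hst
      simp only [walkSum]
      linarith
    | succ n ih =>
      intro x s t hs hst
      exact nbSum_mono (fun y => ih y hs hst) x
  have hS0 : ∀ n x {t : ℝ}, 0 ≤ t → 0 ≤ walkSum w n x t := by
    intro n
    induction n with
    | zero => intro x t ht; exact hw0 x t ht
    | succ n ih => intro x t ht; exact nbSum_nonneg (fun y => ih y ht) x
  -- This keeps the `n`-step walks in the Duhamel expansion and drops the potential. Together with
  -- `upper`, it replaces any growth condition at infinity.
  have lower : ∀ n x {s t : ℝ}, 0 ≤ s → s ≤ t →
      (κ * (t - s)) ^ n / n.factorial * walkSum w n x s ≤ w x t := by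
    intro n
    induction n with
    | zero => intro x s t hs hst; simpa [walkSum] using hmono 0 x hs hst
    | succ n ih =>
      intro x s t hs hst
      have h1 := hlow x hs hst
      have h2 : ∫ r in s..t, κ * ((κ * (r - s)) ^ n / n.factorial) * walkSum w (n + 1) x s
          ≤ ∫ r in s..t, κ * nbSum (fun y => w y r) x := by
        refine intervalIntegral.integral_mono_on hst (Continuous.intervalIntegrable (by fun_prop) _ _)
          (hint x hs hst) fun r hr => ?_
        rw [mul_assoc, walkSum, ← nbSum_const_mul]
        exact mul_le_mul_of_nonneg_left (nbSum_mono (fun y => ih y hs hr.1) x) hκ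
      rw [intervalIntegral.integral_mul_const,
        intervalIntegral.integral_comp_sub_right (fun r => κ * ((κ * r) ^ n / n.factorial)),
        sub_self, integral_mul_pow_div_factorial] at h2
      have := hw0 x s hs
      linarith
  -- The factor `exp (-γ t)` absorbs the potential, since `V ≤ γ`. As `w` vanishes at time `0`,
  -- every iteration is a pure integral, and monotonicity in time puts all values at time `t`.
  have upper : ∀ n x {t : ℝ}, 0 ≤ t →
      Real.exp (-γ * t) * w x t ≤ (κ * t) ^ n / n.factorial * walkSum w n x t := by
    intro n
    induction n with
    | zero =>
      intro x t ht
      have hγ : 0 ≤ γ := (hV.nonneg 0 0).trans (hV.le 0 0)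
      simp only [pow_zero, Nat.factorial_zero, Nat.cast_one, div_one, walkSum]
      exact mul_le_mul_of_nonneg_right (Real.exp_le_one_iff.2 (by nlinarith)) (hw0 x t ht)
    | succ n ih =>
      intro x t ht
      have hexp : ∀ r : ℝ, HasDerivAt (fun r => Real.exp (-γ * r)) (Real.exp (-γ * r) * -γ) r := by
        intro r
        have := ((hasDerivAt_id r).const_mul (-γ)).exp
        simpa using this
      have hcE : Continuous fun r => Real.exp (-γ * r) := by fun_prop
      have hcw := fun y => (hw.continuousOn y).mono (uIcc_subset_Ici le_rfl ht)
      have hii : IntervalIntegrable (fun r => Real.exp (-γ * r) * -γ * w x r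
          + Real.exp (-γ * r) * growthRate κ V w x r) volume 0 t :=
        (ContinuousOn.intervalIntegrable (by fun_prop)).add
          ((hV.intervalIntegrable_growthRate hcw x).continuousOn_mul hcE.continuousOn)
      have h1 : ∫ r in (0 : ℝ)..t, (Real.exp (-γ * r) * -γ * w x r
          + Real.exp (-γ * r) * growthRate κ V w x r)
          = Real.exp (-γ * t) * w x t - Real.exp (-γ * 0) * w x 0 := by
        refine intervalIntegral.integral_eq_sub_of_hasDeriv_right
          (f := fun r => Real.exp (-γ * r) * w x r) (hcE.continuousOn.mul (hcw x)) (fun r hr => ?_) hii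
        rw [min_eq_left ht] at hr
        exact ((hexp r).hasDerivWithinAt.mul (hw.equation x r hr.1.le)).mono Set.Ioi_subset_Ici_self
      rw [hi, mul_zero, sub_zero] at h1
      rw [← h1]
      calc _ ≤ ∫ r in (0 : ℝ)..t, κ * ((κ * r) ^ n / n.factorial) * walkSum w (n + 1) x t := by
            refine intervalIntegral.integral_mono_on ht hii
              (Continuous.intervalIntegrable (by fun_prop) _ _) fun r hr => ?_
            have e1 : Real.exp (-γ * r) * -γ * w x r + Real.exp (-γ * r) * growthRate κ V w x r
                ≤ κ * nbSum (fun y => Real.exp (-γ * r) * w y r) x := by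
              rw [nbSum_const_mul]
              simp only [growthRate]
              have : Real.exp (-γ * r) * ((γ - V x r) * w x r) ≥ 0 :=
                mul_nonneg (Real.exp_pos _).le
                  (mul_nonneg (sub_nonneg.2 (hV.le x r)) (hw0 x r hr.1))
              linarith
            refine e1.trans ?_
            have e2 : nbSum (fun y => Real.exp (-γ * r) * w y r) x
                ≤ (κ * r) ^ n / n.factorial * walkSum w (n + 1) x t := by
              rw [walkSum, ← nbSum_const_mul ((κ * r) ^ n / n.factorial)]
              refine nbSum_mono (fun y => (ih y hr.1).trans ?_) x
              refine mul_le_mul_of_nonneg_left (hmono n y hr.1 hr.2) ?_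
              have := mul_nonneg hκ hr.1
              positivity
            rw [mul_assoc]
            exact mul_le_mul_of_nonneg_left e2 hκ
        _ = _ := by rw [intervalIntegral.integral_mul_const, integral_mul_pow_div_factorial]
  rcases ht.eq_or_lt with rfl | htpos
  · exact hi x
  -- The lower bound from `t` to `3 t` has elapsed time `2 t`, hence a factor `2 ^ n` more than the
  -- upper bound at `t`, with the same walk sum. Letting `n → ∞` forces `w x t = 0`.
  have main : ∀ n : ℕ, (2 : ℝ) ^ n * (Real.exp (-γ * t) * w x t) ≤ w x (3 * t) := by
    intro n
    refine le_trans ?_ (lower n x ht (by linarith : t ≤ 3 * t))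
    refine (mul_le_mul_of_nonneg_left (upper n x ht) (by positivity)).trans (le_of_eq ?_)
    rw [show κ * (3 * t - t) = 2 * (κ * t) by ring, mul_pow]
    ring
  by_contra hne
  have hpos : 0 < Real.exp (-γ * t) * w x t :=
    mul_pos (Real.exp_pos _) (lt_of_le_of_ne (hw0 x t ht) (Ne.symm hne))
  obtain ⟨n, hn⟩ := pow_unbounded_of_one_lt (w x (3 * t) / (Real.exp (-γ * t) * w x t)) one_lt_two
  rw [div_lt_iff₀ hpos] at hn
  exact absurd (main n) (not_le.2 hn)

/-- Nonnegative solutions of the growth equation are unique. -/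
theorem IsGrowthSolution.eq_growth (hw : IsGrowthSolution κ V w) (hV : IsPotential γ V) (hκ : 0 ≤ κ)
    (hg : IsDatum g) (hw0 : ∀ x t, 0 ≤ t → 0 ≤ w x t) (hwg : ∀ x, w x 0 = g x) (x : Lattice d)
    {t : ℝ} (ht : 0 ≤ t) : w x t = growth κ V g x t := by
  -- By minimality the difference is nonnegative, so the uniqueness result for zero initial data
  -- applies to it.
  have h := (hw.sub (hV.isGrowthSolution_growth hκ hg)).eq_zero hV hκ
    (fun y s hs => sub_nonneg.2 (hw.growth_le hV hκ hg.nonneg hw0 (fun x => (hwg x).ge) y hs))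
    (fun y => by rw [hwg, growth_zero, sub_self]) x ht
  linarith

end Growth

/-! ### Translation, linearity, finite range and composition of the growth solution. -/

section GrowthAlgebra

variable {d : ℕ} {κ γ : ℝ} {V : Lattice d → ℝ → ℝ} {g : Lattice d → ℝ}

lemma nb_add (k : Fin d × Bool) (x v : Lattice d) : nb k (x + v) = nb k x + v := by
  unfold nb
  split_ifs <;> abel

lemma picard_translate (κ : ℝ) (V : Lattice d → ℝ → ℝ) (g : Lattice d → ℝ) (v : Lattice d) (n : ℕ)
    (x : Lattice d) (t : ℝ) :
    picard κ V g n (x + v) t = picard κ (fun y => V (y + v)) (fun y => g (y + v)) n x t := by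
  induction n generalizing x t with
  | zero => rfl
  | succ n ih => simp only [picard, growthRate, nbSum, nb_add, ih]

lemma growth_translate (κ : ℝ) (V : Lattice d → ℝ → ℝ) (g : Lattice d → ℝ) (v x : Lattice d) (t : ℝ) :
    growth κ V g (x + v) t = growth κ (fun y => V (y + v)) (fun y => g (y + v)) x t :=
  tsum_congr fun n => picard_translate κ V g v n x t

lemma IsPotential.picard_sum (hV : IsPotential γ V) (κ : ℝ) {ι : Type*} (Y : Finset ι) (c : ι → ℝ)
    (g : ι → Lattice d → ℝ) (n : ℕ) (x : Lattice d) (t : ℝ) :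
    picard κ V (fun y => ∑ i ∈ Y, c i * g i y) n x t = ∑ i ∈ Y, c i * picard κ V (g i) n x t := by
  induction n generalizing x t with
  | zero => rfl
  | succ n ih =>
    simp only [picard, ← intervalIntegral.integral_const_mul]
    rw [← intervalIntegral.integral_finsetSum fun i _ =>
      (hV.intervalIntegrable_growthRate
        (fun y => (hV.continuous_picard (g i) n y).continuousOn) x).const_mul (c i)]
    refine intervalIntegral.integral_congr fun r _ => ?_
    simp only [growthRate, nbSum, ih, mul_add, Finset.sum_add_distrib, Finset.mul_sum]
    rw [Finset.sum_comm]
    congr 1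
    · exact Finset.sum_congr rfl fun i _ => Finset.sum_congr rfl fun k _ => by ring
    · exact Finset.sum_congr rfl fun i _ => by ring

lemma IsPotential.growth_sum (hV : IsPotential γ V) (hκ : 0 ≤ κ) {ι : Type*} (Y : Finset ι)
    (c : ι → ℝ) (g : ι → Lattice d → ℝ) (hg : ∀ i ∈ Y, IsDatum (g i)) (x : Lattice d) {t : ℝ}
    (ht : 0 ≤ t) :
    growth κ V (fun y => ∑ i ∈ Y, c i * g i y) x t = ∑ i ∈ Y, c i * growth κ V (g i) x t := by
  simp only [growth, hV.picard_sum, ← tsum_mul_left]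
  exact Summable.tsum_finsetSum fun i hi => (hV.summable_picard hκ (hg i hi) x ht).mul_left _

/-- Finite range: the initial datum outside a box is not felt before enough steps were made. -/
lemma picard_eq_zero (κ : ℝ) (V : Lattice d → ℝ → ℝ) {R : ℤ} (hg : ∀ y, (∀ i, |y i| ≤ R) → g y = 0)
    (n : ℕ) (x : Lattice d) (hx : ∀ i, |x i| + n ≤ R) (t : ℝ) : picard κ V g n x t = 0 := by
  induction n generalizing x t with
  | zero => exact hg x (by simpa using hx)
  | succ n ih =>
    have h1 : ∀ r, growthRate κ V (picard κ V g n) x r = 0 := by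
      intro r
      have hn : ∀ k, picard κ V g n (nb k x) r = 0 := by
        refine fun k => ih _ (fun i => ?_) r
        have h2 : |nb k x i| ≤ |x i| + 1 := by
          have hs : |(Pi.single k.1 1 : Lattice d) i| ≤ 1 := by
            rw [Pi.single_apply]; split_ifs <;> simp
          unfold nb
          split_ifs
          · exact (abs_add_le _ _).trans (by gcongr)
          · exact (abs_sub _ _).trans (by gcongr)
        have := hx i
        push_cast at this
        linarith
      have h0 : picard κ V g n x r = 0 := ih x (fun i => by
        have := hx i
        push_cast at this
        linarith) r
      simp [growthRate, nbSum, hn, h0]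
    simp [picard, h1]

/-- The Picard iterates up to `R` do not see the datum from the origin. For `n > R` the factor `exp
(n - R) ≥ 1` may be inserted, and the series sums to an exponential. -/
lemma IsPotential.growth_le_of_vanishing (hV : IsPotential γ V) (hκ : 0 ≤ κ) (hg : IsDatum g) {R : ℕ}
    (hgR : ∀ y, (∀ i, |y i| ≤ (R : ℤ)) → g y = 0) {t : ℝ} (ht : 0 ≤ t) :
    growth κ V g 0 t ≤ Real.exp (Real.exp 1 * ((2 * d * κ + γ) * t) - R) := by
  have hc : 0 ≤ (2 * d * κ + γ) * t := mul_nonneg (hV.rate_nonneg hκ) ht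
  rw [sub_eq_neg_add, Real.exp_add, ← tsum_pow_div_factorial (Real.exp 1 * _), ← tsum_mul_left]
  refine (hV.summable_picard hκ hg 0 ht).tsum_le_tsum (fun n => ?_)
    ((Real.summable_pow_div_factorial _).mul_left _)
  rcases le_or_gt n R with hn | hn
  · rw [picard_eq_zero κ V hgR n 0 (fun i => by simpa using hn)]
    positivity
  · refine (le_abs_self _).trans ((hV.abs_picard_le hκ hg n 0 ht le_rfl).trans ?_)
    rw [mul_pow (Real.exp 1), ← Real.exp_nat_mul, mul_div_assoc, ← mul_assoc, ← Real.exp_add]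
    refine le_mul_of_one_le_left (by positivity) (Real.one_le_exp ?_)
    have : (R : ℝ) ≤ n := by exact_mod_cast hn.le
    linarith

/-- The unit mass at `z`. -/
def unitMass (z x : Lattice d) : ℝ := if x = z then 1 else 0

lemma isDatum_unitMass (z : Lattice d) : IsDatum (unitMass z) :=
  ⟨fun x => by unfold unitMass; split_ifs <;> norm_num,
    fun x => by unfold unitMass; split_ifs <;> norm_num⟩

lemma isDatum_one : IsDatum (fun _ : Lattice d => 1) := ⟨fun _ => zero_le_one, fun _ => le_rfl⟩

lemma unitMass_add (z x v : Lattice d) : unitMass z (x + v) = unitMass (z - v) x := by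
  simp only [unitMass, eq_sub_iff_add_eq]

lemma sum_mul_unitMass (Y : Finset (Lattice d)) (c : Lattice d → ℝ) (x : Lattice d) :
    ∑ y ∈ Y, c y * unitMass y x = if x ∈ Y then c x else 0 := by
  simp [unitMass]

lemma IsGrowthSolution.shift {w V' : Lattice d → ℝ → ℝ} (hw : IsGrowthSolution κ V w) {t : ℝ}
    (ht : 0 ≤ t) (hV' : ∀ x r, 0 ≤ r → V' x r = V x (t + r)) :
    IsGrowthSolution κ V' fun x r => w x (t + r) := by
  refine ⟨fun x => (hw.continuousOn x).comp (by fun_prop) fun r hr => add_nonneg ht hr,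
    fun x r hr => ?_⟩
  have h := (hw.equation x (t + r) (add_nonneg ht hr)).scomp (h := fun r => t + r) (h' := 1)
    (s := Set.Ici r) r ((hasDerivAt_id r).const_add t).hasDerivWithinAt
    (fun s hs => add_le_add_right hs t)
  refine (h.congr_deriv ?_ :)
  simp [growthRate, hV' x r hr]

/-- The growth started at the point masses evolves at least into the superposition of the growths
that are started at time `t`. -/
lemma IsPotential.sum_growth_mul_le (hV : IsPotential γ V) (hκ : 0 ≤ κ) (hg : IsDatum g)
    {V' : Lattice d → ℝ → ℝ} (hV' : IsPotential γ V') {s t : ℝ} (hs : 0 ≤ s) (ht : 0 ≤ t)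
    (h : ∀ x r, 0 ≤ r → V' x r = V x (t + r)) (Y : Finset (Lattice d)) (x : Lattice d) :
    ∑ y ∈ Y, growth κ V g y t * growth κ V' (unitMass y) x s ≤ growth κ V g x (t + s) := by
  have h0 : ∀ x r, 0 ≤ r → 0 ≤ growth κ V g x r := fun x r hr => hV.growth_nonneg hκ hg x hr
  rw [← hV'.growth_sum hκ Y _ _ (fun y _ => isDatum_unitMass y) x hs]
  -- The solution restarted at time `t` solves the shifted equation and dominates the finite
  -- superposition at its start, so minimality gives the claim.
  refine ((hV.isGrowthSolution_growth hκ hg).shift ht h).growth_le hV' hκ (fun y => ?_)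
    (fun y r hr => h0 y _ (add_nonneg ht hr)) (fun y => ?_) x hs
  · exact Finset.sum_nonneg fun i _ => mul_nonneg (h0 i t ht) ((isDatum_unitMass i).nonneg y)
  · rw [sum_mul_unitMass, add_zero]
    split_ifs
    · exact le_rfl
    · exact h0 y t ht

end GrowthAlgebra

/-! ### Comparison principle for flows generated by coalescing random walks. -/

section CoalFlow

variable {d : ℕ} {p : Lattice d → Lattice d → ℝ}

/-- A flow of functions of finite sets that is generated by the coalescing random walks. -/
structure IsCoalFlow (p : Lattice d → Lattice d → ℝ) (φ : ℝ≥0 → Finset (Lattice d) → ℝ) : Prop where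
  mem_Icc : ∀ t A, φ t A ∈ Set.Icc (0 : ℝ) 1
  euler : ∀ A s t, s ≤ t → |φ t A - φ s A - (t - s) * coalOp p (φ s) A|
    ≤ 2 * A.card ^ 2 * (t - s : ℝ) ^ 2

lemma coalOp_eq_sum (φ : Finset (Lattice d) → ℝ) {A C : Finset (Lattice d)} (h : A ⊆ C) :
    coalOp p φ A = ∑ x ∈ C, ∑' y, p x y * (φ (A.image (moveTo x y)) - φ A) := by
  refine Finset.sum_subset h fun x _ hx => ?_
  simp [image_moveTo_of_notMem hx]

lemma image_image_add_moveTo (A : Finset (Lattice d)) (x y v : Lattice d) :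
    (A.image (· + v)).image (moveTo (x + v) (y + v)) = (A.image (moveTo x y)).image (· + v) := by
  rw [Finset.image_image, Finset.image_image]
  refine Finset.image_congr fun z _ => ?_
  simp only [Function.comp_apply, moveTo, add_left_inj]
  split_ifs <;> rfl

lemma coalOp_translate (hp : IsRandomWalkKernel p) (φ : Finset (Lattice d) → ℝ) (v : Lattice d)
    (A : Finset (Lattice d)) :
    coalOp p (fun B => φ (B.image (· + v))) A = coalOp p φ (A.image (· + v)) := by
  rw [coalOp, coalOp, Finset.sum_image fun a _ b _ h => add_left_injective v h]
  refine Finset.sum_congr rfl fun x _ => ?_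
  refine ((tsum_congr fun y => ?_).trans ((Equiv.addRight v).tsum_eq _))
  rw [Equiv.coe_addRight, hp.translation, image_image_add_moveTo]

lemma IsCoalFlow.translate {φ : ℝ≥0 → Finset (Lattice d) → ℝ} (hφ : IsCoalFlow p φ)
    (hp : IsRandomWalkKernel p) (v : Lattice d) :
    IsCoalFlow p fun t A => φ t (A.image (· + v)) := by
  refine ⟨fun t A => hφ.mem_Icc t _, fun A s t hst => ?_⟩
  have := hφ.euler (A.image (· + v)) s t hst
  rwa [← coalOp_translate hp, Finset.card_image_of_injective _ (add_left_injective v)] at this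

lemma tsum_mul_sub_const (hp : IsRandomWalkKernel p) (x : Lattice d) {f : Lattice d → ℝ} {C : ℝ}
    (hf : ∀ y, |f y| ≤ C) (b : ℝ) : ∑' y, p x y * (f y - b) = ∑' y, p x y * f y - b := by
  simp only [mul_sub]
  rw [(summable_mul_of_bounded hp x hf).tsum_sub ((hp.hasSum_one x).summable.mul_right b),
    tsum_mul_right, (hp.hasSum_one x).tsum_eq, one_mul]

/-- One Euler step of the coalescing flow preserves a lower bound. -/
lemma euler_step_le (hp : IsRandomWalkKernel p) {φ ψ : Finset (Lattice d) → ℝ}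
    (hφ : ∀ A, φ A ∈ Set.Icc (0 : ℝ) 1) (hψ : ∀ A, ψ A ∈ Set.Icc (0 : ℝ) 1) {c r e h : ℝ}
    (hc : 0 ≤ c) (hr : r ∈ Set.Icc (0 : ℝ) 1) (hh : 0 ≤ h) {N : ℕ} (hN : h * N ≤ 1)
    (hyp : ∀ A B : Finset (Lattice d), A.card + B.card ≤ N →
      c * r ^ B.card * ψ A - e ≤ φ (A ∪ B))
    (A B : Finset (Lattice d)) (hAB : A.card + B.card ≤ N) :
    c * r ^ B.card * (ψ A + h * coalOp p ψ A) - e ≤ φ (A ∪ B) + h * coalOp p φ (A ∪ B) := by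
  have hφ1 : ∀ A, |φ A| ≤ 1 := fun A => abs_le.2 ⟨by linarith [(hφ A).1], (hφ A).2⟩
  have hψ1 : ∀ A, |ψ A| ≤ 1 := fun A => abs_le.2 ⟨by linarith [(hψ A).1], (hψ A).2⟩
  rw [coalOp_eq_sum ψ (Finset.subset_union_left (s₂ := B)), coalOp]
  set C := A ∪ B with hC
  set K := c * r ^ B.card with hK
  have hcard : (C.card : ℝ) ≤ N := by exact_mod_cast (Finset.card_union_le _ _).trans hAB
  have h0 := hyp A B hAB
  -- Moving a site of `A ∪ B` maps `A` and `B` separately and increases neither cardinality, so the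
  -- hypothesis applies to the images, and `r ≤ 1` helps when `B` shrinks. Each site costs the slack
  -- `φ C - (K ψ A - e)` once.
  have hx : ∀ x ∈ C, K * ∑' y, p x y * (ψ (A.image (moveTo x y)) - ψ A) - (φ C - (K * ψ A - e))
      ≤ ∑' y, p x y * (φ (C.image (moveTo x y)) - φ C) := by
    intro x _
    rw [tsum_mul_sub_const hp x (fun y => hψ1 _), tsum_mul_sub_const hp x (fun y => hφ1 _)]
    have h1 : ∑' y, p x y * (K * ψ (A.image (moveTo x y)) - e)
        ≤ ∑' y, p x y * φ (C.image (moveTo x y)) := by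
      refine Summable.tsum_le_tsum (fun y => mul_le_mul_of_nonneg_left ?_ (hp.nonneg x y)) ?_
        (summable_mul_of_bounded hp x fun y => hφ1 _)
      · rw [hC, Finset.image_union]
        refine le_trans ?_ (hyp _ _ ((add_le_add Finset.card_image_le Finset.card_image_le).trans hAB))
        refine sub_le_sub_right (mul_le_mul_of_nonneg_right ?_ (hψ _).1) _
        exact mul_le_mul_of_nonneg_left (pow_le_pow_of_le_one hr.1 hr.2 Finset.card_image_le) hc
      · refine summable_mul_of_bounded hp x (C := |K| + |e|) fun y => (abs_sub _ _).trans ?_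
        rw [abs_mul]
        exact add_le_add (mul_le_of_le_one_right (abs_nonneg _) (hψ1 _)) le_rfl
    rw [tsum_mul_sub_const hp x (C := |K|) (fun y => by
      rw [abs_mul]; exact mul_le_of_le_one_right (abs_nonneg _) (hψ1 _))] at h1
    simp only [mul_left_comm (p x _) K] at h1
    rw [tsum_mul_left] at h1
    linarith
  have h2 := Finset.sum_le_sum hx
  rw [Finset.sum_sub_distrib, ← Finset.mul_sum, Finset.sum_const, nsmul_eq_mul] at h2
  have h3 := mul_le_mul_of_nonneg_left h2 hh
  -- The total cost is `h * C.card` times the slack, and the slack is available once; this is where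
  -- a small step size is used.
  have h4 : h * (C.card * (φ C - (K * ψ A - e))) ≤ φ C - (K * ψ A - e) := by
    rw [← mul_assoc]
    exact mul_le_of_le_one_left (by linarith) ((mul_le_mul_of_nonneg_left hcard hh).trans hN)
  linarith

lemma euler_arith {c j E F G a a' b b' k k' : ℝ} (hF : F * G ≤ E * G)
    (h1 : a + k - j * (2 * E * G * (1 + c)) ≤ b + k')
    (h2 : -(2 * F * G) ≤ b' - b - k') (h3 : a' - a - k ≤ c * (2 * E * G)) :
    a' - (j + 1) * (2 * E * G * (1 + c)) ≤ b' := by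
  linarith

/-- Comparison of two coalescing flows. -/
theorem IsCoalFlow.le_union {φ ψ : ℝ≥0 → Finset (Lattice d) → ℝ} (hφ : IsCoalFlow p φ)
    (hψ : IsCoalFlow p ψ) (hp : IsRandomWalkKernel p) {c r : ℝ} (hc : 0 ≤ c)
    (hr : r ∈ Set.Icc (0 : ℝ) 1)
    (h0 : ∀ A B : Finset (Lattice d), c * r ^ B.card * ψ 0 A ≤ φ 0 (A ∪ B)) (t : ℝ≥0)
    (A B : Finset (Lattice d)) : c * r ^ B.card * ψ t A ≤ φ t (A ∪ B) := by
  set N := A.card + B.card with hN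
  -- Each Euler step adds an error `2 N² h²` for `φ` and at most `c` times this for `ψ`. With about
  -- `t / h` steps the total is of order `h`.
  have key : ∀ (h : ℝ≥0), (h : ℝ) * N ≤ 1 → ∀ (j : ℕ) (A B : Finset (Lattice d)),
      A.card + B.card ≤ N →
      c * r ^ B.card * ψ (j * h) A - j * (2 * N ^ 2 * (h : ℝ) ^ 2 * (1 + c)) ≤ φ (j * h) (A ∪ B) := by
    intro h hh j
    induction j with
    | zero => intro A B _; simpa using h0 A B
    | succ j ih =>
      intro A B hAB
      have h1 := euler_step_le hp (hφ.mem_Icc (j * h)) (hψ.mem_Icc (j * h)) hc hr h.2 hh ih A B hAB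
      have hle : (j * h : ℝ≥0) ≤ (j + 1 : ℕ) * h := by gcongr; simp
      have e1 := hφ.euler (A ∪ B) _ _ hle
      have e2 := hψ.euler A _ _ hle
      have hd : (((j + 1 : ℕ) * h : ℝ≥0) : ℝ) - ((j * h : ℝ≥0) : ℝ) = h := by push_cast; ring
      rw [hd] at e1 e2
      have hcA : ((A.card : ℝ)) ^ 2 ≤ N ^ 2 := by
        have : (A.card : ℝ) ≤ N := by exact_mod_cast (Nat.le_add_right _ _).trans hAB
        exact pow_le_pow_left₀ (by positivity) this 2
      have hcU : (((A ∪ B).card : ℝ)) ^ 2 ≤ N ^ 2 := by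
        have : ((A ∪ B).card : ℝ) ≤ N := by exact_mod_cast (Finset.card_union_le _ _).trans hAB
        exact pow_le_pow_left₀ (by positivity) this 2
      have hh2 : (0 : ℝ) ≤ (h : ℝ) ^ 2 := by positivity
      have e1' := (abs_le.1 e1).1
      have e2' := (abs_le.1 e2).2
      have m1 := mul_le_mul_of_nonneg_right hcA hh2
      have m2 := mul_le_mul_of_nonneg_right hcU hh2
      have hK0 : 0 ≤ c * r ^ B.card := mul_nonneg hc (pow_nonneg hr.1 _)
      have hK1 : c * r ^ B.card ≤ c := mul_le_of_le_one_right hc (pow_le_one₀ hr.1 hr.2)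
      have m3 : c * r ^ B.card * (ψ ((j + 1 : ℕ) * h) A - ψ (j * h) A - h * coalOp p (ψ (j * h)) A)
          ≤ c * (2 * N ^ 2 * (h : ℝ) ^ 2) := by
        refine (mul_le_mul_of_nonneg_left e2' hK0).trans
          (mul_le_mul hK1 (by linarith) (by positivity) hc)
      rw [Nat.cast_succ (R := ℝ)]
      rw [mul_sub, mul_sub] at m3
      rw [mul_add] at h1
      refine euler_arith (j := j) m2 h1 e1' m3
  have hlim : Tendsto (fun m : ℕ => c * r ^ B.card * ψ t A
      - 2 * N ^ 2 * (t : ℝ) ^ 2 * (1 + c) * (1 / ((m : ℝ) + 1))) atTop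
      (𝓝 (c * r ^ B.card * ψ t A - 2 * N ^ 2 * (t : ℝ) ^ 2 * (1 + c) * 0)) :=
    (tendsto_one_div_add_atTop_nhds_zero_nat.const_mul _).const_sub _
  rw [mul_zero, sub_zero] at hlim
  refine le_of_tendsto hlim ?_
  obtain ⟨m₀, hm₀⟩ := exists_nat_ge ((t : ℝ) * N)
  filter_upwards [eventually_ge_atTop m₀] with m hm
  have hmm : ((m₀ : ℝ)) ≤ m := by exact_mod_cast hm
  have hpos : (0 : ℝ) < (m : ℝ) + 1 := by positivity
  have h1 := key (t / ((m : ℝ≥0) + 1)) (by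
    push_cast
    rw [div_mul_eq_mul_div, div_le_one hpos]
    linarith) (m + 1) A B le_rfl
  have h2 : ((m + 1 : ℕ) : ℝ≥0) * (t / ((m : ℝ≥0) + 1)) = t := by
    push_cast
    field_simp
  rw [h2] at h1
  refine le_trans (le_of_eq ?_) h1
  push_cast
  field_simp

end CoalFlow

/-! ### Comparison of joint occupation probabilities at several times. -/

section Voter

variable {d : ℕ} {Ω : Type*} [mΩ : MeasurableSpace Ω] {p : Lattice d → Lattice d → ℝ}
  {μ : Measure (Config d)} {P : Measure Ω} [IsProbabilityMeasure P] {ℱ : Filtration ℝ≥0 mΩ}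
  {ξ : ℝ≥0 → Ω → Config d}

lemma IsVoterModel.isCoalFlow_moment (hξ : IsVoterModel p μ P ℱ ξ) (hp : IsRandomWalkKernel p)
    {s : ℝ≥0} {Z : Ω → ℝ} (hZ : Measurable[ℱ s] Z) (h0 : ∀ ω, 0 ≤ Z ω) (h1 : ∀ ω, Z ω ≤ 1) :
    IsCoalFlow p fun t => moment P ξ Z (s + t) := by
  refine ⟨fun t A => hξ.moment_mem_Icc A _ (hZ.mono (ℱ.le s) le_rfl).aestronglyMeasurable h0 h1,
    fun A r t hrt => ?_⟩
  have := hξ.abs_moment_sub_le hp A (s := s + r) (t := s + t) (by gcongr)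
    (hZ.mono (ℱ.mono (by simp)) le_rfl) h0 h1
  push_cast at this
  rwa [add_sub_add_left_eq_sub] at this

/-- The indicator that the space-time points of `K`, translated by `i`, are occupied. -/
def occAt (ξ : ℝ≥0 → Ω → Config d) (i : ℝ≥0 × Lattice d) (K : Finset (Lattice d × ℝ≥0))
    (ω : Ω) : ℝ :=
  ∏ k ∈ K, occ {k.1 + i.2} (ξ (i.1 + k.2) ω)

lemma occAt_nonneg (i : ℝ≥0 × Lattice d) (K : Finset (Lattice d × ℝ≥0)) (ω : Ω) :
    0 ≤ occAt ξ i K ω := Finset.prod_nonneg fun _ _ => occ_nonneg _ _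

lemma occAt_le_one (i : ℝ≥0 × Lattice d) (K : Finset (Lattice d × ℝ≥0)) (ω : Ω) :
    occAt ξ i K ω ≤ 1 := Finset.prod_le_one (fun _ _ => occ_nonneg _ _) fun _ _ => occ_le_one _ _

@[simp] lemma occAt_empty (i : ℝ≥0 × Lattice d) (ω : Ω) : occAt ξ i ∅ ω = 1 := rfl

lemma occAt_insert (i : ℝ≥0 × Lattice d) (k : Lattice d × ℝ≥0) (K : Finset (Lattice d × ℝ≥0))
    (ω : Ω) : occAt ξ i (insert k K) ω = occ {k.1 + i.2} (ξ (i.1 + k.2) ω) * occAt ξ i K ω := by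
  by_cases hk : k ∈ K
  · rw [Finset.insert_eq_of_mem hk, occAt, ← Finset.mul_prod_erase _ _ hk, ← mul_assoc, ← occ_union,
      Finset.union_self]
  · exact Finset.prod_insert hk

lemma IsVoterModel.measurable_occAt (hξ : IsVoterModel p μ P ℱ ξ) (i : ℝ≥0 × Lattice d)
    (K : Finset (Lattice d × ℝ≥0)) {t : ℝ≥0} (hK : ∀ k ∈ K, i.1 + k.2 ≤ t) :
    Measurable[ℱ t] (occAt ξ i K) := by
  refine @Finset.measurable_fun_prod _ _ _ _ _ _ (ℱ t) _ K fun k hk => ?_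
  exact (measurable_occ _).comp ((hξ.adapted _).mono (ℱ.mono (hK k hk)) le_rfl)

/-- A comparison of weighted moments at one time propagates to all products of later
occupation variables. -/
theorem IsVoterModel.moment_mul_occAt_le (hξ : IsVoterModel p μ P ℱ ξ) (hp : IsRandomWalkKernel p)
    (i j : ℝ≥0 × Lattice d) {Y Z : Ω → ℝ} (hY : Measurable[ℱ i.1] Y) (hZ : Measurable[ℱ j.1] Z)
    (hY01 : ∀ ω, Y ω ∈ Set.Icc (0 : ℝ) 1) (hZ01 : ∀ ω, Z ω ∈ Set.Icc (0 : ℝ) 1) {c r : ℝ}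
    (hc : 0 ≤ c) (hr : r ∈ Set.Icc (0 : ℝ) 1)
    (h0 : ∀ A B : Finset (Lattice d), c * r ^ B.card * moment P ξ Z j.1 (A.image (· + j.2))
      ≤ moment P ξ Y i.1 ((A ∪ B).image (· + i.2)))
    (K : Finset (Lattice d × ℝ≥0)) (t : ℝ≥0) (hK : ∀ k ∈ K, k.2 ≤ t) (A B : Finset (Lattice d)) :
    c * r ^ B.card * moment P ξ (fun ω => Z ω * occAt ξ j K ω) (j.1 + t) (A.image (· + j.2))
      ≤ moment P ξ (fun ω => Y ω * occAt ξ i K ω) (i.1 + t) ((A ∪ B).image (· + i.2)) := by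
  have flow : ∀ (l : ℝ≥0 × Lattice d) (X : Ω → ℝ), Measurable[ℱ l.1] X →
      (∀ ω, X ω ∈ Set.Icc (0 : ℝ) 1) → ∀ (K : Finset (Lattice d × ℝ≥0)) (s : ℝ≥0),
      (∀ k ∈ K, k.2 ≤ s) → IsCoalFlow p fun t A =>
        moment P ξ (fun ω => X ω * occAt ξ l K ω) (l.1 + s + t) (A.image (· + l.2)) := by
    intro l X hX hX01 K s hs
    have hm : Measurable[ℱ (l.1 + s)] fun ω => X ω * occAt ξ l K ω :=
      (hX.mono (ℱ.mono (by simp)) le_rfl).mul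
        (hξ.measurable_occAt l K fun k hk => by have := hs k hk; gcongr)
    exact (hξ.isCoalFlow_moment hp hm
      (fun ω => mul_nonneg (hX01 ω).1 (occAt_nonneg _ _ _))
      (fun ω => mul_le_one₀ (hX01 ω).2 (occAt_nonneg _ _ _) (occAt_le_one _ _ _))).translate hp l.2
  have step : ∀ (K : Finset (Lattice d × ℝ≥0)) (s t : ℝ≥0), (∀ k ∈ K, k.2 ≤ s) → s ≤ t →
      (∀ A B : Finset (Lattice d),
        c * r ^ B.card * moment P ξ (fun ω => Z ω * occAt ξ j K ω) (j.1 + s) (A.image (· + j.2))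
        ≤ moment P ξ (fun ω => Y ω * occAt ξ i K ω) (i.1 + s) ((A ∪ B).image (· + i.2))) →
      ∀ A B : Finset (Lattice d),
        c * r ^ B.card * moment P ξ (fun ω => Z ω * occAt ξ j K ω) (j.1 + t) (A.image (· + j.2))
        ≤ moment P ξ (fun ω => Y ω * occAt ξ i K ω) (i.1 + t) ((A ∪ B).image (· + i.2)) := by
    intro K s t hs hst h A B
    obtain ⟨u, rfl⟩ := exists_add_of_le hst
    have := (flow i Y hY hY01 K s hs).le_union (flow j Z hZ hZ01 K s hs) hp hc hr
      (fun A B => by simpa using h A B) u A B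
    simpa only [← add_assoc] using this
  revert t A B
  -- Space-time points are added in order of time. Between two times the comparison of flows
  -- applies; at the time of a new point its site is inserted into the set `A` on both sides.
  refine Finset.induction_on_max_value Prod.snd K ?_ ?_
  · intro t _ A B
    exact step ∅ 0 t (by simp) (zero_le) (fun A B => by simpa using h0 A B) A B
  · intro a K _ hmax ih t hK A B
    have hmax' : ∀ k ∈ insert a K, k.2 ≤ a.2 := fun k hk => by
      rcases Finset.mem_insert.1 hk with rfl | hk
      · exact le_rfl
      · exact hmax k hk
    refine step (insert a K) a.2 t hmax' (hK a (Finset.mem_insert_self a K)) (fun A B => ?_) A B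
    have e : ∀ (l : ℝ≥0 × Lattice d) (X : Ω → ℝ) (C : Finset (Lattice d)),
        moment P ξ (fun ω => X ω * occAt ξ l (insert a K) ω) (l.1 + a.2) (C.image (· + l.2))
        = moment P ξ (fun ω => X ω * occAt ξ l K ω) (l.1 + a.2) ((insert a.1 C).image (· + l.2)) := by
      intro l X C
      refine integral_congr_ae (Eventually.of_forall fun ω => ?_)
      simp only [Finset.image_insert, occAt_insert]
      rw [Finset.insert_eq, occ_union]
      ring
    rw [e, e, ← Finset.insert_union]
    exact ih a.2 (fun k hk => hmax k hk) (insert a.1 A) B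

lemma moment_empty (Z : Ω → ℝ) (t : ℝ≥0) : moment P ξ Z t ∅ = ∫ ω, Z ω ∂P := by
  simp [moment]

end Voter

/-! ### Translation invariance and positive correlations for the Bernoulli start. -/

section BernoulliStart

variable {d : ℕ} {Ω : Type*} [mΩ : MeasurableSpace Ω] {p : Lattice d → Lattice d → ℝ}
  {ρ : unitInterval} {P : Measure Ω} [IsProbabilityMeasure P] {ℱ : Filtration ℝ≥0 mΩ}
  {ξ : ℝ≥0 → Ω → Config d}

lemma IsVoterModel.moment_one_zero (hξ : IsVoterModel p (bernoulliProduct d ρ) P ℱ ξ)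
    (A : Finset (Lattice d)) : moment P ξ (fun _ => 1) 0 A = (ρ : ℝ) ^ A.card := by
  simpa [moment] using hξ.integral_occ_zero A

/-- The joint occupation probabilities are translation invariant in space. -/
theorem IsVoterModel.integral_occAt_le (hξ : IsVoterModel p (bernoulliProduct d ρ) P ℱ ξ)
    (hp : IsRandomWalkKernel p) (v w : Lattice d) (K : Finset (Lattice d × ℝ≥0)) :
    ∫ ω, occAt ξ (0, w) K ω ∂P ≤ ∫ ω, occAt ξ (0, v) K ω ∂P := by
  -- With `r = 0` the comparison is void unless `B` is empty, and then it only compares moments of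
  -- translates of the same set `A`, which agree at time `0`.
  have h := hξ.moment_mul_occAt_le hp (0, v) (0, w) (Y := fun _ => 1) (Z := fun _ => 1)
    measurable_const measurable_const (fun _ => ⟨zero_le_one, le_rfl⟩)
    (fun _ => ⟨zero_le_one, le_rfl⟩) zero_le_one (r := 0) ⟨le_rfl, zero_le_one⟩ (fun A B => ?_)
    K (K.sup Prod.snd) (fun k hk => Finset.le_sup hk) ∅ ∅
  · simpa [moment_empty] using h
  · rw [hξ.moment_one_zero, hξ.moment_one_zero,
      Finset.card_image_of_injective _ (add_left_injective _),
      Finset.card_image_of_injective _ (add_left_injective _)]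
    rcases B.eq_empty_or_nonempty with rfl | hB
    · simp
    · rw [zero_pow hB.card_pos.ne']
      have := ρ.2.1
      simp only [mul_zero, zero_mul]
      positivity

/-- Occupation variables up to time `s` and after time `s` are positively correlated, where the
latter are compared with a voter model that starts afresh. -/
theorem IsVoterModel.integral_occAt_mul_le (hξ : IsVoterModel p (bernoulliProduct d ρ) P ℱ ξ)
    (hp : IsRandomWalkKernel p) {s : ℝ≥0} (K' : Finset (Lattice d × ℝ≥0)) (hK' : ∀ k ∈ K', k.2 ≤ s)
    (K : Finset (Lattice d × ℝ≥0)) :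
    (∫ ω, occAt ξ 0 K' ω ∂P) * ∫ ω, occAt ξ 0 K ω ∂P
      ≤ ∫ ω, occAt ξ 0 K' ω * occAt ξ (s, 0) K ω ∂P := by
  have hone : ∀ ω : Ω, (fun _ => (1 : ℝ)) ω ∈ Set.Icc (0 : ℝ) 1 := fun _ => ⟨zero_le_one, le_rfl⟩
  -- Taking `r = ρ` and `A = ∅`: sites added at time `s` are occupied, jointly with the past, with
  -- at least the probability they would have if independent. At time `0` this is `ρ ^ (A.card +
  -- B.card) ≤ ρ ^ (A ∪ B).card`.
  have h1 : ∀ B : Finset (Lattice d), (ρ : ℝ) ^ B.card * ∫ ω, occAt ξ 0 K' ω ∂P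
      ≤ moment P ξ (occAt ξ 0 K') s B := by
    intro B
    have h := hξ.moment_mul_occAt_le hp 0 0 (Y := fun _ => 1) (Z := fun _ => 1)
      measurable_const measurable_const hone hone zero_le_one (r := ρ) ρ.2 (fun A B => ?_) K' s hK' ∅ B
    · simpa [moment_empty] using h
    · simp only [Prod.snd_zero, Prod.fst_zero, add_zero, Finset.image_id', one_mul]
      rw [hξ.moment_one_zero, hξ.moment_one_zero, ← pow_add]
      exact pow_le_pow_of_le_one ρ.2.1 ρ.2.2
        ((Finset.card_union_le A B).trans (add_comm _ _).le)
  -- The voter model from time `s`, weighted with the past, is compared with a fresh one from time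
  -- `0`; `h1` is the comparison of their initial moments.
  have h := hξ.moment_mul_occAt_le hp (s, 0) 0 (Y := occAt ξ 0 K') (Z := fun _ => 1)
    (hξ.measurable_occAt 0 K' fun k hk => by simpa using hK' k hk) measurable_const
    (fun ω => ⟨occAt_nonneg _ _ _, occAt_le_one _ _ _⟩) hone
    (c := ∫ ω, occAt ξ 0 K' ω ∂P) (integral_nonneg fun ω => occAt_nonneg _ _ _) (r := 0)
    ⟨le_rfl, zero_le_one⟩ (fun A B => ?_) K (K.sup Prod.snd) (fun k hk => Finset.le_sup hk) ∅ ∅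
  · simpa [moment_empty] using h
  · simp only [Prod.snd_zero, Prod.fst_zero, add_zero, Finset.image_id']
    rw [hξ.moment_one_zero]
    refine le_trans ?_ (h1 _)
    rcases B.eq_empty_or_nonempty with rfl | hB
    · simp [mul_comm]
    · rw [zero_pow hB.card_pos.ne']
      have := ρ.2.1
      have h2 : 0 ≤ ∫ ω, occAt ξ 0 K' ω ∂P := integral_nonneg fun ω => occAt_nonneg _ _ _
      simp only [mul_zero, zero_mul]
      positivity

end BernoulliStart

/-! ### Transfer of occupation inequalities to the growth solution. -/

section Transfer

variable {d : ℕ} {Ω : Type*} [mΩ : MeasurableSpace Ω] {p : Lattice d → Lattice d → ℝ}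
  {μ : Measure (Config d)} {P : Measure Ω} [IsProbabilityMeasure P] {ℱ : Filtration ℝ≥0 mΩ}
  {ξ : ℝ≥0 → Ω → Config d} {κ γ : ℝ} {g : Lattice d → ℝ}

/-- The random potential `γ ξ`, translated by `i`. -/
def pot (γ : ℝ) (ξ : ℝ≥0 → Ω → Config d) (i : ℝ≥0 × Lattice d) (ω : Ω) (x : Lattice d) (r : ℝ) : ℝ :=
  γ * occ {x + i.2} (ξ (i.1 + r.toNNReal) ω)

lemma IsVoterModel.continuousWithinAt_occ (hξ : IsVoterModel p μ P ℱ ξ) (A : Finset (Lattice d))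
    (t : ℝ≥0) (ω : Ω) (r : ℝ) :
    ContinuousWithinAt (fun s : ℝ => occ A (ξ (t + s.toNNReal) ω)) (Set.Ici r) r := by
  have h : ContinuousWithinAt (fun s : ℝ => t + s.toNNReal) (Set.Ici r) r :=
    (Continuous.continuousWithinAt (by fun_prop))
  exact (continuous_occ _).continuousAt.comp_continuousWithinAt
    (ContinuousWithinAt.comp (f := fun s : ℝ => t + s.toNNReal)
      (hξ.right_continuous ω (t + r.toNNReal)) h
      fun s hs => Set.mem_Ici.2 (add_le_add_right (Real.toNNReal_mono hs) t))

lemma IsVoterModel.measurable_uncurry_pot (hξ : IsVoterModel p μ P ℱ ξ) (γ : ℝ)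
    (i : ℝ≥0 × Lattice d) (x : Lattice d) :
    Measurable (Function.uncurry fun r ω => pot γ ξ i ω x r) := by
  refine measurable_uncurry_of_rightContinuous (fun r => ?_) fun ω r => ?_
  · exact ((measurable_occ _).comp (hξ.measurable _)).const_mul γ
  · refine ContinuousWithinAt.const_mul ?_ γ
    exact hξ.continuousWithinAt_occ _ _ ω r

lemma IsVoterModel.isPotential_pot (hξ : IsVoterModel p μ P ℱ ξ) (hγ : 0 ≤ γ)
    (i : ℝ≥0 × Lattice d) (ω : Ω) : IsPotential γ (pot γ ξ i ω) where
  nonneg x r := mul_nonneg hγ (occ_nonneg _ _)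
  le x r := mul_le_of_le_one_right hγ (occ_le_one _ _)
  measurable x := (hξ.measurable_uncurry_pot γ i x).comp measurable_prodMk_right
  right_continuous x r := by
    refine ContinuousWithinAt.const_mul ?_ γ
    exact hξ.continuousWithinAt_occ _ _ ω r

lemma measurable_intervalIntegral {f : ℝ → Ω → ℝ} (hf : Measurable (Function.uncurry f)) (a b : ℝ) :
    Measurable fun ω => ∫ r in a..b, f r ω := by
  have h : Measurable fun q : Ω × ℝ => f q.2 q.1 := hf.comp measurable_swap
  simp only [intervalIntegral]
  exact (h.stronglyMeasurable.integral_prod_right).measurable.sub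
    (h.stronglyMeasurable.integral_prod_right).measurable

lemma integrable_prod_of_abs_le {f : ℝ → Ω → ℝ} {t : ℝ} (ht : 0 ≤ t)
    (hf : Measurable (Function.uncurry f)) {C : ℝ} (hC : ∀ r ∈ Set.Icc 0 t, ∀ ω, |f r ω| ≤ C) :
    Integrable (Function.uncurry f) ((volume.restrict (Set.uIoc 0 t)).prod P) := by
  rw [Set.uIoc_of_le ht]
  refine Integrable.of_bound hf.aestronglyMeasurable C ?_
  have : ∀ᵐ q ∂((volume.restrict (Set.Ioc 0 t)).prod P), q.1 ∈ Set.Ioc 0 t :=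
    Measure.quasiMeasurePreserving_fst.ae (ae_restrict_mem measurableSet_Ioc)
  filter_upwards [this] with q hq
  exact hC q.1 ⟨hq.1.le, hq.2⟩ q.2

lemma IsVoterModel.measurable_uncurry_picard (hξ : IsVoterModel p μ P ℱ ξ) (hγ : 0 ≤ γ) (κ : ℝ)
    (i : ℝ≥0 × Lattice d) (g : Lattice d → ℝ) (n : ℕ) (x : Lattice d) :
    Measurable (Function.uncurry fun r ω => picard κ (pot γ ξ i ω) g n x r) := by
  induction n generalizing x with
  | zero => exact measurable_const
  | succ n ih =>
    refine measurable_uncurry_of_rightContinuous (fun r => ?_) fun ω r =>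
      ((hξ.isPotential_pot hγ i ω).continuous_picard g (n + 1) x).continuousWithinAt
    refine measurable_intervalIntegral ?_ 0 r
    exact ((Finset.measurable_fun_sum _ fun k _ => ih (nb k x)).const_mul κ).add
      ((hξ.measurable_uncurry_pot γ i x).mul (ih x))

lemma IsVoterModel.measurable_picard (hξ : IsVoterModel p μ P ℱ ξ) (hγ : 0 ≤ γ) (κ : ℝ)
    (i : ℝ≥0 × Lattice d) (g : Lattice d → ℝ) (n : ℕ) (x : Lattice d) (r : ℝ) :
    Measurable fun ω => picard κ (pot γ ξ i ω) g n x r :=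
  (hξ.measurable_uncurry_picard hγ κ i g n x).comp measurable_prodMk_left

lemma IsVoterModel.tendsto_sum_picard (hξ : IsVoterModel p μ P ℱ ξ) (hγ : 0 ≤ γ) (hκ : 0 ≤ κ)
    (hg : IsDatum g) (i : ℝ≥0 × Lattice d) (ω : Ω) (x : Lattice d) {r : ℝ} (hr : 0 ≤ r) :
    Tendsto (fun N => ∑ n ∈ Finset.range N, picard κ (pot γ ξ i ω) g n x r) atTop
      (𝓝 (growth κ (pot γ ξ i ω) g x r)) :=
  ((hξ.isPotential_pot hγ i ω).summable_picard hκ hg x hr).hasSum.tendsto_sum_nat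

lemma IsVoterModel.measurable_growth (hξ : IsVoterModel p μ P ℱ ξ) (hγ : 0 ≤ γ) (hκ : 0 ≤ κ)
    (hg : IsDatum g) (i : ℝ≥0 × Lattice d) (x : Lattice d) {r : ℝ} (hr : 0 ≤ r) :
    Measurable fun ω => growth κ (pot γ ξ i ω) g x r :=
  measurable_of_tendsto_metrizable
    (fun _ => Finset.measurable_fun_sum _ fun n _ => hξ.measurable_picard hγ κ i g n x r)
    (tendsto_pi_nhds.2 fun ω => hξ.tendsto_sum_picard hγ hκ hg i ω x hr)

/-- `F` has larger expectations than `G` against all occupation variables up to time `T`, with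
respect to the translates by `i` and `j`. -/
structure OccDominates (P : Measure Ω) (ξ : ℝ≥0 → Ω → Config d) (T : ℝ≥0) (i j : ℝ≥0 × Lattice d)
    (F G : Ω → ℝ) : Prop where
  measurable_left : Measurable F
  measurable_right : Measurable G
  bounded : ∃ C, ∀ ω, |F ω| ≤ C ∧ |G ω| ≤ C
  le : ∀ K : Finset (Lattice d × ℝ≥0), (∀ k ∈ K, k.2 ≤ T) →
    ∫ ω, occAt ξ j K ω * G ω ∂P ≤ ∫ ω, occAt ξ i K ω * F ω ∂P

lemma IsVoterModel.integrable_occAt_mul (hξ : IsVoterModel p μ P ℱ ξ) (i : ℝ≥0 × Lattice d)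
    (K : Finset (Lattice d × ℝ≥0)) {F : Ω → ℝ} (hF : Measurable F) {C : ℝ} (hC : ∀ ω, |F ω| ≤ C) :
    Integrable (fun ω => occAt ξ i K ω * F ω) P := by
  have hm : Measurable (occAt ξ i K) :=
    Finset.measurable_fun_prod _ fun k _ => (measurable_occ _).comp (hξ.measurable _)
  refine integrable_of_abs_le (hm.mul hF).aestronglyMeasurable (C := C) fun ω => ?_
  rw [abs_mul, abs_of_nonneg (occAt_nonneg _ _ _)]
  exact (mul_le_of_le_one_left (abs_nonneg _) (occAt_le_one _ _ _)).trans (hC ω)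

variable {T : ℝ≥0} {i j : ℝ≥0 × Lattice d} {F G F' G' : Ω → ℝ}

lemma OccDominates.add (h : OccDominates P ξ T i j F G) (h' : OccDominates P ξ T i j F' G')
    (hξ : IsVoterModel p μ P ℱ ξ) :
    OccDominates P ξ T i j (fun ω => F ω + F' ω) (fun ω => G ω + G' ω) := by
  obtain ⟨C, hC⟩ := h.bounded
  obtain ⟨C', hC'⟩ := h'.bounded
  refine ⟨h.measurable_left.add h'.measurable_left, h.measurable_right.add h'.measurable_right,
    ⟨C + C', fun ω => ⟨(abs_add_le _ _).trans (add_le_add (hC ω).1 (hC' ω).1),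
      (abs_add_le _ _).trans (add_le_add (hC ω).2 (hC' ω).2)⟩⟩, fun K hK => ?_⟩
  simp only [mul_add]
  rw [integral_add (hξ.integrable_occAt_mul j K h.measurable_right fun ω => (hC ω).2)
      (hξ.integrable_occAt_mul j K h'.measurable_right fun ω => (hC' ω).2),
    integral_add (hξ.integrable_occAt_mul i K h.measurable_left fun ω => (hC ω).1)
      (hξ.integrable_occAt_mul i K h'.measurable_left fun ω => (hC' ω).1)]
  exact add_le_add (h.le K hK) (h'.le K hK)

lemma OccDominates.const_mul (h : OccDominates P ξ T i j F G) {c : ℝ} (hc : 0 ≤ c) :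
    OccDominates P ξ T i j (fun ω => c * F ω) (fun ω => c * G ω) := by
  obtain ⟨C, hC⟩ := h.bounded
  refine ⟨h.measurable_left.const_mul c, h.measurable_right.const_mul c, ⟨c * C, fun ω => ?_⟩,
    fun K hK => ?_⟩
  · rw [abs_mul, abs_mul, abs_of_nonneg hc]
    exact ⟨mul_le_mul_of_nonneg_left (hC ω).1 hc, mul_le_mul_of_nonneg_left (hC ω).2 hc⟩
  · simp only [mul_left_comm _ c]
    rw [integral_const_mul, integral_const_mul]
    exact mul_le_mul_of_nonneg_left (h.le K hK) hc

lemma OccDominates.zero : OccDominates P ξ T i j (fun _ => 0) (fun _ => 0) :=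
  ⟨measurable_const, measurable_const, ⟨0, by simp⟩, by simp⟩

lemma OccDominates.sum {ι : Type*} (s : Finset ι) {f g : ι → Ω → ℝ}
    (h : ∀ a ∈ s, OccDominates P ξ T i j (f a) (g a)) (hξ : IsVoterModel p μ P ℱ ξ) :
    OccDominates P ξ T i j (fun ω => ∑ a ∈ s, f a ω) (fun ω => ∑ a ∈ s, g a ω) := by
  classical
  induction s using Finset.induction_on with
  | empty => simpa using OccDominates.zero
  | insert a s ha ih =>
    simp only [Finset.sum_insert ha]
    exact (h a (Finset.mem_insert_self a s)).add
      (ih fun b hb => h b (Finset.mem_insert_of_mem hb)) hξ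

/-- Testing against all products of occupation variables makes the relation stable here: the extra
factor is absorbed into the test set `K`. -/
lemma OccDominates.mul_occ (h : OccDominates P ξ T i j F G) (hξ : IsVoterModel p μ P ℱ ξ)
    (x : Lattice d) {r : ℝ≥0} (hr : r ≤ T) :
    OccDominates P ξ T i j (fun ω => occ {x + i.2} (ξ (i.1 + r) ω) * F ω)
      (fun ω => occ {x + j.2} (ξ (j.1 + r) ω) * G ω) := by
  obtain ⟨C, hC⟩ := h.bounded
  have hb : ∀ (A : Finset (Lattice d)) η (a : ℝ), |occ A η * a| ≤ |a| := fun A η a => by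
    rw [abs_mul, abs_of_nonneg (occ_nonneg _ _)]
    exact mul_le_of_le_one_left (abs_nonneg _) (occ_le_one _ _)
  refine ⟨((measurable_occ _).comp (hξ.measurable _)).mul h.measurable_left,
    ((measurable_occ _).comp (hξ.measurable _)).mul h.measurable_right,
    ⟨C, fun ω => ⟨(hb _ _ _).trans (hC ω).1, (hb _ _ _).trans (hC ω).2⟩⟩, fun K hK => ?_⟩
  have := h.le (insert (x, r) K) fun k hk => by
    rcases Finset.mem_insert.1 hk with rfl | hk
    · exact hr
    · exact hK k hk
  simp only [occAt_insert] at this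
  simpa only [mul_assoc, mul_left_comm, mul_comm] using this

lemma OccDominates.of_tendsto {f g : ℕ → Ω → ℝ} (hξ : IsVoterModel p μ P ℱ ξ)
    (h : ∀ n, OccDominates P ξ T i j (f n) (g n)) {C : ℝ}
    (hC : ∀ n ω, |f n ω| ≤ C ∧ |g n ω| ≤ C) (hf : ∀ ω, Tendsto (fun n => f n ω) atTop (𝓝 (F ω)))
    (hg : ∀ ω, Tendsto (fun n => g n ω) atTop (𝓝 (G ω))) : OccDominates P ξ T i j F G := by
  refine ⟨measurable_of_tendsto_metrizable (fun n => (h n).measurable_left) (tendsto_pi_nhds.2 hf),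
    measurable_of_tendsto_metrizable (fun n => (h n).measurable_right) (tendsto_pi_nhds.2 hg),
    ⟨C, fun ω => ⟨le_of_tendsto' (hf ω).abs fun n => (hC n ω).1,
      le_of_tendsto' (hg ω).abs fun n => (hC n ω).2⟩⟩, fun K hK => ?_⟩
  have hlim : ∀ (l : ℝ≥0 × Lattice d) (f : ℕ → Ω → ℝ) (F : Ω → ℝ), (∀ n, Measurable (f n)) →
      (∀ n ω, |f n ω| ≤ C) → (∀ ω, Tendsto (fun n => f n ω) atTop (𝓝 (F ω))) →
      Tendsto (fun n => ∫ ω, occAt ξ l K ω * f n ω ∂P) atTop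
        (𝓝 (∫ ω, occAt ξ l K ω * F ω ∂P)) := by
    intro l f F hm hb ht
    refine tendsto_integral_of_dominated_convergence (fun _ => C) (fun n =>
      (hξ.integrable_occAt_mul l K (hm n) (hb n)).aestronglyMeasurable) (integrable_const C)
      (fun n => Eventually.of_forall fun ω => ?_) (Eventually.of_forall fun ω => (ht ω).const_mul _)
    rw [Real.norm_eq_abs, abs_mul, abs_of_nonneg (occAt_nonneg _ _ _)]
    exact (mul_le_of_le_one_left (abs_nonneg _) (occAt_le_one _ _ _)).trans (hb n ω)
  exact le_of_tendsto_of_tendsto'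
    (hlim j g G (fun n => (h n).measurable_right) (fun n ω => (hC n ω).2) hg)
    (hlim i f F (fun n => (h n).measurable_left) (fun n ω => (hC n ω).1) hf)
    fun n => (h n).le K hK

lemma OccDominates.intervalIntegral {f g : ℝ → Ω → ℝ} (hξ : IsVoterModel p μ P ℱ ξ) {t : ℝ}
    (ht : 0 ≤ t) (hf : Measurable (Function.uncurry f)) (hg : Measurable (Function.uncurry g)) {C : ℝ}
    (hC : ∀ r ∈ Set.Icc 0 t, ∀ ω, |f r ω| ≤ C ∧ |g r ω| ≤ C)
    (h : ∀ r ∈ Set.Icc 0 t, OccDominates P ξ T i j (f r) (g r)) :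
    OccDominates P ξ T i j (fun ω => ∫ r in (0 : ℝ)..t, f r ω) fun ω => ∫ r in (0 : ℝ)..t, g r ω := by
  have hb : ∀ f : ℝ → Ω → ℝ, (∀ r ∈ Set.Icc 0 t, ∀ ω, |f r ω| ≤ C) → ∀ ω,
      |∫ r in (0 : ℝ)..t, f r ω| ≤ C * t := by
    intro f hf ω
    have := intervalIntegral.norm_integral_le_of_norm_le_const (a := 0) (b := t)
      (f := fun r => f r ω) (C := C) fun r hr => by
        rw [Set.uIoc_of_le ht] at hr
        exact hf r ⟨hr.1.le, hr.2⟩ ω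
    rwa [sub_zero, abs_of_nonneg ht] at this
  refine ⟨measurable_intervalIntegral hf 0 t, measurable_intervalIntegral hg 0 t,
    ⟨C * t, fun ω => ⟨hb f (fun r hr ω => (hC r hr ω).1) ω,
      hb g (fun r hr ω => (hC r hr ω).2) ω⟩⟩, fun K hK => ?_⟩
  have hint : ∀ (l : ℝ≥0 × Lattice d) (f : ℝ → Ω → ℝ), Measurable (Function.uncurry f) →
      (∀ r ∈ Set.Icc 0 t, ∀ ω, |f r ω| ≤ C) → Integrable (Function.uncurry fun r ω =>
        occAt ξ l K ω * f r ω) ((volume.restrict (Set.uIoc 0 t)).prod P) := by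
    intro l f hf hb
    have hm : Measurable (occAt ξ l K) :=
      Finset.measurable_fun_prod _ fun k _ => (measurable_occ _).comp (hξ.measurable _)
    refine integrable_prod_of_abs_le ht ((hm.comp measurable_snd).mul hf) (C := C) fun r hr ω => ?_
    rw [abs_mul, abs_of_nonneg (occAt_nonneg _ _ _)]
    exact (mul_le_of_le_one_left (abs_nonneg _) (occAt_le_one _ _ _)).trans (hb r hr ω)
  have hswap : ∀ (l : ℝ≥0 × Lattice d) (f : ℝ → Ω → ℝ), Measurable (Function.uncurry f) →
      (∀ r ∈ Set.Icc 0 t, ∀ ω, |f r ω| ≤ C) →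
      ∫ ω, occAt ξ l K ω * (∫ r in (0 : ℝ)..t, f r ω) ∂P
        = ∫ r in (0 : ℝ)..t, ∫ ω, occAt ξ l K ω * f r ω ∂P := by
    intro l f hf hb
    rw [MeasureTheory.intervalIntegral_integral_swap (hint l f hf hb)]
    simp only [intervalIntegral.integral_const_mul]
  have hii : ∀ (l : ℝ≥0 × Lattice d) (f : ℝ → Ω → ℝ), Measurable (Function.uncurry f) →
      (∀ r ∈ Set.Icc 0 t, ∀ ω, |f r ω| ≤ C) →
      IntervalIntegrable (fun r => ∫ ω, occAt ξ l K ω * f r ω ∂P) volume 0 t := by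
    intro l f hf hb
    rw [intervalIntegrable_iff]
    exact (hint l f hf hb).integral_prod_left
  rw [hswap j g hg fun r hr ω => (hC r hr ω).2, hswap i f hf fun r hr ω => (hC r hr ω).1]
  exact intervalIntegral.integral_mono_on ht (hii j g hg fun r hr ω => (hC r hr ω).2)
    (hii i f hf fun r hr ω => (hC r hr ω).1) fun r hr => (h r hr).le K hK

/-- Picard iterates arise from nonnegative constants by sums, nonnegative multiples, products with
occupation variables and time integrals, and each of these operations preserves domination. -/
lemma OccDominates.mul_picard (h : OccDominates P ξ T i j F G) (hξ : IsVoterModel p μ P ℱ ξ)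
    (hγ : 0 ≤ γ) (hκ : 0 ≤ κ) (hg : IsDatum g) (n : ℕ) (x : Lattice d) {t : ℝ} (ht : 0 ≤ t)
    (htT : t ≤ T) : OccDominates P ξ T i j (fun ω => picard κ (pot γ ξ i ω) g n x t * F ω)
      (fun ω => picard κ (pot γ ξ j ω) g n x t * G ω) := by
  induction n generalizing x t with
  | zero => exact h.const_mul (hg.nonneg x)
  | succ n ih =>
    obtain ⟨C, hC⟩ := h.bounded
    have hrate : ∀ (l : ℝ≥0 × Lattice d), Measurable (Function.uncurry fun r ω =>
        growthRate κ (pot γ ξ l ω) (picard κ (pot γ ξ l ω) g n) x r) := fun l =>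
      ((Finset.measurable_fun_sum _ fun k _ =>
        hξ.measurable_uncurry_picard hγ κ l g n (nb k x)).const_mul κ).add
        ((hξ.measurable_uncurry_pot γ l x).mul (hξ.measurable_uncurry_picard hγ κ l g n x))
    have hbound : ∀ (l : ℝ≥0 × Lattice d) (H : Ω → ℝ), (∀ ω, |H ω| ≤ C) → ∀ r ∈ Set.Icc 0 t, ∀ ω,
        |growthRate κ (pot γ ξ l ω) (picard κ (pot γ ξ l ω) g n) x r * H ω|
          ≤ (2 * d * κ + γ) * (((2 * d * κ + γ) * t) ^ n / n.factorial) * C := by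
      intro l H hH r hr ω
      have hV := hξ.isPotential_pot hγ l ω
      have hb : ∀ y, picard κ (pot γ ξ l ω) g n y r ≤ ((2 * d * κ + γ) * t) ^ n / n.factorial :=
        fun y => (le_abs_self _).trans (hV.abs_picard_le hκ hg n y hr.1 hr.2)
      have h0 := growthRate_nonneg hκ hV (fun y => hV.picard_nonneg hκ hg.nonneg n y hr.1) x
      have h1 := mul_le_mul_of_nonneg_left (nbSum_le hb x) hκ
      have h2 := mul_le_mul (hV.le x r) (hb x) (hV.picard_nonneg hκ hg.nonneg n x hr.1) hγ
      have h3 : growthRate κ (pot γ ξ l ω) (picard κ (pot γ ξ l ω) g n) x r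
          ≤ (2 * d * κ + γ) * (((2 * d * κ + γ) * t) ^ n / n.factorial) := by
        simp only [growthRate]
        linarith
      rw [abs_mul, abs_of_nonneg h0]
      exact mul_le_mul h3 (hH ω) (abs_nonneg _) (h0.trans h3)
    simp only [picard, ← intervalIntegral.integral_mul_const]
    refine OccDominates.intervalIntegral hξ ht ((hrate i).mul (h.measurable_left.comp measurable_snd))
      ((hrate j).mul (h.measurable_right.comp measurable_snd))
      (fun r hr ω => ⟨hbound i F (fun ω => (hC ω).1) r hr ω, hbound j G (fun ω => (hC ω).2) r hr ω⟩)
      fun r hr => ?_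
    have hrT : r ≤ T := hr.2.trans htT
    have h1 := ((OccDominates.sum (Finset.univ) (fun k _ => ih (nb k x) hr.1 hrT) hξ).const_mul hκ).add
      (((ih x hr.1 hrT).mul_occ hξ x (r := r.toNNReal)
        (Real.toNNReal_le_iff_le_coe.2 hrT)).const_mul hγ) hξ
    simpa only [growthRate, nbSum, pot, add_mul, Finset.sum_mul, mul_assoc] using h1

lemma OccDominates.mul_growth (h : OccDominates P ξ T i j F G) (hξ : IsVoterModel p μ P ℱ ξ)
    (hγ : 0 ≤ γ) (hκ : 0 ≤ κ) (hg : IsDatum g) (x : Lattice d) {t : ℝ} (ht : 0 ≤ t) (htT : t ≤ T) :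
    OccDominates P ξ T i j (fun ω => growth κ (pot γ ξ i ω) g x t * F ω)
      (fun ω => growth κ (pot γ ξ j ω) g x t * G ω) := by
  obtain ⟨C, hC⟩ := h.bounded
  have hb : ∀ (l : ℝ≥0 × Lattice d) (H : Ω → ℝ), (∀ ω, |H ω| ≤ C) → ∀ (N : ℕ) ω,
      |(∑ n ∈ Finset.range N, picard κ (pot γ ξ l ω) g n x t) * H ω|
        ≤ Real.exp ((2 * d * κ + γ) * t) * C := by
    intro l H hH N ω
    have hV := hξ.isPotential_pot hγ l ω
    have h0 : ∀ n, 0 ≤ picard κ (pot γ ξ l ω) g n x t := fun n => hV.picard_nonneg hκ hg.nonneg n x ht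
    rw [abs_mul, abs_of_nonneg (Finset.sum_nonneg fun n _ => h0 n)]
    refine mul_le_mul ?_ (hH ω) (abs_nonneg _) (Real.exp_pos _).le
    exact ((hV.summable_picard hκ hg x ht).sum_le_tsum _ fun n _ => h0 n).trans
      (hV.growth_le hκ hg x ht)
  refine OccDominates.of_tendsto hξ (fun N => ?_) (fun N ω => ⟨hb i F (fun ω => (hC ω).1) N ω,
    hb j G (fun ω => (hC ω).2) N ω⟩) (fun ω => (hξ.tendsto_sum_picard hγ hκ hg i ω x ht).mul_const _)
    (fun ω => (hξ.tendsto_sum_picard hγ hκ hg j ω x ht).mul_const _)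
  simp only [Finset.sum_mul]
  exact OccDominates.sum _ (fun n _ => h.mul_picard hξ hγ hκ hg n x ht htT) hξ

lemma OccDominates.mul_growth_pow (h : OccDominates P ξ T i j F G) (hξ : IsVoterModel p μ P ℱ ξ)
    (hγ : 0 ≤ γ) (hκ : 0 ≤ κ) (hg : IsDatum g) (x : Lattice d) {t : ℝ} (ht : 0 ≤ t) (htT : t ≤ T)
    (q : ℕ) : OccDominates P ξ T i j (fun ω => growth κ (pot γ ξ i ω) g x t ^ q * F ω)
      (fun ω => growth κ (pot γ ξ j ω) g x t ^ q * G ω) := by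
  induction q with
  | zero => simpa using h
  | succ q ih =>
    simp only [pow_succ', mul_assoc]
    exact ih.mul_growth hξ hγ hκ hg x ht htT

end Transfer

/-! ### Translation invariance and positive correlation of the moments. -/

section Correlation

variable {d : ℕ} {Ω : Type*} [mΩ : MeasurableSpace Ω] {p : Lattice d → Lattice d → ℝ}
  {ρ : unitInterval} {P : Measure Ω} [IsProbabilityMeasure P] {ℱ : Filtration ℝ≥0 mΩ}
  {ξ : ℝ≥0 → Ω → Config d} {κ γ : ℝ} {g : Lattice d → ℝ}

lemma IsVoterModel.integral_growth_pow_translate (hξ : IsVoterModel p (bernoulliProduct d ρ) P ℱ ξ)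
    (hp : IsRandomWalkKernel p) (hγ : 0 ≤ γ) (hκ : 0 ≤ κ) (hg : IsDatum g) (q : ℕ) (v x : Lattice d)
    {t : ℝ} (ht : 0 ≤ t) :
    ∫ ω, growth κ (pot γ ξ (0, v) ω) g x t ^ q ∂P = ∫ ω, growth κ (pot γ ξ 0 ω) g x t ^ q ∂P := by
  have h : ∀ v w : Lattice d, ∫ ω, growth κ (pot γ ξ (0, w) ω) g x t ^ q ∂P
      ≤ ∫ ω, growth κ (pot γ ξ (0, v) ω) g x t ^ q ∂P := by
    intro v w
    have h1 : OccDominates P ξ t.toNNReal (0, v) (0, w) (fun _ => 1) (fun _ => 1) :=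
      ⟨measurable_const, measurable_const, ⟨1, by simp⟩, fun K _ => by
        simpa using hξ.integral_occAt_le hp v w K⟩
    simpa using (h1.mul_growth_pow hξ hγ hκ hg x ht (Real.le_coe_toNNReal t) q).le ∅ (by simp)
  exact le_antisymm (h 0 v) (h v 0)

/-- The correlation inequality for two families of occupation variables is transferred one family at
a time: first the later one becomes a power of the shifted growth solution, then the earlier one a
power of the unshifted solution. -/
lemma IsVoterModel.integral_growth_pow_mul_le (hξ : IsVoterModel p (bernoulliProduct d ρ) P ℱ ξ)
    (hp : IsRandomWalkKernel p) (hγ : 0 ≤ γ) (hκ : 0 ≤ κ) (q : ℕ) {g' : Lattice d → ℝ}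
    (hg : IsDatum g) (hg' : IsDatum g') (x y : Lattice d) {s t : ℝ} (hs : 0 ≤ s) (ht : 0 ≤ t) :
    (∫ ω, growth κ (pot γ ξ 0 ω) g x t ^ q ∂P) * ∫ ω, growth κ (pot γ ξ 0 ω) g' y s ^ q ∂P
      ≤ ∫ ω, growth κ (pot γ ξ 0 ω) g x t ^ q
        * growth κ (pot γ ξ (t.toNNReal, 0) ω) g' y s ^ q ∂P := by
  have hpos : ∀ i ω, 0 ≤ growth κ (pot γ ξ i ω) g' y s ^ q := fun i ω =>
    pow_nonneg ((hξ.isPotential_pot hγ i ω).growth_nonneg hκ hg' y hs) q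
  have hle : ∀ i ω, growth κ (pot γ ξ i ω) g' y s ^ q ≤ Real.exp ((2 * d * κ + γ) * s) ^ q :=
    fun i ω => pow_le_pow_left₀ ((hξ.isPotential_pot hγ i ω).growth_nonneg hκ hg' y hs)
      ((hξ.isPotential_pot hγ i ω).growth_le hκ hg' y hs) q
  have hm : ∀ i, Measurable fun ω => growth κ (pot γ ξ i ω) g' y s ^ q := fun i =>
    (hξ.measurable_growth hγ hκ hg' i y hs).pow_const q
  set c := ∫ ω, growth κ (pot γ ξ 0 ω) g' y s ^ q ∂P with hc
  have h1 : OccDominates P ξ t.toNNReal 0 0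
      (fun ω => growth κ (pot γ ξ (t.toNNReal, 0) ω) g' y s ^ q) (fun _ => c) := by
    refine ⟨hm _, measurable_const, ⟨max (Real.exp ((2 * d * κ + γ) * s) ^ q) |c|, fun ω => ⟨?_, ?_⟩⟩,
      fun K hK => ?_⟩
    · rw [abs_of_nonneg (hpos _ ω)]
      exact (hle _ ω).trans (le_max_left _ _)
    · exact le_max_right _ _
    · have hoc : Measurable (occAt ξ 0 K) :=
        Finset.measurable_fun_prod _ fun k _ => (measurable_occ _).comp (hξ.measurable _)
      -- The earlier test set `K` is frozen here and serves as the weight; its expectation is the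
      -- constant on the other side.
      have h2 : OccDominates P ξ s.toNNReal (t.toNNReal, 0) 0 (occAt ξ 0 K)
          (fun _ => ∫ ω, occAt ξ 0 K ω ∂P) := by
        refine ⟨hoc, measurable_const, ⟨max 1 |∫ ω, occAt ξ 0 K ω ∂P|, fun ω => ⟨?_, ?_⟩⟩,
          fun K' _ => ?_⟩
        · rw [abs_of_nonneg (occAt_nonneg _ _ _)]
          exact (occAt_le_one _ _ _).trans (le_max_left _ _)
        · exact le_max_right _ _
        · rw [integral_mul_const, mul_comm]
          refine (hξ.integral_occAt_mul_le hp K hK K').trans (le_of_eq ?_)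
          exact integral_congr_ae (Eventually.of_forall fun ω => mul_comm _ _)
      have h3 := (h2.mul_growth_pow hξ hγ hκ hg' y hs (Real.le_coe_toNNReal s) q).le ∅ (by simp)
      simp only [occAt_empty, one_mul] at h3
      rw [integral_mul_const] at h3
      rw [integral_mul_const, mul_comm]
      refine h3.trans (le_of_eq ?_)
      exact integral_congr_ae (Eventually.of_forall fun ω => mul_comm _ _)
  have h4 := (h1.mul_growth_pow hξ hγ hκ hg x ht (Real.le_coe_toNNReal t) q).le ∅ (by simp)
  simp only [occAt_empty, one_mul] at h4
  rwa [integral_mul_const] at h4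

end Correlation

/-! ### Superadditivity and elementary inequalities for the growth rate. -/

section Fekete

/-- Fekete's lemma for nonnegative superadditive functions on the half-line. -/
lemma exists_tendsto_div_of_superadditive {b : ℝ → ℝ} {C : ℝ} (h0 : ∀ t, 0 ≤ t → 0 ≤ b t)
    (hC : ∀ t, 0 ≤ t → b t ≤ C * t)
    (hadd : ∀ s t, 0 ≤ s → 0 ≤ t → b s + b t ≤ b (s + t)) :
    ∃ l, Tendsto (fun t => b t / t) atTop (𝓝 l) := by
  have hmono : ∀ s t, 0 ≤ s → s ≤ t → b s ≤ b t := by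
    intro s t hs hst
    have h1 := hadd s (t - s) hs (sub_nonneg.2 hst)
    rw [add_sub_cancel] at h1
    linarith [h0 (t - s) (sub_nonneg.2 hst)]
  have hsub : Subadditive fun n : ℕ => -b n := fun m n => by
    have := hadd m n (Nat.cast_nonneg _) (Nat.cast_nonneg _)
    push_cast
    linarith
  have hbdd : BddBelow (Set.range fun n : ℕ => -b n / n) := by
    refine ⟨-C, ?_⟩
    rintro _ ⟨n, rfl⟩
    rcases n.eq_zero_or_pos with rfl | hn
    · have h1 := hC 1 zero_le_one
      have h2 := h0 1 zero_le_one
      simp only [CharP.cast_eq_zero, div_zero]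
      linarith
    · have hn' : (0 : ℝ) < n := by exact_mod_cast hn
      rw [le_div_iff₀ hn']
      linarith [hC n hn'.le]
  have hlim : Tendsto (fun n : ℕ => b n / n) atTop (𝓝 (-hsub.lim)) := by
    refine (hsub.tendsto_lim hbdd).neg.congr fun n => ?_
    ring
  have hfl : Tendsto (fun t : ℝ => ⌊t⌋₊) atTop atTop := tendsto_nat_floor_atTop
  have hlow : Tendsto (fun t : ℝ => b ⌊t⌋₊ / ⌊t⌋₊ * (⌊t⌋₊ / t)) atTop (𝓝 (-hsub.lim * 1)) :=
    (hlim.comp hfl).mul tendsto_nat_floor_div_atTop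
  have hup : Tendsto (fun t : ℝ => b (⌊t⌋₊ + 1 : ℕ) / (⌊t⌋₊ + 1 : ℕ) * (⌊t⌋₊ / t + 1 / t)) atTop
      (𝓝 (-hsub.lim * (1 + 0))) := by
    refine ((hlim.comp (tendsto_add_atTop_nat 1)).comp hfl).mul
      (tendsto_nat_floor_div_atTop.add ?_)
    exact (tendsto_inv_atTop_zero (𝕜 := ℝ)).congr fun t => (one_div t).symm
  rw [mul_one] at hlow
  rw [add_zero, mul_one] at hup
  refine ⟨_, tendsto_of_tendsto_of_tendsto_of_le_of_le' hlow hup ?_ ?_⟩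
  · filter_upwards [eventually_ge_atTop 1] with t ht
    have hn : (0 : ℝ) < ⌊t⌋₊ := by exact_mod_cast Nat.floor_pos.2 ht
    have ht0 : 0 < t := by linarith
    have e : b ⌊t⌋₊ / ⌊t⌋₊ * (⌊t⌋₊ / t) = b ⌊t⌋₊ / t := by field_simp
    rw [e]
    exact div_le_div_of_nonneg_right (hmono _ _ hn.le (Nat.floor_le ht0.le)) ht0.le
  · filter_upwards [eventually_ge_atTop 1] with t ht
    have ht0 : 0 < t := by linarith
    have e : b (⌊t⌋₊ + 1 : ℕ) / (⌊t⌋₊ + 1 : ℕ) * (⌊t⌋₊ / t + 1 / t) = b (⌊t⌋₊ + 1 : ℕ) / t := by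
      push_cast
      field_simp
    rw [e]
    refine div_le_div_of_nonneg_right (hmono _ _ ht0.le ?_) ht0.le
    push_cast
    exact (Nat.lt_floor_add_one t).le

lemma sum_pow_le_pow_sum {ι : Type*} (s : Finset ι) {f : ι → ℝ} (hf : ∀ i ∈ s, 0 ≤ f i) (n : ℕ) :
    ∑ i ∈ s, f i ^ (n + 1) ≤ (∑ i ∈ s, f i) ^ (n + 1) := by
  rw [pow_succ (∑ i ∈ s, f i), Finset.mul_sum]
  refine Finset.sum_le_sum fun i hi => ?_
  rw [pow_succ]
  exact mul_le_mul_of_nonneg_right (pow_le_pow_left₀ (hf i hi) (Finset.single_le_sum hf hi) n)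
    (hf i hi)

/-- Convolution bounds make the total mass supermultiplicative. -/
lemma tsum_mul_tsum_le_of_convolution {E : Type*} [AddCommGroup E] {a b c : E → ℝ}
    (ha0 : ∀ z, 0 ≤ a z) (hb0 : ∀ z, 0 ≤ b z) (hb : Summable b) (hc : Summable c)
    (h : ∀ (Y : Finset E) z, ∑ y ∈ Y, a y * b (z - y) ≤ c z) :
    (∑' z, a z) * ∑' z, b z ≤ ∑' z, c z := by
  rw [← tsum_mul_right]
  refine Real.tsum_le_of_sum_le (fun z => mul_nonneg (ha0 z) (tsum_nonneg hb0)) fun Y => ?_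
  have hs : ∀ y, Summable fun z => a y * b (z - y) := fun y =>
    (((Equiv.subRight y).summable_iff).2 hb).mul_left _
  calc ∑ y ∈ Y, a y * ∑' z, b z = ∑ y ∈ Y, ∑' z, a y * b (z - y) := by
        refine Finset.sum_congr rfl fun y _ => ?_
        rw [tsum_mul_left]
        congr 1
        exact ((Equiv.subRight y).tsum_eq b).symm
    _ = ∑' z, ∑ y ∈ Y, a y * b (z - y) := (Summable.tsum_finsetSum fun y _ => hs y).symm
    _ ≤ ∑' z, c z := (summable_sum fun y _ => hs y).tsum_le_tsum (h Y) hc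

lemma tendsto_log_linear_div {K : ℝ} (hK : 0 ≤ K) :
    Tendsto (fun t => Real.log (K * t + 3) / t) atTop (𝓝 0) := by
  have h1 : Tendsto (fun t : ℝ => Real.log (K + 3) / t + Real.log t / t) atTop (𝓝 (0 + 0)) :=
    (tendsto_const_nhds.div_atTop tendsto_id).add Real.isLittleO_log_id_atTop.tendsto_div_nhds_zero
  rw [add_zero] at h1
  refine tendsto_of_tendsto_of_tendsto_of_le_of_le' tendsto_const_nhds h1 ?_ ?_
  · filter_upwards [eventually_ge_atTop 1] with t ht
    have : 0 ≤ K * t := by positivity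
    exact div_nonneg (Real.log_nonneg (by linarith)) (by linarith)
  · filter_upwards [eventually_ge_atTop 1] with t ht
    rw [← add_div, ← Real.log_mul (by positivity) (by positivity)]
    refine div_le_div_of_nonneg_right (Real.log_le_log (by positivity) ?_) (by positivity)
    linarith

end Fekete

/-! ### Existence of the exponential growth rate of the moments. -/

section Existence

variable {d : ℕ} {Ω : Type*} [mΩ : MeasurableSpace Ω] {p : Lattice d → Lattice d → ℝ}
  {ρ : unitInterval} {P : Measure Ω} [IsProbabilityMeasure P] {ℱ : Filtration ℝ≥0 mΩ}
  {ξ : ℝ≥0 → Ω → Config d} {κ γ : ℝ}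

/-- The box of radius `R` around the origin. -/
def box (d R : ℕ) : Finset (Lattice d) := Fintype.piFinset fun _ => Finset.Icc (-(R : ℤ)) R

lemma mem_box {R : ℕ} {y : Lattice d} : y ∈ box d R ↔ ∀ i, |y i| ≤ (R : ℤ) := by
  simp [box, abs_le]

lemma card_box (d R : ℕ) : (box d R).card = (2 * R + 1) ^ d := by
  rw [box, Fintype.card_piFinset_const, Int.card_Icc]
  congr 1
  omega

-- The datum `1` is split into point masses in the box and the indicator of the complement. The
-- latter contributes at most `1` once the radius exceeds `e` times the total rate times `t`.
open scoped Classical in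
lemma IsPotential.growth_one_le {V : Lattice d → ℝ → ℝ} (hV : IsPotential γ V) (hκ : 0 ≤ κ) {R : ℕ}
    {t : ℝ} (ht : 0 ≤ t) (hR : Real.exp 1 * ((2 * d * κ + γ) * t) ≤ R) :
    growth κ V (fun _ => 1) 0 t ≤ ∑ z ∈ box d R, growth κ V (unitMass z) 0 t + 1 := by
  set h : Option (Lattice d) → Lattice d → ℝ := fun o =>
    o.elim (fun y => if y ∈ box d R then 0 else 1) unitMass with hh
  have hD : ∀ o ∈ (box d R).insertNone, IsDatum (h o) := by
    rintro (_ | z) _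
    · exact ⟨fun x => by simp only [hh, Option.elim]; split_ifs <;> norm_num,
        fun x => by simp only [hh, Option.elim]; split_ifs <;> norm_num⟩
    · exact isDatum_unitMass z
  have e : (fun _ : Lattice d => (1 : ℝ)) = fun y => ∑ o ∈ (box d R).insertNone, 1 * h o y := by
    funext y
    simp only [Finset.sum_insertNone, one_mul, hh, Option.elim]
    have := sum_mul_unitMass (box d R) (fun _ => 1) y
    simp only [one_mul] at this
    rw [this]
    split_ifs <;> norm_num
  rw [e, hV.growth_sum hκ _ _ _ hD 0 ht]
  simp only [Finset.sum_insertNone, one_mul]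
  rw [add_comm]
  refine add_le_add le_rfl ((hV.growth_le_of_vanishing hκ (hD none (by simp)) (R := R) (fun y hy => ?_)
    ht).trans (Real.exp_le_one_iff.2 (by linarith)))
  simp only [hh, Option.elim]
  rw [if_pos (mem_box.2 hy)]

open scoped Classical in
lemma IsPotential.sum_growth_unitMass_le {V : Lattice d → ℝ → ℝ} (hV : IsPotential γ V) (hκ : 0 ≤ κ)
    (Z : Finset (Lattice d)) {t : ℝ} (ht : 0 ≤ t) :
    ∑ z ∈ Z, growth κ V (unitMass z) 0 t ≤ growth κ V (fun _ => 1) 0 t := by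
  have h1 := hV.growth_sum hκ Z (fun _ => 1) unitMass (fun z _ => isDatum_unitMass z) 0 ht
  simp only [one_mul] at h1
  rw [← h1]
  have hs : ∀ y : Lattice d, ∑ z ∈ Z, unitMass z y = if y ∈ Z then 1 else 0 := fun y => by
    simpa using sum_mul_unitMass Z (fun _ => 1) y
  refine (hV.isGrowthSolution_growth hκ isDatum_one).growth_le hV hκ (fun y => ?_)
    (fun y r hr => hV.growth_nonneg hκ isDatum_one y hr) (fun y => ?_) 0 ht
  · exact Finset.sum_nonneg fun z _ => (isDatum_unitMass z).nonneg y
  · rw [hs, growth_zero]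
    split_ifs <;> norm_num

/-- The moments of the growth solution. -/
def growthMoment (P : Measure Ω) (ξ : ℝ≥0 → Ω → Config d) (κ γ : ℝ) (q : ℕ) (g : Lattice d → ℝ)
    (t : ℝ) : ℝ := ∫ ω, growth κ (pot γ ξ 0 ω) g 0 t ^ q ∂P

variable {g : Lattice d → ℝ}

lemma IsVoterModel.integrable_growth_pow {μ : Measure (Config d)} (hξ : IsVoterModel p μ P ℱ ξ)
    (hγ : 0 ≤ γ) (hκ : 0 ≤ κ) (hg : IsDatum g) (i : ℝ≥0 × Lattice d) (x : Lattice d) {t : ℝ}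
    (ht : 0 ≤ t) (q : ℕ) : Integrable (fun ω => growth κ (pot γ ξ i ω) g x t ^ q) P := by
  refine integrable_of_abs_le ((hξ.measurable_growth hγ hκ hg i x ht).pow_const q).aestronglyMeasurable
    (C := Real.exp ((2 * d * κ + γ) * t) ^ q) fun ω => ?_
  have hV := hξ.isPotential_pot hγ i ω
  rw [abs_of_nonneg (pow_nonneg (hV.growth_nonneg hκ hg x ht) q)]
  exact pow_le_pow_left₀ (hV.growth_nonneg hκ hg x ht) (hV.growth_le hκ hg x ht) q

lemma IsVoterModel.growthMoment_nonneg {μ : Measure (Config d)} (hξ : IsVoterModel p μ P ℱ ξ)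
    (hγ : 0 ≤ γ) (hκ : 0 ≤ κ) (hg : IsDatum g) (q : ℕ) {t : ℝ} (ht : 0 ≤ t) :
    0 ≤ growthMoment P ξ κ γ q g t := integral_nonneg fun ω =>
  pow_nonneg ((hξ.isPotential_pot hγ 0 ω).growth_nonneg hκ hg 0 ht) q

lemma IsVoterModel.growthMoment_unitMass_sub (hξ : IsVoterModel p (bernoulliProduct d ρ) P ℱ ξ)
    (hp : IsRandomWalkKernel p) (hγ : 0 ≤ γ) (hκ : 0 ≤ κ) (q : ℕ) (y z : Lattice d) {t : ℝ}
    (ht : 0 ≤ t) : growthMoment P ξ κ γ q (unitMass (z - y)) t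
      = ∫ ω, growth κ (pot γ ξ 0 ω) (unitMass z) y t ^ q ∂P := by
  rw [growthMoment, ← hξ.integral_growth_pow_translate hp hγ hκ (isDatum_unitMass _) q y 0 ht]
  refine integral_congr_ae (Eventually.of_forall fun ω => ?_)
  have h := growth_translate κ (pot γ ξ 0 ω) (unitMass z) y 0 t
  rw [zero_add] at h
  have e : (fun x => pot γ ξ 0 ω (x + y)) = pot γ ξ (0, y) ω := by
    funext x r
    simp [pot]
  simp only [h, e, unitMass_add]

/-- The intermediate site at time `t` splits the solution. For exponents at least `1`, a sum of
powers is at most the power of the sum, positive correlation decouples the two time intervals, and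
translation invariance turns the first factor into a function of `z - y`. -/
lemma IsVoterModel.sum_growthMoment_mul_le (hξ : IsVoterModel p (bernoulliProduct d ρ) P ℱ ξ)
    (hp : IsRandomWalkKernel p) (hγ : 0 ≤ γ) (hκ : 0 ≤ κ) (q : ℕ) {s t : ℝ} (hs : 0 ≤ s)
    (ht : 0 ≤ t) (Y : Finset (Lattice d)) (z : Lattice d) :
    ∑ y ∈ Y, growthMoment P ξ κ γ (q + 1) (unitMass y) s
        * growthMoment P ξ κ γ (q + 1) (unitMass (z - y)) t
      ≤ growthMoment P ξ κ γ (q + 1) (unitMass z) (s + t) := by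
  set W : Lattice d → Ω → ℝ := fun y ω => growth κ (pot γ ξ 0 ω) (unitMass z) y t with hW
  set W' : Lattice d → Ω → ℝ := fun y ω => growth κ (pot γ ξ (t.toNNReal, 0) ω) (unitMass y) 0 s
    with hW'
  have hW0 : ∀ y ω, 0 ≤ W y ω := fun y ω =>
    (hξ.isPotential_pot hγ 0 ω).growth_nonneg hκ (isDatum_unitMass z) y ht
  have hW'0 : ∀ y ω, 0 ≤ W' y ω := fun y ω =>
    (hξ.isPotential_pot hγ _ ω).growth_nonneg hκ (isDatum_unitMass y) 0 hs
  have hint : ∀ y, Integrable (fun ω => W y ω ^ (q + 1) * W' y ω ^ (q + 1)) P := by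
    intro y
    refine integrable_of_abs_le (C := Real.exp ((2 * d * κ + γ) * t) ^ (q + 1)
      * Real.exp ((2 * d * κ + γ) * s) ^ (q + 1)) ?_ fun ω => ?_
    · exact (((hξ.measurable_growth hγ hκ (isDatum_unitMass z) 0 y ht).pow_const _).mul
        ((hξ.measurable_growth hγ hκ (isDatum_unitMass y) _ 0 hs).pow_const _)).aestronglyMeasurable
    · rw [abs_of_nonneg (mul_nonneg (pow_nonneg (hW0 y ω) _) (pow_nonneg (hW'0 y ω) _))]
      refine mul_le_mul (pow_le_pow_left₀ (hW0 y ω) ?_ _) (pow_le_pow_left₀ (hW'0 y ω) ?_ _)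
        (pow_nonneg (hW'0 y ω) _) (by positivity)
      · exact (hξ.isPotential_pot hγ 0 ω).growth_le hκ (isDatum_unitMass z) y ht
      · exact (hξ.isPotential_pot hγ _ ω).growth_le hκ (isDatum_unitMass y) 0 hs
  calc _ ≤ ∑ y ∈ Y, ∫ ω, W y ω ^ (q + 1) * W' y ω ^ (q + 1) ∂P := by
        refine Finset.sum_le_sum fun y _ => ?_
        rw [hξ.growthMoment_unitMass_sub hp hγ hκ (q + 1) y z ht, mul_comm]
        exact hξ.integral_growth_pow_mul_le hp hγ hκ (q + 1) (isDatum_unitMass z)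
          (isDatum_unitMass y) y 0 hs ht
    _ = ∫ ω, ∑ y ∈ Y, W y ω ^ (q + 1) * W' y ω ^ (q + 1) ∂P :=
        (integral_finsetSum _ fun y _ => hint y).symm
    _ ≤ ∫ ω, growth κ (pot γ ξ 0 ω) (unitMass z) 0 (s + t) ^ (q + 1) ∂P := by
        refine integral_mono (integrable_finsetSum _ fun y _ => hint y)
          (hξ.integrable_growth_pow hγ hκ (isDatum_unitMass z) 0 0 (add_nonneg hs ht) _) fun ω => ?_
        simp only [← mul_pow]
        refine (sum_pow_le_pow_sum Y (fun y _ => mul_nonneg (hW0 y ω) (hW'0 y ω)) q).trans ?_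
        refine pow_le_pow_left₀ (Finset.sum_nonneg fun y _ => mul_nonneg (hW0 y ω) (hW'0 y ω)) ?_ _
        rw [add_comm s t]
        refine (hξ.isPotential_pot hγ 0 ω).sum_growth_mul_le hκ (isDatum_unitMass z)
          (hξ.isPotential_pot hγ (t.toNNReal, 0) ω) hs ht (fun x r hr => ?_) Y 0
        simp only [pot, Real.toNNReal_add ht hr, Prod.snd_zero, Prod.fst_zero, zero_add, add_zero]

lemma IsVoterModel.sum_growthMoment_le {μ : Measure (Config d)} (hξ : IsVoterModel p μ P ℱ ξ)
    (hγ : 0 ≤ γ) (hκ : 0 ≤ κ) (q : ℕ) {t : ℝ} (ht : 0 ≤ t) (Z : Finset (Lattice d)) :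
    ∑ z ∈ Z, growthMoment P ξ κ γ (q + 1) (unitMass z) t
      ≤ growthMoment P ξ κ γ (q + 1) (fun _ => 1) t := by
  have hi := fun z => hξ.integrable_growth_pow hγ hκ (isDatum_unitMass z) 0 0 ht (q + 1)
  simp only [growthMoment]
  rw [← integral_finsetSum _ fun z _ => hi z]
  refine integral_mono (integrable_finsetSum _ fun z _ => hi z)
    (hξ.integrable_growth_pow hγ hκ isDatum_one 0 0 ht (q + 1)) fun ω => ?_
  have hV := hξ.isPotential_pot hγ 0 ω
  have h0 := fun z => hV.growth_nonneg hκ (isDatum_unitMass z) 0 ht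
  exact (sum_pow_le_pow_sum Z (fun z _ => h0 z) q).trans (pow_le_pow_left₀
    (Finset.sum_nonneg fun z _ => h0 z) (hV.sum_growth_unitMass_le hκ Z ht) _)

lemma IsVoterModel.growthMoment_one_le {μ : Measure (Config d)} (hξ : IsVoterModel p μ P ℱ ξ)
    (hγ : 0 ≤ γ) (hκ : 0 ≤ κ) (q : ℕ) {t : ℝ} (ht : 0 ≤ t) {R : ℕ}
    (hR : Real.exp 1 * ((2 * d * κ + γ) * t) ≤ R) :
    growthMoment P ξ κ γ (q + 1) (fun _ => 1) t ≤ 2 ^ q * (((2 * R + 1) ^ d) ^ q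
      * ∑ z ∈ box d R, growthMoment P ξ κ γ (q + 1) (unitMass z) t + 1) := by
  have hi := fun z => hξ.integrable_growth_pow hγ hκ (isDatum_unitMass z) 0 0 ht (q + 1)
  simp only [growthMoment]
  rw [← integral_finsetSum _ fun z _ => hi z, ← integral_const_mul]
  have hi' := (integrable_finsetSum (box d R) fun z _ => hi z).const_mul
    ((((2 * R + 1 : ℝ) ^ d) ^ q))
  have e : ∫ ω, (2 : ℝ) ^ q * (((2 * R + 1 : ℝ) ^ d) ^ q
      * ∑ z ∈ box d R, growth κ (pot γ ξ 0 ω) (unitMass z) 0 t ^ (q + 1) + 1) ∂P = _ :=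
    (integral_const_mul _ _).trans (congrArg _ (integral_add hi' (integrable_const 1)))
  rw [integral_const, probReal_univ, one_smul] at e
  rw [← e]
  refine integral_mono (hξ.integrable_growth_pow hγ hκ isDatum_one 0 0 ht (q + 1))
    ((hi'.add (integrable_const _)).const_mul _) fun ω => ?_
  have hV := hξ.isPotential_pot hγ 0 ω
  have h0 := fun z => hV.growth_nonneg hκ (isDatum_unitMass z) 0 ht
  have h1 := pow_le_pow_left₀ (hV.growth_nonneg hκ isDatum_one 0 ht) (hV.growth_one_le hκ ht hR) (q + 1)
  have h2 := add_pow_le (Finset.sum_nonneg fun z (_ : z ∈ box d R) => h0 z) zero_le_one (q + 1)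
  have h3 := pow_sum_le_card_mul_sum_pow (s := box d R) (fun z _ => h0 z) q
  rw [card_box] at h3
  push_cast at h3
  rw [one_pow, Nat.add_sub_cancel] at h2
  exact h1.trans (h2.trans (mul_le_mul_of_nonneg_left (add_le_add h3 le_rfl) (by positivity)))

/-- The exponential growth rate of the moments of the growth solution exists. -/
theorem IsVoterModel.exists_tendsto_log_growthMoment
    (hξ : IsVoterModel p (bernoulliProduct d ρ) P ℱ ξ)
    (hp : IsRandomWalkKernel p) (hγ : 0 ≤ γ) (hκ : 0 ≤ κ) (q : ℕ) :
    ∃ l, Tendsto (fun t => Real.log (growthMoment P ξ κ γ (q + 1) (fun _ => 1) t) / t) atTop (𝓝 l) := by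
  set a : ℝ → Lattice d → ℝ := fun t z => growthMoment P ξ κ γ (q + 1) (unitMass z) t with ha
  set G : ℝ → ℝ := growthMoment P ξ κ γ (q + 1) fun _ => 1 with hG
  have ha0 : ∀ t, 0 ≤ t → ∀ z, 0 ≤ a t z := fun t ht z =>
    hξ.growthMoment_nonneg hγ hκ (isDatum_unitMass z) _ ht
  have hsum : ∀ t, 0 ≤ t → Summable (a t) := fun t ht =>
    summable_of_sum_le (ha0 t ht) fun Z => hξ.sum_growthMoment_le hγ hκ q ht Z
  set A : ℝ → ℝ := fun t => ∑' z, a t z with hA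
  have hAG : ∀ t, 0 ≤ t → A t ≤ G t := fun t ht =>
    Real.tsum_le_of_sum_le (ha0 t ht) fun Z => hξ.sum_growthMoment_le hγ hκ q ht Z
  have hA1 : ∀ t, 0 ≤ t → 1 ≤ A t := by
    intro t ht
    refine le_trans ?_ ((hsum t ht).le_tsum 0 fun z _ => ha0 t ht z)
    have e1 : ∫ _, (1 : ℝ) ∂P = 1 := by simp
    rw [← e1]
    refine integral_mono (integrable_const _)
      (hξ.integrable_growth_pow hγ hκ (isDatum_unitMass 0) 0 0 ht (q + 1)) fun ω => ?_
    have hV := hξ.isPotential_pot hγ 0 ω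
    refine one_le_pow₀ ?_
    refine le_trans ?_ ((hV.summable_picard hκ (isDatum_unitMass 0) 0 ht).le_tsum 0
      fun n _ => hV.picard_nonneg hκ (isDatum_unitMass 0).nonneg n 0 ht)
    simp [picard, unitMass]
  -- The total mass over all point sources is used because it is supermultiplicative; the moment for
  -- the datum `1` is only sandwiched by it.
  have hAA : ∀ s t, 0 ≤ s → 0 ≤ t → A s * A t ≤ A (s + t) := fun s t hs ht =>
    tsum_mul_tsum_le_of_convolution (ha0 s hs) (ha0 t ht) (hsum t ht) (hsum _ (add_nonneg hs ht))
      fun Y z => hξ.sum_growthMoment_mul_le hp hγ hκ q hs ht Y z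
  set c := 2 * d * κ + γ with hc
  have hc0 : 0 ≤ c := by positivity
  have hGle : ∀ t, 0 ≤ t → G t ≤ Real.exp (c * t) ^ (q + 1) := by
    intro t ht
    have e1 : ∫ _, Real.exp (c * t) ^ (q + 1) ∂P = Real.exp (c * t) ^ (q + 1) := by simp
    rw [← e1]
    refine integral_mono (hξ.integrable_growth_pow hγ hκ isDatum_one 0 0 ht (q + 1))
      (integrable_const _) fun ω => ?_
    have hV := hξ.isPotential_pot hγ 0 ω
    exact pow_le_pow_left₀ (hV.growth_nonneg hκ isDatum_one 0 ht) (hV.growth_le hκ isDatum_one 0 ht) _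
  obtain ⟨l, hl⟩ := exists_tendsto_div_of_superadditive (b := fun t => Real.log (A t))
    (C := (q + 1 : ℕ) * c) (fun t ht => Real.log_nonneg (hA1 t ht)) (fun t ht => by
      refine (Real.log_le_log (by linarith [hA1 t ht]) ((hAG t ht).trans (hGle t ht))).trans ?_
      rw [Real.log_pow, Real.log_exp, mul_assoc]) (fun s t hs ht => by
      rw [← Real.log_mul (by linarith [hA1 s hs]) (by linarith [hA1 t ht])]
      exact Real.log_le_log (mul_pos (by linarith [hA1 s hs]) (by linarith [hA1 t ht]))
        (hAA s t hs ht))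
  refine ⟨l, ?_⟩
  -- The upper bound comes from `G ≤ 2 ^ (q + 1) * D ^ (d * q) * A`, where `D` is linear in `t` and
  -- bounds the side of the box; the logarithm of the prefactor is negligible against `t`.
  have hup : Tendsto (fun t => ((q + 1 : ℕ) * Real.log 2) / t + ((d * q : ℕ) : ℝ)
      * (Real.log (2 * (Real.exp 1 * c) * t + 3) / t) + Real.log (A t) / t) atTop
      (𝓝 (0 + ((d * q : ℕ) : ℝ) * 0 + l)) :=
    ((tendsto_const_nhds.div_atTop tendsto_id).add ((tendsto_log_linear_div (by positivity)).const_mul _)).add hl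
  rw [mul_zero, add_zero, zero_add] at hup
  refine tendsto_of_tendsto_of_tendsto_of_le_of_le' hl hup ?_ ?_
  · filter_upwards [eventually_gt_atTop 0] with t ht
    exact div_le_div_of_nonneg_right
      (Real.log_le_log (by linarith [hA1 t ht.le]) (hAG t ht.le)) ht.le
  · filter_upwards [eventually_gt_atTop 0] with t ht
    rw [mul_div_assoc', ← add_div, ← add_div]
    refine div_le_div_of_nonneg_right ?_ ht.le
    have hy0 : 0 ≤ Real.exp 1 * (c * t) := by positivity
    set R := ⌈Real.exp 1 * (c * t)⌉₊ with hR
    have h1 : G t ≤ 2 ^ q * (((2 * R + 1 : ℝ) ^ d) ^ q * ∑ z ∈ box d R, a t z + 1) :=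
      hξ.growthMoment_one_le hγ hκ q ht.le (Nat.le_ceil _)
    have hRle : (2 * R + 1 : ℝ) ≤ 2 * (Real.exp 1 * c) * t + 3 := by
      have := (Nat.ceil_lt_add_one hy0).le
      rw [← hR] at this
      linarith
    have hA1t := hA1 t ht.le
    have h2 : ∑ z ∈ box d R, a t z ≤ A t := (hsum t ht.le).sum_le_tsum _ fun z _ => ha0 t ht.le z
    set D := 2 * (Real.exp 1 * c) * t + 3 with hD
    have hD1 : 1 ≤ D := by
      have : 0 ≤ 2 * (Real.exp 1 * c) * t := by positivity
      linarith
    have h3 : G t ≤ 2 ^ (q + 1) * D ^ (d * q) * A t := by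
      have h4 : ((2 * R + 1 : ℝ) ^ d) ^ q * ∑ z ∈ box d R, a t z ≤ D ^ (d * q) * A t := by
        rw [← pow_mul]
        exact mul_le_mul (pow_le_pow_left₀ (by positivity) hRle _) h2
          (Finset.sum_nonneg fun z _ => ha0 t ht.le z) (by positivity)
      have h5 : 1 ≤ D ^ (d * q) * A t := one_le_mul_of_one_le_of_one_le (one_le_pow₀ hD1) hA1t
      calc G t ≤ 2 ^ q * (D ^ (d * q) * A t + D ^ (d * q) * A t) :=
            h1.trans (mul_le_mul_of_nonneg_left (add_le_add h4 h5) (by positivity))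
        _ = _ := by ring
    have hGpos : 0 < G t := by linarith [hAG t ht.le]
    have hApos : 0 < A t := by linarith
    have hDpos : 0 < D := by linarith
    refine (Real.log_le_log hGpos h3).trans (le_of_eq ?_)
    rw [Real.log_mul (by positivity) hApos.ne', Real.log_mul (by positivity) (by positivity),
      Real.log_pow, Real.log_pow]

end Existence

/-! ### Powers of the solution as subsolutions. -/

section PowGrowth

variable {d : ℕ} {κ γ : ℝ} {V : Lattice d → ℝ → ℝ}

/-- Young's inequality. It bounds the hopping term in the derivative of `w ^ (m + 1)` by hopping of
`w ^ (m + 1)` plus a multiple of `w ^ (m + 1)` itself. -/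
lemma pow_mul_le_add_pow {a b : ℝ} (ha : 0 ≤ a) (hb : 0 ≤ b) (m : ℕ) :
    (m + 1) * a ^ m * b ≤ m * a ^ (m + 1) + b ^ (m + 1) := by
  induction m with
  | zero => simp
  | succ m ih =>
    have h1 := mul_le_mul_of_nonneg_right ih hb
    have h2 : 0 ≤ (m + 1) * a ^ m * (a - b) ^ 2 := by positivity
    push_cast
    have e1 : a ^ (m + 1 + 1) = a ^ m * a ^ 2 := by ring
    have e2 : a ^ (m + 1) = a ^ m * a := by ring
    have e3 : b ^ (m + 1 + 1) = b ^ (m + 1) * b := by ring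
    rw [e1, e2, e3]
    rw [e2] at h1
    linarith

lemma IsPotential.intervalIntegrable (hV : IsPotential γ V) (x : Lattice d) (a b : ℝ) :
    IntervalIntegrable (V x) volume a b := by
  simpa using hV.intervalIntegrable_mul (a := a) (b := b) x (continuousOn_const (c := (1 : ℝ)))

lemma IsPotential.hasDerivWithinAt_integral (hV : IsPotential γ V) (x : Lattice d) {t : ℝ} :
    HasDerivWithinAt (fun t => ∫ s in (0 : ℝ)..t, V x s) (V x t) (Set.Ici t) t := by
  have hm : StronglyMeasurableAtFilter (V x) (𝓝[Set.Ioi t] t) volume :=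
    ⟨Set.univ, univ_mem, (hV.measurable x).aestronglyMeasurable⟩
  exact intervalIntegral.integral_hasDerivWithinAt_right (s := Set.Ici t) (t := Set.Ioi t)
    (hV.intervalIntegrable x 0 t) hm ((hV.right_continuous x t).mono Set.Ioi_subset_Ici_self)

/-- The power `m + 1` of the solution of the parabolic Anderson model, with the exponential factor that
removes the loss term. -/
def powGrowth (κ : ℝ) (V : Lattice d → ℝ → ℝ) (m : ℕ) (x : Lattice d) (t : ℝ) : ℝ :=
  growth κ V (fun _ => 1) x t ^ (m + 1) * Real.exp (-(2 * d * κ * m * t))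

lemma IsPotential.powGrowth_nonneg (hV : IsPotential γ V) (hκ : 0 ≤ κ) (m : ℕ) (x : Lattice d) {t : ℝ}
    (ht : 0 ≤ t) : 0 ≤ powGrowth κ V m x t :=
  mul_nonneg (pow_nonneg (hV.growth_nonneg hκ isDatum_one x ht) _) (Real.exp_pos _).le

lemma IsPotential.continuousOn_powGrowth (hV : IsPotential γ V) (hκ : 0 ≤ κ) (m : ℕ) (x : Lattice d) :
    ContinuousOn (powGrowth κ V m x) (Set.Ici 0) :=
  ((hV.continuousOn_growth hκ isDatum_one x).pow _).mul (Continuous.continuousOn (by fun_prop))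

/-- The powers of the solution satisfy a Duhamel inequality for the potential `(m + 1) V`. -/
theorem IsPotential.powGrowth_le (hV : IsPotential γ V) (hκ : 0 ≤ κ) (m : ℕ) (x : Lattice d) {t : ℝ}
    (ht : 0 ≤ t) : powGrowth κ V m x t ≤ Real.exp ((m + 1) * ∫ s in (0 : ℝ)..t, V x s)
      + ∫ r in (0 : ℝ)..t, Real.exp ((m + 1) * ∫ s in r..t, V x s)
        * (κ * nbSum (fun y => powGrowth κ V m y r) x) := by
  set w := growth κ V (fun _ : Lattice d => 1) with hw
  have hsol : IsGrowthSolution κ V w := hV.isGrowthSolution_growth hκ isDatum_one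
  have hw0 : ∀ y r, 0 ≤ r → 0 ≤ w y r := fun y r hr => hV.growth_nonneg hκ isDatum_one y hr
  -- `exp (-I)` is the integrating factor for the potential `(m + 1) V`; only the hopping term is
  -- left in the bound on the derivative of `y`.
  set I : ℝ → ℝ := fun t => (m + 1) * ∫ s in (0 : ℝ)..t, V x s with hI
  have hIc : Continuous I :=
    continuous_const.mul (intervalIntegral.continuous_primitive (hV.intervalIntegrable x) 0)
  set E : ℝ → ℝ := fun r => Real.exp (-(2 * d * κ * m * r)) with hE
  set y : ℝ → ℝ := fun r => Real.exp (-I r) * powGrowth κ V m x r with hy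
  have hcy : ContinuousOn y (Set.Icc 0 t) :=
    (Continuous.continuousOn (by fun_prop)).mul
      ((hV.continuousOn_powGrowth hκ m x).mono Set.Icc_subset_Ici_self)
  have hcφ : ContinuousOn (fun r => Real.exp (-I r) * (κ * nbSum (fun y => powGrowth κ V m y r) x))
      (Set.Icc 0 t) := by
    refine (Continuous.continuousOn (by fun_prop)).mul (continuousOn_const.mul ?_)
    exact continuousOn_nbSum (fun y => (hV.continuousOn_powGrowth hκ m y).mono Set.Icc_subset_Ici_self) x
  have hder : ∀ r, 0 ≤ r → HasDerivWithinAt y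
      (Real.exp (-I r) * -((m + 1) * V x r) * powGrowth κ V m x r + Real.exp (-I r)
        * ((((m + 1 : ℕ) : ℝ) * w x r ^ m * growthRate κ V w x r) * E r
          + w x r ^ (m + 1) * (E r * -(2 * d * κ * m)))) (Set.Ici r) r := by
    intro r hr
    have h1 : HasDerivWithinAt (fun r => Real.exp (-I r)) (Real.exp (-I r) * -((m + 1) * V x r))
        (Set.Ici r) r := ((hV.hasDerivWithinAt_integral x).const_mul _).neg.exp
    have h2 : HasDerivWithinAt E (E r * -(2 * d * κ * m)) (Set.Ici r) r := by
      have := (((hasDerivAt_id r).const_mul (2 * d * κ * m)).neg.exp).hasDerivWithinAt (s := Set.Ici r)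
      simpa [hE] using this
    exact h1.mul (((hsol.equation x r hr).pow (m + 1)).mul h2)
  have key := intervalIntegral.sub_le_integral_of_hasDeriv_right_of_le ht hcy
    (fun r hr => (hder r hr.1.le).mono Set.Ioi_subset_Ici_self) hcφ.integrableOn_Icc (fun r hr => by
      have hr0 : 0 ≤ r := hr.1.le
      -- Summing Young's inequality over the `2 d` neighbours leaves the excess `2 d m w ^ (m + 1)`,
      -- which the exponential factor in `powGrowth` cancels.
      have h3 : (m + 1) * w x r ^ m * nbSum (fun y => w y r) x
          ≤ 2 * d * m * w x r ^ (m + 1) + nbSum (fun y => w y r ^ (m + 1)) x := by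
        have h4 : ∑ k : Fin d × Bool, (m + 1) * w x r ^ m * w (nb k x) r
            ≤ ∑ k : Fin d × Bool, (m * w x r ^ (m + 1) + w (nb k x) r ^ (m + 1)) :=
          Finset.sum_le_sum fun k _ => pow_mul_le_add_pow (hw0 x r hr0) (hw0 _ r hr0) m
        rw [← Finset.mul_sum, Finset.sum_add_distrib, Finset.sum_const, Finset.card_univ,
          Fintype.card_prod, Fintype.card_fin, Fintype.card_bool, nsmul_eq_mul] at h4
        push_cast at h4
        refine h4.trans (le_of_eq ?_)
        simp only [nbSum]
        ring
      have h5 : nbSum (fun y => powGrowth κ V m y r) x = nbSum (fun y => w y r ^ (m + 1)) x * E r :=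
        (Finset.sum_mul _ _ _).symm
      have h6 : powGrowth κ V m x r = w x r ^ (m + 1) * E r := rfl
      rw [h5, h6]
      have h7 := mul_le_mul_of_nonneg_left h3
        (mul_nonneg (mul_nonneg (Real.exp_pos (-I r)).le (Real.exp_pos (-(2 * d * κ * m * r))).le) hκ)
      have h8 : w x r ^ (m + 1) = w x r ^ m * w x r := pow_succ _ _
      simp only [growthRate]
      push_cast
      rw [h8] at h7 ⊢
      simp only [hE]
      linarith)
  have hy0 : y 0 = 1 := by
    simp [hy, hI, powGrowth, growth_zero]
  rw [hy0] at key
  have h9 : powGrowth κ V m x t = Real.exp (I t) * y t := by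
    simp only [hy]
    rw [← mul_assoc, ← Real.exp_add, add_neg_cancel, Real.exp_zero, one_mul]
  have h10 : ∫ r in (0 : ℝ)..t, Real.exp ((m + 1) * ∫ s in r..t, V x s)
        * (κ * nbSum (fun y => powGrowth κ V m y r) x)
      = Real.exp (I t) * ∫ r in (0 : ℝ)..t, Real.exp (-I r)
        * (κ * nbSum (fun y => powGrowth κ V m y r) x) := by
    rw [← intervalIntegral.integral_const_mul]
    refine intervalIntegral.integral_congr fun r _ => ?_
    have h11 := intervalIntegral.integral_add_adjacent_intervals (hV.intervalIntegrable x 0 r)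
      (hV.intervalIntegrable x r t)
    rw [← mul_assoc (Real.exp (I t)), ← Real.exp_add]
    congr 2
    simp only [hI]
    rw [← h11]
    ring
  rw [h9, h10]
  have := mul_le_mul_of_nonneg_left key (Real.exp_pos (I t)).le
  linarith

end PowGrowth

/-! ### From moments of the solution to occupation times along deterministic paths. -/

section Paths

variable {d : ℕ} {Ω : Type*} [mΩ : MeasurableSpace Ω] {p : Lattice d → Lattice d → ℝ}
  {μ : Measure (Config d)} {P : Measure Ω} [IsProbabilityMeasure P] {ℱ : Filtration ℝ≥0 mΩ}
  {ξ : ℝ≥0 → Ω → Config d} {κ γ : ℝ}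

/-- The occupation indicator along the path `X`. -/
def along (ξ : ℝ≥0 → Ω → Config d) (X : ℝ → Lattice d) (s : ℝ) (ω : Ω) : ℝ :=
  occ {X s} (ξ s.toNNReal ω)

lemma along_nonneg (X : ℝ → Lattice d) (s : ℝ) (ω : Ω) : 0 ≤ along ξ X s ω := occ_nonneg _ _

lemma along_le_one (X : ℝ → Lattice d) (s : ℝ) (ω : Ω) : along ξ X s ω ≤ 1 := occ_le_one _ _

lemma abs_along_le_one (X : ℝ → Lattice d) (s : ℝ) (ω : Ω) : |along ξ X s ω| ≤ 1 := by
  rw [abs_of_nonneg (along_nonneg X s ω)]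
  exact along_le_one X s ω

lemma IsVoterModel.measurable_uncurry_along (hξ : IsVoterModel p μ P ℱ ξ) {X : ℝ → Lattice d}
    (hX : Measurable X) : Measurable (Function.uncurry (along ξ X)) := by
  have h : Measurable fun q : Lattice d × (ℝ × Ω) => occ {q.1} (ξ q.2.1.toNNReal q.2.2) :=
    measurable_from_prod_countable_right fun x => hξ.measurable_uncurry (continuous_occ {x})
  exact h.comp ((hX.comp measurable_fst).prodMk measurable_id)

lemma IsVoterModel.intervalIntegrable_along (hξ : IsVoterModel p μ P ℱ ξ) {X : ℝ → Lattice d}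
    (hX : Measurable X) (ω : Ω) (a b : ℝ) :
    IntervalIntegrable (fun s => along ξ X s ω) volume a b := by
  refine (intervalIntegrable_const (c := (1 : ℝ))).mono_fun
    ((hξ.measurable_uncurry_along hX).comp measurable_prodMk_right).aestronglyMeasurable
    (Eventually.of_forall fun s => ?_)
  simpa using abs_along_le_one X s ω

lemma IsVoterModel.integral_along_le (hξ : IsVoterModel p μ P ℱ ξ) {X : ℝ → Lattice d}
    (hX : Measurable X) (ω : Ω) {a b : ℝ} (hab : a ≤ b) : ∫ s in a..b, along ξ X s ω ≤ b - a := by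
  refine (intervalIntegral.integral_mono_on hab (hξ.intervalIntegrable_along hX ω a b)
    (intervalIntegrable_const (c := (1 : ℝ))) fun s _ => along_le_one X s ω).trans ?_
  simp

lemma IsVoterModel.measurable_uncurry_exp_along (hξ : IsVoterModel p μ P ℱ ξ) {X : ℝ → Lattice d}
    (hX : Measurable X) (θ T : ℝ) :
    Measurable (Function.uncurry fun r ω => Real.exp (θ * ∫ s in r..T, along ξ X s ω)) := by
  refine measurable_uncurry_of_rightContinuous (fun r => ?_) fun ω r => ?_
  · exact ((measurable_intervalIntegral (hξ.measurable_uncurry_along hX) r T).const_mul θ).exp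
  · have h : Continuous fun r => ∫ s in r..T, along ξ X s ω := by
      simp only [intervalIntegral.integral_symm T]
      exact (intervalIntegral.continuous_primitive (hξ.intervalIntegrable_along hX ω) T).neg
    exact (Continuous.continuousWithinAt (by fun_prop))

lemma IsVoterModel.measurable_uncurry_powGrowth (hξ : IsVoterModel p μ P ℱ ξ) (hγ : 0 ≤ γ)
    (hκ : 0 ≤ κ) (m : ℕ) (x : Lattice d) :
    Measurable (Function.uncurry fun r ω => powGrowth κ (pot γ ξ 0 ω) m x (max r 0)) := by
  refine measurable_uncurry_of_rightContinuous (fun r => ?_) fun ω r => ?_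
  · exact ((hξ.measurable_growth hγ hκ isDatum_one 0 x (le_max_right r 0)).pow_const _).mul_const _
  · have h : Continuous fun r => powGrowth κ (pot γ ξ 0 ω) m x (max r 0) :=
      ((hξ.isPotential_pot hγ 0 ω).continuousOn_powGrowth hκ m x).comp_continuous (by fun_prop)
        fun r => le_max_right r 0
    exact h.continuousWithinAt

lemma IsPotential.powGrowth_le_exp {V : Lattice d → ℝ → ℝ} (hV : IsPotential γ V) (hκ : 0 ≤ κ) (m : ℕ)
    (x : Lattice d) {t T : ℝ} (ht : 0 ≤ t) (htT : t ≤ T) :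
    powGrowth κ V m x t ≤ Real.exp ((2 * d * κ + γ) * T) ^ (m + 1) := by
  have h1 : growth κ V (fun _ => 1) x t ≤ Real.exp ((2 * d * κ + γ) * T) :=
    (hV.growth_le hκ isDatum_one x ht).trans
      (Real.exp_le_exp.2 (mul_le_mul_of_nonneg_left htT (hV.rate_nonneg hκ)))
  refine (mul_le_of_le_one_right (pow_nonneg (hV.growth_nonneg hκ isDatum_one x ht) _) ?_).trans
    (pow_le_pow_left₀ (hV.growth_nonneg hκ isDatum_one x ht) h1 _)
  rw [Real.exp_le_one_iff, neg_nonpos]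
  positivity

/-- The Duhamel inequality for the powers of the solution, multiplied with the contribution of a path
after time `t`. -/
lemma IsVoterModel.exp_along_mul_powGrowth_le (hξ : IsVoterModel p μ P ℱ ξ) (hγ : 0 ≤ γ) (hκ : 0 ≤ κ)
    (m : ℕ) (x : Lattice d) {X X' : ℝ → Lattice d} (hX : Measurable X') {t T : ℝ} (ht : 0 ≤ t)
    (htT : t ≤ T) (h1 : ∀ s ≤ t, X' s = x) (h2 : ∀ s, t < s → X' s = X s) (ω : Ω) :
    Real.exp ((m + 1) * γ * ∫ s in t..T, along ξ X s ω) * powGrowth κ (pot γ ξ 0 ω) m x t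
      ≤ Real.exp ((m + 1) * γ * ∫ s in (0 : ℝ)..T, along ξ X' s ω)
        + ∫ r in (0 : ℝ)..t, ∑ k : Fin d × Bool, κ * (Real.exp ((m + 1) * γ
          * ∫ s in r..T, along ξ X' s ω) * powGrowth κ (pot γ ξ 0 ω) m (nb k x) (max r 0)) := by
  have hV := hξ.isPotential_pot hγ 0 ω
  have h := mul_le_mul_of_nonneg_left (hV.powGrowth_le hκ m x ht)
    (Real.exp_pos ((m + 1) * γ * ∫ s in t..T, along ξ X s ω)).le
  have e1 : ∫ s in t..T, along ξ X s ω = ∫ s in t..T, along ξ X' s ω := by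
    refine intervalIntegral.integral_congr_ae (Eventually.of_forall fun s hs => ?_)
    rw [Set.uIoc_of_le htT] at hs
    rw [along, along, h2 s hs.1]
  have e2 : ∀ r ≤ t, Real.exp ((m + 1) * γ * ∫ s in t..T, along ξ X s ω)
      * Real.exp ((m + 1) * ∫ s in r..t, pot γ ξ 0 ω x s)
      = Real.exp ((m + 1) * γ * ∫ s in r..T, along ξ X' s ω) := by
    intro r hr
    have e3 : ∫ s in r..t, pot γ ξ 0 ω x s = γ * ∫ s in r..t, along ξ X' s ω := by
      rw [← intervalIntegral.integral_const_mul]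
      refine intervalIntegral.integral_congr_ae (Eventually.of_forall fun s hs => ?_)
      rw [Set.uIoc_of_le hr] at hs
      simp [pot, along, h1 s hs.2]
    rw [← Real.exp_add, e1, e3, ← intervalIntegral.integral_add_adjacent_intervals
      (hξ.intervalIntegrable_along hX ω r t) (hξ.intervalIntegrable_along hX ω t T)]
    congr 1
    ring
  rw [mul_add, e2 0 ht, ← intervalIntegral.integral_const_mul
    (Real.exp ((m + 1) * γ * ∫ s in t..T, along ξ X s ω))] at h
  refine h.trans (le_of_eq ?_)
  congr 1
  refine intervalIntegral.integral_congr fun r hr => ?_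
  rw [Set.uIcc_of_le ht] at hr
  rw [← mul_assoc, e2 r hr.2, max_eq_left hr.1, nbSum, Finset.mul_sum, Finset.mul_sum]
  exact Finset.sum_congr rfl fun k _ => by ring

/-- A uniform bound on the exponential moments of the occupation time along deterministic paths
bounds the moments of the solution. -/
theorem IsVoterModel.integral_powGrowth_le (hξ : IsVoterModel p μ P ℱ ξ) (hγ : 0 ≤ γ) (hκ : 0 ≤ κ)
    (m : ℕ) {T S : ℝ} (hT : 0 ≤ T)
    (hS : ∀ X : ℝ → Lattice d, Measurable X →
      ∫ ω, Real.exp ((m + 1) * γ * ∫ s in (0 : ℝ)..T, along ξ X s ω) ∂P ≤ S) :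
    ∫ ω, powGrowth κ (pot γ ξ 0 ω) m 0 T ∂P ≤ S * Real.exp (2 * d * κ * T) := by
  set θ : ℝ := (m + 1) * γ with hθ
  have hθ0 : 0 ≤ θ := by positivity
  set c : ℝ := 2 * d * κ with hc
  have hc0 : 0 ≤ c := by positivity
  set B : ℝ := Real.exp (θ * T) * Real.exp ((2 * d * κ + γ) * T) ^ (m + 1) with hB
  have hS0 : 0 ≤ S := (integral_nonneg fun ω => (Real.exp_pos _).le).trans (hS (fun _ => 0) measurable_const)
  have hnn : ∀ X x r ω, 0 ≤ Real.exp (θ * ∫ s in r..T, along ξ X s ω)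
      * powGrowth κ (pot γ ξ 0 ω) m x (max r 0) := fun X x r ω => mul_nonneg (Real.exp_pos _).le
    ((hξ.isPotential_pot hγ 0 ω).powGrowth_nonneg hκ m x (le_max_right r 0))
  have hbd : ∀ X, Measurable X → ∀ x r, r ∈ Set.Icc 0 T → ∀ ω,
      Real.exp (θ * ∫ s in r..T, along ξ X s ω) * powGrowth κ (pot γ ξ 0 ω) m x (max r 0) ≤ B := by
    intro X hX x r hr ω
    have hV := hξ.isPotential_pot hγ 0 ω
    rw [max_eq_left hr.1]
    refine mul_le_mul (Real.exp_le_exp.2 (mul_le_mul_of_nonneg_left ?_ hθ0))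
      (hV.powGrowth_le_exp hκ m x hr.1 hr.2) (hV.powGrowth_nonneg hκ m x hr.1) (Real.exp_pos _).le
    linarith [hξ.integral_along_le hX ω hr.2, hr.1]
  have hmeas : ∀ X, Measurable X → ∀ x, Measurable (Function.uncurry fun r ω =>
      Real.exp (θ * ∫ s in r..T, along ξ X s ω) * powGrowth κ (pot γ ξ 0 ω) m x (max r 0)) :=
    fun X hX x => (hξ.measurable_uncurry_exp_along hX θ T).mul
      (hξ.measurable_uncurry_powGrowth hγ hκ m x)
  have hint : ∀ X, Measurable X → ∀ x r, r ∈ Set.Icc 0 T → Integrable (fun ω =>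
      Real.exp (θ * ∫ s in r..T, along ξ X s ω) * powGrowth κ (pot γ ξ 0 ω) m x (max r 0)) P :=
    fun X hX x r hr => integrable_of_abs_le
      ((hmeas X hX x).comp measurable_prodMk_left).aestronglyMeasurable (C := B) fun ω => by
        rw [abs_of_nonneg (hnn X x r ω)]
        exact hbd X hX x r hr ω
  -- Iterating Duhamel's inequality backwards in time prolongs the path after `t` by one jump each
  -- time. The closed part stays below `S * exp (c t)`, and the remainder carries the factor `(c t)
  -- ^ n / n!`.
  have key : ∀ (n : ℕ) (t : ℝ), t ∈ Set.Icc 0 T → ∀ x X, Measurable X →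
      ∫ ω, Real.exp (θ * ∫ s in t..T, along ξ X s ω) * powGrowth κ (pot γ ξ 0 ω) m x (max t 0) ∂P
        ≤ S * Real.exp (c * t) + (c * t) ^ n / n.factorial * B := by
    intro n
    induction n with
    | zero =>
      intro t ht x X hX
      have h1 : ∫ ω, Real.exp (θ * ∫ s in t..T, along ξ X s ω)
          * powGrowth κ (pot γ ξ 0 ω) m x (max t 0) ∂P ≤ ∫ _, B ∂P :=
        integral_mono (hint X hX x t ht) (integrable_const _) fun ω => hbd X hX x t ht ω
      rw [integral_const, probReal_univ, one_smul] at h1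
      have h2 : 0 ≤ S * Real.exp (c * t) := mul_nonneg hS0 (Real.exp_pos _).le
      simp only [pow_zero, Nat.factorial_zero, Nat.cast_one, div_one, one_mul]
      linarith
    | succ n ih =>
      intro t ht x X hX
      -- The new path waits at `x` until time `t` and then follows the given one.
      set X' : ℝ → Lattice d := fun s => if s ≤ t then x else X s with hX'
      have hX'm : Measurable X' := Measurable.ite measurableSet_Iic measurable_const hX
      set J : ℝ → Ω → ℝ := fun r ω => ∑ k : Fin d × Bool, κ * (Real.exp (θ
          * ∫ s in r..T, along ξ X' s ω) * powGrowth κ (pot γ ξ 0 ω) m (nb k x) (max r 0)) with hJ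
      have hJm : Measurable (Function.uncurry J) :=
        Finset.measurable_fun_sum _ fun k _ => (hmeas X' hX'm (nb k x)).const_mul κ
      have hJb : ∀ r ∈ Set.Icc 0 t, ∀ ω, |J r ω| ≤ c * B := by
        intro r hr ω
        rw [abs_of_nonneg (Finset.sum_nonneg fun k _ => mul_nonneg hκ (hnn _ _ _ _))]
        refine (Finset.sum_le_sum fun k _ => mul_le_mul_of_nonneg_left
          (hbd X' hX'm (nb k x) r ⟨hr.1, hr.2.trans ht.2⟩ ω) hκ).trans (le_of_eq ?_)
        rw [Finset.sum_const, Finset.card_univ, Fintype.card_prod, Fintype.card_fin,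
          Fintype.card_bool, nsmul_eq_mul]
        push_cast
        ring
      have hprod := integrable_prod_of_abs_le (P := P) ht.1 hJm hJb
      have hA : Integrable (fun ω => Real.exp (θ * ∫ s in (0 : ℝ)..T, along ξ X' s ω)) P := by
        refine integrable_of_abs_le ((hξ.measurable_uncurry_exp_along hX'm θ T).comp
          measurable_prodMk_left).aestronglyMeasurable (C := Real.exp (θ * T)) fun ω => ?_
        rw [abs_of_pos (Real.exp_pos _)]
        refine Real.exp_le_exp.2 (mul_le_mul_of_nonneg_left ?_ hθ0)
        simpa using hξ.integral_along_le hX'm ω hT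
      have hI : Integrable (fun ω => ∫ r in (0 : ℝ)..t, J r ω) P := by
        refine integrable_of_abs_le (measurable_intervalIntegral hJm 0 t).aestronglyMeasurable
          (C := c * B * t) fun ω => ?_
        have := intervalIntegral.norm_integral_le_of_norm_le_const (a := 0) (b := t)
          (f := fun r => J r ω) (C := c * B) fun r hr => by
            rw [Set.uIoc_of_le ht.1] at hr
            exact hJb r ⟨hr.1.le, hr.2⟩ ω
        rwa [sub_zero, abs_of_nonneg ht.1] at this
      have hJr : ∀ r ∈ Set.Icc 0 t, ∫ ω, J r ω ∂P
          ≤ c * (S * Real.exp (c * r)) + c * ((c * r) ^ n / n.factorial) * B := by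
        intro r hr
        have hr' : r ∈ Set.Icc 0 T := ⟨hr.1, hr.2.trans ht.2⟩
        rw [integral_finsetSum _ fun k _ => (hint X' hX'm (nb k x) r hr').const_mul κ]
        simp only [integral_const_mul]
        refine (Finset.sum_le_sum fun k _ => mul_le_mul_of_nonneg_left
          (ih r hr' (nb k x) X' hX'm) hκ).trans (le_of_eq ?_)
        rw [Finset.sum_const, Finset.card_univ, Fintype.card_prod, Fintype.card_fin,
          Fintype.card_bool, nsmul_eq_mul]
        push_cast
        ring
      have hle : ∫ ω, Real.exp (θ * ∫ s in t..T, along ξ X s ω)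
          * powGrowth κ (pot γ ξ 0 ω) m x (max t 0) ∂P
          ≤ ∫ ω, (Real.exp (θ * ∫ s in (0 : ℝ)..T, along ξ X' s ω) + ∫ r in (0 : ℝ)..t, J r ω) ∂P := by
        refine integral_mono (hint X hX x t ht) (hA.add hI) fun ω => ?_
        have := hξ.exp_along_mul_powGrowth_le hγ hκ m x (X := X) hX'm ht.1 ht.2
          (fun s hs => if_pos hs) (fun s hs => if_neg (not_le.2 hs)) ω
        beta_reduce
        rw [max_eq_left ht.1]
        exact this
      rw [integral_add hA hI, ← MeasureTheory.intervalIntegral_integral_swap hprod] at hle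
      have hii : IntervalIntegrable (fun r => ∫ ω, J r ω ∂P) volume 0 t := by
        rw [intervalIntegrable_iff]
        exact hprod.integral_prod_left
      have h3 := intervalIntegral.integral_mono_on ht.1 hii
        (Continuous.intervalIntegrable (by fun_prop) _ _) hJr
      have h4 : ∫ r in (0 : ℝ)..t, c * (S * Real.exp (c * r)) = S * Real.exp (c * t) - S := by
        have hd : ∀ r ∈ Set.uIcc 0 t, HasDerivAt (fun r => S * Real.exp (c * r))
            (c * (S * Real.exp (c * r))) r := fun r _ => by
          have := (((hasDerivAt_id r).const_mul c).exp).const_mul S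
          refine this.congr_deriv ?_
          simp only [id]
          ring
        rw [intervalIntegral.integral_eq_sub_of_hasDerivAt hd
          (Continuous.intervalIntegrable (by fun_prop) _ _)]
        simp
      rw [intervalIntegral.integral_add (Continuous.intervalIntegrable (by fun_prop) _ _)
        (Continuous.intervalIntegrable (by fun_prop) _ _), h4, intervalIntegral.integral_mul_const,
        integral_mul_pow_div_factorial] at h3
      linarith [hS X' hX'm]
  have hlim : Tendsto (fun n : ℕ => S * Real.exp (c * T) + (c * T) ^ n / n.factorial * B) atTop
      (𝓝 (S * Real.exp (c * T) + 0 * B)) :=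
    ((Real.summable_pow_div_factorial (c * T)).tendsto_atTop_zero.mul_const B).const_add _
  rw [zero_mul, add_zero] at hlim
  refine ge_of_tendsto' hlim fun n => ?_
  have := key n T ⟨hT, le_rfl⟩ 0 (fun _ => 0) measurable_const
  simpa [max_eq_left hT] using this

end Paths

/-! ### Exponential moments of the occupation time along a path. -/

section Energy

variable {d : ℕ} {Ω : Type*} [mΩ : MeasurableSpace Ω] {p : Lattice d → Lattice d → ℝ}
  {μ : Measure (Config d)} {P : Measure Ω} [IsProbabilityMeasure P] {ℱ : Filtration ℝ≥0 mΩ}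
  {ξ : ℝ≥0 → Ω → Config d}

lemma strictMono_fin_add_le {n : ℕ} {f : Fin n → ℕ} (hf : StrictMono f) (a : Fin n) (m : ℕ)
    (h : a + m < n) : f a + m ≤ f ⟨a + m, h⟩ := by
  induction m with
  | zero => exact le_rfl
  | succ m ih =>
    have h1 := ih (by omega)
    have h2 : f ⟨a + m, by omega⟩ < f ⟨a + (m + 1), h⟩ := hf (Fin.mk_lt_mk.2 (by omega))
    omega

lemma exp_mul_along (a : ℝ) (X : ℝ → Lattice d) (s : ℝ) (ω : Ω) :
    Real.exp (a * along ξ X s ω) = 1 + (Real.exp a - 1) * along ξ X s ω := by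
  rw [along, occ_singleton]
  split_ifs <;> simp

lemma IsVoterModel.measurable_along (hξ : IsVoterModel p μ P ℱ ξ) (X : ℝ → Lattice d) (s : ℝ) :
    Measurable (along ξ X s) := (measurable_occ _).comp (hξ.measurable _)

variable {M : ℕ} {r : ℝ}

/-- The joint occupation probabilities along an arithmetic progression of times. -/
lemma integral_prod_along_le
    (hr : ∀ (n : ℕ) (t : ℕ → ℝ≥0) (x : ℕ → Lattice d),
      (∀ i k, i < k → k < n → (t k : ℝ) + (k - i) * M ≤ t i) →
      ∫ ω, ∏ k : Fin n, occ {x k} (ξ (t k) ω) ∂P ≤ r ^ n)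
    (X : ℝ → Lattice d) {s : ℝ} (hs : 0 ≤ s) (J : Finset ℕ) :
    ∫ ω, ∏ k ∈ J, along ξ X (s + k * M) ω ∂P ≤ r ^ J.card := by
  -- The occupation bound is stated for decreasing times, so `J` is enumerated from its largest
  -- element down.
  set e : Fin J.card → ℕ := fun i => J.orderEmbOfFin rfl (Fin.rev i) with he
  set j : ℕ → ℕ := fun i => if h : i < J.card then e ⟨i, h⟩ else 0 with hj
  have hgap : ∀ i k, i < k → k < J.card → j k + (k - i) ≤ j i := by
    intro i k hik hk
    have hi : i < J.card := hik.trans hk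
    simp only [hj, dif_pos hk, dif_pos hi, he]
    have h := strictMono_fin_add_le (J.orderEmbOfFin rfl).strictMono (Fin.rev ⟨k, hk⟩) (k - i)
      (by simp only [Fin.val_rev]; omega)
    refine h.trans (le_of_eq ?_)
    congr 1
    ext
    simp only [Fin.val_rev]
    omega
  have h := hr J.card (fun i => (s + j i * M).toNNReal) (fun i => X (s + j i * M)) fun i k hik hk => by
    have h0 : ∀ i, (0 : ℝ) ≤ s + j i * M := fun i => by positivity
    rw [Real.coe_toNNReal _ (h0 k), Real.coe_toNNReal _ (h0 i)]
    have h1 : (j k : ℝ) + (k - i) ≤ j i := by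
      have := hgap i k hik hk
      rw [← Nat.cast_sub hik.le]
      exact_mod_cast this
    have := mul_le_mul_of_nonneg_right h1 (Nat.cast_nonneg (α := ℝ) M)
    linarith
  refine le_trans (le_of_eq (integral_congr_ae (Eventually.of_forall fun ω => ?_))) h
  have h2 : ∀ i : Fin J.card, j i = J.orderEmbOfFin rfl (Fin.revPerm i) := fun i => by
    simp [hj, he]
  calc ∏ k ∈ J, along ξ X (s + k * M) ω
      = ∏ k ∈ Finset.univ.map (J.orderEmbOfFin rfl).toEmbedding, along ξ X (s + k * M) ω := by
        rw [Finset.map_orderEmbOfFin_univ]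
    _ = ∏ i : Fin J.card, along ξ X (s + (J.orderEmbOfFin rfl i : ℕ) * M) ω := by
        rw [Finset.prod_map]; rfl
    _ = ∏ i : Fin J.card, along ξ X (s + (J.orderEmbOfFin rfl (Fin.revPerm i) : ℕ) * M) ω :=
        (Equiv.prod_comp Fin.revPerm fun i : Fin J.card =>
          along ξ X (s + (J.orderEmbOfFin rfl i : ℕ) * M) ω).symm
    _ = _ := by simp only [along, h2]

/-- As the variables take the values `0` and `1`, the exponential is a product of factors `1 + (exp
a - 1) ξ`. Its expansion has nonnegative coefficients, and each monomial is bounded by a power of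
`r`, as if the variables were independent. -/
lemma IsVoterModel.integral_exp_sum_along_le (hξ : IsVoterModel p μ P ℱ ξ)
    (hr : ∀ (n : ℕ) (t : ℕ → ℝ≥0) (x : ℕ → Lattice d),
      (∀ i k, i < k → k < n → (t k : ℝ) + (k - i) * M ≤ t i) →
      ∫ ω, ∏ k : Fin n, occ {x k} (ξ (t k) ω) ∂P ≤ r ^ n)
    (X : ℝ → Lattice d) {s a : ℝ} (hs : 0 ≤ s) (ha : 0 ≤ a) (n : ℕ) :
    ∫ ω, Real.exp (a * ∑ k ∈ Finset.range n, along ξ X (s + k * M) ω) ∂P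
      ≤ (1 + (Real.exp a - 1) * r) ^ n := by
  have hb : 0 ≤ Real.exp a - 1 := sub_nonneg.2 (Real.one_le_exp ha)
  have h1 : ∀ ω, Real.exp (a * ∑ k ∈ Finset.range n, along ξ X (s + k * M) ω)
      = ∑ J ∈ (Finset.range n).powerset,
        (Real.exp a - 1) ^ J.card * ∏ k ∈ J, along ξ X (s + k * M) ω := by
    intro ω
    rw [Finset.mul_sum, Real.exp_sum]
    simp only [exp_mul_along]
    rw [Finset.prod_one_add]
    simp only [Finset.prod_mul_distrib, Finset.prod_const]
  have h2 : (1 + (Real.exp a - 1) * r) ^ n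
      = ∑ J ∈ (Finset.range n).powerset, (Real.exp a - 1) ^ J.card * r ^ J.card := by
    have := Finset.prod_one_add (f := fun _ => (Real.exp a - 1) * r) (Finset.range n)
    simp only [Finset.prod_const, Finset.card_range, mul_pow] at this
    exact this
  have hi : ∀ J : Finset ℕ, Integrable (fun ω =>
      (Real.exp a - 1) ^ J.card * ∏ k ∈ J, along ξ X (s + k * M) ω) P := fun J => by
    refine (integrable_of_abs_le (C := 1) (Finset.measurable_fun_prod _ fun k _ =>
      hξ.measurable_along X _).aestronglyMeasurable fun ω => ?_).const_mul _
    rw [abs_of_nonneg (Finset.prod_nonneg fun k _ => along_nonneg X _ ω)]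
    exact Finset.prod_le_one (fun k _ => along_nonneg X _ ω) fun k _ => along_le_one X _ ω
  rw [h2]
  simp only [h1]
  rw [integral_finsetSum _ fun J _ => hi J]
  refine Finset.sum_le_sum fun J _ => ?_
  rw [integral_const_mul]
  exact mul_le_mul_of_nonneg_left (integral_prod_along_le hr X hs J) (pow_nonneg hb _)

/-- Jensen's inequality for the exponential function on an interval. -/
lemma mul_exp_integral_le {g : ℝ → ℝ} {L θ : ℝ} (hL : 0 ≤ L) (hg : IntervalIntegrable g volume 0 L)
    (he : IntervalIntegrable (fun s => Real.exp (L * θ * g s)) volume 0 L) :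
    L * Real.exp (θ * ∫ s in (0 : ℝ)..L, g s) ≤ ∫ s in (0 : ℝ)..L, Real.exp (L * θ * g s) := by
  set I := ∫ s in (0 : ℝ)..L, g s with hI
  have h1 : ∫ s in (0 : ℝ)..L, Real.exp (θ * I) * (L * θ * g s - θ * I + 1)
      ≤ ∫ s in (0 : ℝ)..L, Real.exp (L * θ * g s) := by
    refine intervalIntegral.integral_mono_on hL ?_ he fun s _ => ?_
    · exact (((hg.const_mul _).sub intervalIntegrable_const).add intervalIntegrable_const).const_mul _
    · have := mul_le_mul_of_nonneg_left (Real.add_one_le_exp (L * θ * g s - θ * I))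
        (Real.exp_pos (θ * I)).le
      rwa [← Real.exp_add, add_sub_cancel] at this
  refine le_trans (le_of_eq ?_) h1
  rw [intervalIntegral.integral_const_mul, intervalIntegral.integral_add
    ((hg.const_mul _).sub intervalIntegrable_const) intervalIntegrable_const,
    intervalIntegral.integral_sub (hg.const_mul _) intervalIntegrable_const,
    intervalIntegral.integral_const_mul, ← hI]
  simp only [intervalIntegral.integral_const, smul_eq_mul]
  ring

/-- The exponential moments of the occupation time along a deterministic path have a growth rate
that is strictly smaller than the maximal one. -/
theorem IsVoterModel.integral_exp_along_le (hξ : IsVoterModel p μ P ℱ ξ) (hM : 0 < M)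
    (hr : ∀ (n : ℕ) (t : ℕ → ℝ≥0) (x : ℕ → Lattice d),
      (∀ i k, i < k → k < n → (t k : ℝ) + (k - i) * M ≤ t i) →
      ∫ ω, ∏ k : Fin n, occ {x k} (ξ (t k) ω) ∂P ≤ r ^ n)
    {X : ℝ → Lattice d} (hX : Measurable X) {θ T : ℝ} (hθ : 0 ≤ θ) (hT : 0 ≤ T) :
    ∫ ω, Real.exp (θ * ∫ s in (0 : ℝ)..T, along ξ X s ω) ∂P
      ≤ Real.exp (θ * M) * (1 + (Real.exp (M * θ) - 1) * r) ^ ⌊T / M⌋₊ := by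
  have hM' : (0 : ℝ) < M := by exact_mod_cast hM
  set n := ⌊T / M⌋₊ with hn
  have hn1 : (n : ℝ) * M ≤ T := (le_div_iff₀ hM').1 (Nat.floor_le (by positivity))
  have hn2 : T ≤ n * M + M := by
    have := (div_lt_iff₀ hM').1 (Nat.lt_floor_add_one (T / M))
    linarith
  set g : ℝ → Ω → ℝ := fun s ω => ∑ k ∈ Finset.range n, along ξ X (s + k * M) ω with hg
  have hgk : ∀ k : ℕ, Measurable (Function.uncurry fun s ω => along ξ X (s + k * M) ω) := fun k =>
    (hξ.measurable_uncurry_along hX).comp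
      ((measurable_fst.add_const ((k : ℝ) * M)).prodMk measurable_snd)
  have hgm : Measurable (Function.uncurry g) := Finset.measurable_fun_sum _ fun k _ => hgk k
  have hg0 : ∀ s ω, 0 ≤ g s ω := fun s ω => Finset.sum_nonneg fun k _ => along_nonneg X _ ω
  have hg1 : ∀ s ω, g s ω ≤ n := fun s ω => by
    refine (Finset.sum_le_sum fun k _ => along_le_one X _ ω).trans ?_
    simp
  have hgi : ∀ ω, IntervalIntegrable (fun s => g s ω) volume 0 M := fun ω => by
    refine (intervalIntegrable_const (c := (n : ℝ))).mono_fun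
      (hgm.comp measurable_prodMk_right).aestronglyMeasurable (Eventually.of_forall fun s => ?_)
    show ‖g s ω‖ ≤ ‖(n : ℝ)‖
    rw [Real.norm_of_nonneg (hg0 s ω), Real.norm_of_nonneg (Nat.cast_nonneg n)]
    exact hg1 s ω
  set F : ℝ → Ω → ℝ := fun s ω => Real.exp (M * θ * g s ω) with hF
  have hFm : Measurable (Function.uncurry F) := (hgm.const_mul _).exp
  have hFb : ∀ s ω, |F s ω| ≤ Real.exp (M * θ * n) := fun s ω => by
    rw [abs_of_pos (Real.exp_pos _)]
    exact Real.exp_le_exp.2 (mul_le_mul_of_nonneg_left (hg1 s ω) (by positivity))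
  have hFi : ∀ ω, IntervalIntegrable (fun s => F s ω) volume 0 M := fun ω => by
    refine (intervalIntegrable_const (c := Real.exp (M * θ * n))).mono_fun
      (hFm.comp measurable_prodMk_right).aestronglyMeasurable (Eventually.of_forall fun s => ?_)
    exact (hFb s ω).trans (le_abs_self _)
  -- The interval `[0, n M]` is folded onto `[0, M]`; the remaining piece has length at most `M`.
  have hpath : ∀ ω, ∫ s in (0 : ℝ)..T, along ξ X s ω ≤ (∫ s in (0 : ℝ)..M, g s ω) + M := by
    intro ω
    have hii := hξ.intervalIntegrable_along hX ω
    have h1 : ∫ s in (0 : ℝ)..M, g s ω = ∫ s in (0 : ℝ)..(n * M), along ξ X s ω := by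
      have h2 := intervalIntegral.sum_integral_adjacent_intervals (f := fun s => along ξ X s ω)
        (μ := volume) (a := fun k : ℕ => (k : ℝ) * M) (n := n) fun k _ => hii _ _
      simp only [CharP.cast_eq_zero, zero_mul] at h2
      rw [← h2, intervalIntegral.integral_finsetSum fun k _ => ?_]
      · refine Finset.sum_congr rfl fun k _ => ?_
        rw [intervalIntegral.integral_comp_add_right (fun s => along ξ X s ω)]
        congr 1
        · simp
        · push_cast; ring
      · refine (intervalIntegrable_const (c := (1 : ℝ))).mono_fun
          ((hgk k).comp measurable_prodMk_right).aestronglyMeasurable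
          (Eventually.of_forall fun s => ?_)
        simpa using abs_along_le_one X (s + k * M) ω
    rw [h1, ← intervalIntegral.integral_add_adjacent_intervals (hii 0 (n * M)) (hii (n * M) T)]
    linarith [hξ.integral_along_le hX ω hn1]
  have hprod := integrable_prod_of_abs_le (P := P) hM'.le hFm (C := Real.exp (M * θ * n))
    fun s _ ω => hFb s ω
  have hFI : Integrable (fun ω => ∫ s in (0 : ℝ)..M, F s ω) P := by
    refine integrable_of_abs_le (measurable_intervalIntegral hFm 0 M).aestronglyMeasurable
      (C := Real.exp (M * θ * n) * |(M : ℝ) - 0|) fun ω => ?_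
    exact intervalIntegral.norm_integral_le_of_norm_le_const (f := fun s => F s ω)
      fun s _ => hFb s ω
  have hle : ∀ ω, Real.exp (θ * ∫ s in (0 : ℝ)..T, along ξ X s ω)
      ≤ Real.exp (θ * M) * (1 / M) * ∫ s in (0 : ℝ)..M, F s ω := by
    intro ω
    -- Jensen over the offset `s` reduces the integral to progressions `s + k M`, at the price of
    -- the exponent `M θ` instead of `θ`.
    have h1 := mul_exp_integral_le hM'.le (hgi ω) (hFi ω) (θ := θ)
    have h2 : Real.exp (θ * ∫ s in (0 : ℝ)..T, along ξ X s ω)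
        ≤ Real.exp (θ * M) * Real.exp (θ * ∫ s in (0 : ℝ)..M, g s ω) := by
      rw [← Real.exp_add, ← mul_add, add_comm]
      exact Real.exp_le_exp.2 (mul_le_mul_of_nonneg_left (hpath ω) hθ)
    refine h2.trans ?_
    rw [mul_assoc]
    refine mul_le_mul_of_nonneg_left ?_ (Real.exp_pos _).le
    rw [one_div, ← div_eq_inv_mul, le_div_iff₀ hM', mul_comm]
    exact h1
  have hEi : Integrable (fun ω => Real.exp (θ * ∫ s in (0 : ℝ)..T, along ξ X s ω)) P := by
    refine integrable_of_abs_le ((hξ.measurable_uncurry_exp_along hX θ T).comp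
      measurable_prodMk_left).aestronglyMeasurable (C := Real.exp (θ * T)) fun ω => ?_
    rw [abs_of_pos (Real.exp_pos _)]
    refine Real.exp_le_exp.2 (mul_le_mul_of_nonneg_left ?_ hθ)
    simpa using hξ.integral_along_le hX ω hT
  have h3 := integral_mono hEi (hFI.const_mul (Real.exp (θ * M) * (1 / M))) hle
  rw [integral_const_mul, ← MeasureTheory.intervalIntegral_integral_swap hprod] at h3
  have hii : IntervalIntegrable (fun s => ∫ ω, F s ω ∂P) volume 0 M := by
    rw [intervalIntegrable_iff]
    exact hprod.integral_prod_left
  have h4 := intervalIntegral.integral_mono_on hM'.le hii (intervalIntegrable_const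
    (c := (1 + (Real.exp (M * θ) - 1) * r) ^ n)) fun s hs =>
      hξ.integral_exp_sum_along_le hr X hs.1 (mul_nonneg hM'.le hθ) n
  rw [intervalIntegral.integral_const, smul_eq_mul, sub_zero] at h4
  refine h3.trans ((mul_le_mul_of_nonneg_left h4 (by positivity)).trans (le_of_eq ?_))
  field_simp

end Energy

/-! ### The parabolic Anderson model and the strict bound. -/

section Anderson

variable {d : ℕ} {Ω : Type*} [mΩ : MeasurableSpace Ω] {p : Lattice d → Lattice d → ℝ}
  {P : Measure Ω} [IsProbabilityMeasure P] {ℱ : Filtration ℝ≥0 mΩ}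
  {ξ : ℝ≥0 → Ω → Config d} {κ γ : ℝ}

/-- The solution of the parabolic Anderson model is the growth solution with the loss factor. -/
lemma IsVoterModel.eq_growth_of_isPAMSolution {μ : Measure (Config d)} (hξ : IsVoterModel p μ P ℱ ξ)
    (hγ : 0 ≤ γ) (hκ : 0 ≤ κ) {ω : Ω} {v : Lattice d → ℝ → ℝ}
    (hv : IsPAMSolution κ γ (fun t => ξ t ω) v) (x : Lattice d) {t : ℝ} (ht : 0 ≤ t) :
    v x t = Real.exp (-(2 * d * κ * t)) * growth κ (pot γ ξ 0 ω) (fun _ => 1) x t := by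
  have hexp : ∀ t : ℝ, HasDerivAt (fun t => Real.exp (2 * d * κ * t))
      (Real.exp (2 * d * κ * t) * (2 * d * κ)) t := fun t => by
    simpa using ((hasDerivAt_id t).const_mul (2 * d * κ)).exp
  have hsol : IsGrowthSolution κ (pot γ ξ 0 ω) fun x t => Real.exp (2 * d * κ * t) * v x t := by
    refine ⟨fun x => (Continuous.continuousOn (by fun_prop)).mul (hv.continuousOn x),
      fun x t ht => ?_⟩
    refine ((hexp t).hasDerivWithinAt.mul (hv.equation x t ht)).congr_deriv ?_
    simp only [growthRate, nbSum_const_mul, latticeLaplacian_eq, pot, Prod.snd_zero, Prod.fst_zero,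
      zero_add, add_zero, occ_singleton]
    ring
  have h := hsol.eq_growth (hξ.isPotential_pot hγ 0 ω) hκ isDatum_one
    (fun x t ht => mul_nonneg (Real.exp_pos _).le (hv.nonneg x t ht))
    (fun x => by simp [hv.initial x]) x ht
  rw [← h, ← mul_assoc, ← Real.exp_add, neg_add_cancel, Real.exp_zero, one_mul]

lemma IsVoterModel.growthMoment_one_pos {μ : Measure (Config d)} (hξ : IsVoterModel p μ P ℱ ξ)
    (hγ : 0 ≤ γ) (hκ : 0 ≤ κ) (q : ℕ) {t : ℝ} (ht : 0 ≤ t) :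
    0 < growthMoment P ξ κ γ q (fun _ => 1) t := by
  refine lt_of_lt_of_le one_pos ?_
  have h := integral_mono (integrable_const (1 : ℝ))
    (hξ.integrable_growth_pow hγ hκ isDatum_one 0 0 ht q) fun ω => one_le_pow₀ ?_
  · simpa [growthMoment] using h
  have hV := hξ.isPotential_pot hγ 0 ω
  exact (hV.summable_picard hκ isDatum_one 0 ht).le_tsum 0
    fun n _ => hV.picard_nonneg hκ isDatum_one.nonneg n 0 ht

variable {ρ : unitInterval}

/-- The growth rate of the moments is strictly smaller than that of a fully occupied lattice. -/
theorem IsVoterModel.tendsto_log_growthMoment_lt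
    (hξ : IsVoterModel p (bernoulliProduct d ρ) P ℱ ξ) (hp : IsRandomWalkKernel p)
    (hsymm : ∀ x y, p x y = p y x) (htrans : StronglyTransient p) (hρ : ρ < 1) (hγ : 0 < γ)
    (hκ : 0 ≤ κ) (m : ℕ) {l : ℝ}
    (hl : Tendsto (fun t => Real.log (growthMoment P ξ κ γ (m + 1) (fun _ => 1) t) / t) atTop (𝓝 l)) :
    l < 2 * d * κ * (m + 1) + (m + 1) * γ := by
  obtain ⟨M, hM, r, hr0, hr1, hr⟩ := hξ.exists_moment_rate hp hsymm htrans hρ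
  have hM' : (0 : ℝ) < M := by exact_mod_cast hM
  set θ : ℝ := (m + 1) * γ with hθ
  have hθ0 : 0 < θ := by positivity
  set D : ℝ := 1 + (Real.exp (M * θ) - 1) * r with hD
  have hE : 0 < Real.exp (M * θ) - 1 := sub_pos.2 (Real.one_lt_exp_iff.2 (by positivity))
  have hD1 : 1 ≤ D := by
    have := mul_pos hE hr0
    linarith
  -- `D` is a convex combination of `1` and `exp (M θ)` with weight `r < 1` on the latter;
  -- strictness of the final inequality comes from here.
  have hDlt : Real.log D < M * θ := by
    rw [Real.log_lt_iff_lt_exp (by linarith)]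
    nlinarith
  have hbound : ∀ t, 0 ≤ t → Real.log (growthMoment P ξ κ γ (m + 1) (fun _ => 1) t)
      ≤ θ * M + t / M * Real.log D + 2 * d * κ * (m + 1) * t := by
    intro t ht
    have h1 := hξ.integral_powGrowth_le hγ.le hκ m ht fun X hX =>
      hξ.integral_exp_along_le hM hr hX hθ0.le ht
    simp only [powGrowth] at h1
    rw [integral_mul_const] at h1
    have h2 : growthMoment P ξ κ γ (m + 1) (fun _ => 1) t
        ≤ Real.exp (θ * M) * D ^ ⌊t / M⌋₊ * Real.exp (2 * d * κ * (m + 1) * t) := by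
      have h3 := mul_le_mul_of_nonneg_right h1 (Real.exp_pos (2 * d * κ * m * t)).le
      rw [mul_assoc (∫ _, _ ∂P), ← Real.exp_add, neg_add_cancel, Real.exp_zero, mul_one,
        mul_assoc (_ * _), ← Real.exp_add] at h3
      refine h3.trans (le_of_eq ?_)
      congr 2
      ring
    refine (Real.log_le_log (hξ.growthMoment_one_pos hγ.le hκ _ ht) h2).trans ?_
    rw [Real.log_mul (by positivity) (Real.exp_pos _).ne', Real.log_mul (Real.exp_pos _).ne'
      (by positivity), Real.log_exp, Real.log_exp, Real.log_pow]
    have := mul_le_mul_of_nonneg_right (Nat.floor_le (div_nonneg ht hM'.le)) (Real.log_nonneg hD1)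
    linarith
  have hlim : Tendsto (fun t : ℝ => θ * M / t + Real.log D / M + 2 * d * κ * (m + 1)) atTop
      (𝓝 (0 + Real.log D / M + 2 * d * κ * (m + 1))) :=
    ((tendsto_const_nhds.div_atTop tendsto_id).add_const _).add_const _
  have hle : l ≤ 0 + Real.log D / M + 2 * d * κ * (m + 1) := by
    refine le_of_tendsto_of_tendsto hl hlim ?_
    filter_upwards [eventually_gt_atTop 0] with t ht
    rw [div_le_iff₀ ht]
    refine (hbound t ht.le).trans (le_of_eq ?_)
    field_simp
  have : Real.log D / M < θ := by
    rw [div_lt_iff₀ hM']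
    linarith
  linarith

end Anderson

end VoterPAM

end

theorem mainTheorem1 {d : ℕ} (p : VoterPAM.Lattice d → VoterPAM.Lattice d → ℝ)
    (hp : VoterPAM.IsRandomWalkKernel p) (hsymm : ∀ x y, p x y = p y x)
    (htrans : VoterPAM.StronglyTransient p)
    (ρ : unitInterval) (hρ0 : 0 < ρ) (hρ1 : ρ < 1) (γ : ℝ) (hγ : 0 < γ)
    {Ω : Type*} [mΩ : MeasurableSpace Ω] (P : Measure Ω) [IsProbabilityMeasure P]
    (ℱ : Filtration ℝ≥0 mΩ) (ξ : ℝ≥0 → Ω → VoterPAM.Config d)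
    (hξ : VoterPAM.IsVoterModel p (VoterPAM.bernoulliProduct d ρ) P ℱ ξ)
    (q : ℕ) (hq : 1 ≤ q) (κ : ℝ) (hκ : 0 ≤ κ)
    (u : VoterPAM.Lattice d → ℝ → Ω → ℝ)
    (hu : ∀ᵐ ω ∂P, VoterPAM.IsPAMSolution κ γ (fun t => ξ t ω) (fun x t => u x t ω)) :
    ∃ l : ℝ, VoterPAM.IsAnnealedLyapunovExponent P u q l ∧ l < γ := by
  obtain ⟨m, rfl⟩ := Nat.exists_eq_add_of_le' hq
  obtain ⟨l, hl⟩ := hξ.exists_tendsto_log_growthMoment hp hγ.le hκ m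
  have hlt := hξ.tendsto_log_growthMoment_lt hp hsymm htrans hρ1 hγ hκ m hl
  have hm : (0 : ℝ) < m + 1 := by positivity
  -- `l` is the rate of the `(m + 1)`-th moment without the loss term. The loss factor subtracts `2
  -- d κ (m + 1)`, and the root divides by `m + 1`.
  refine ⟨(l - 2 * d * κ * (m + 1)) / (m + 1), ?_, ?_⟩
  · refine ((hl.sub_const (2 * d * κ * (m + 1))).div_const (m + 1)).congr' ?_
    filter_upwards [eventually_gt_atTop 0] with t ht
    have hpos := hξ.growthMoment_one_pos hγ.le hκ (m + 1) ht.le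
    have h1 : ∫ ω, u 0 t ω ^ (m + 1) ∂P = Real.exp (-(2 * d * κ * t)) ^ (m + 1)
        * VoterPAM.growthMoment P ξ κ γ (m + 1) (fun _ => 1) t := by
      rw [VoterPAM.growthMoment, ← integral_const_mul]
      refine integral_congr_ae ?_
      filter_upwards [hu] with ω hω
      rw [hξ.eq_growth_of_isPAMSolution hγ.le hκ hω 0 ht.le, mul_pow]
    rw [h1, Real.log_rpow (by positivity), Real.log_mul (by positivity) hpos.ne', Real.log_pow,
      Real.log_exp]
    push_cast
    field_simp
    ring
  · rw [div_lt_iff₀ hm]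
    linarith
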